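/- Work on the Hilbert space $L^2(\mathbb{R}^n)$ of $n$ modes, with quadrature vector $\hat{\mathbf R}=(\hat x_1,\hat p_1,\dots,\hat x_n,\hat p_n)$, where $\hat x_j$ is multiplication by $x_j$ and $\hat p_j=-i\,\partial_{x_j}$, and energy operator $\hat E_n=\tfrac12\sum_{k=1}^{2n}\hat R_k^2$. A state is a positive operator of unit trace. For a state $\rho$ of finite energy $\operatorname{Tr}[\rho\hat E_n]<\infty$, let $\mathbf m(\rho)\in\mathbb{R}^{2n}$ be its first moment, $m_k(\rho)=\operatorname{Tr}[\hat R_k\rho]$, and let $V(\rho)\in\mathbb{R}^{2n\times 2n}$ be its covariance matrix, $V(\rho)_{kl}=\operatorname{Tr}[\{\hat R_k-m_k(\rho),\hat R_l-m_l(\rho)\}\rho]$ with $\{A,B\}=AB+BA$. A Gaussian state is a state in the trace-norm closure of the set of Gibbs states $e^{-\beta\hat H}/\operatorname{Tr}[e^{-\beta\hat H}]$, $\beta>0$, of quadratic Hamiltonians $\hat H=\tfrac12(\hat{\mathbf R}-\mathbf m)^{\intercal}h(\hat{\mathbf R}-\mathbf m)$ with $\mathbf m\in\mathbb{R}^{2n}$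 and $h\in\mathbb{R}^{2n\times 2n}$ symmetric and positive definite. **Theorem.** Let $\psi=|\psi\rangle\langle\psi|$ be a pure $n$-mode Gaussian state and let $\rho$ be any (possibly mixed and non-Gaussian) $n$-mode state of finite energy. Then $$\|\rho-\psi\|_1\le\sqrt{\operatorname{Tr}V(\psi)}\,\sqrt{2\|\mathbf m(\rho)-\mathbf m(\psi)\|^2+\|V(\rho)-V(\psi)\|_\infty}.$$ Consequently, for every $E\in\mathbb{R}$ with $\operatorname{Tr}[\psi\hat E_n]\le E$ (in particular if both $\psi$ and $\rho$ have energy at most $E$), $$\tfrac12\|\rho-\psi\|_1\le\sqrt{E}\,\sqrt{2\|\mathbf m(\rho)-\mathbf m(\psi)\|^2+\|V(\rho)-V(\psi)\|_\infty}.$$ Here $\|A\|_1=\operatorname{Tr}\sqrt{A^\dagger A}$ is the trace norm, $\|\cdot\|$ the Euclidean norm and $\|\cdot\|_\infty$ the operator norm. -/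

import Mathlib

open MeasureTheory
open scoped ENNReal InnerProductSpace SchwartzMap

noncomputable section

namespace CVSystem

/-! ### Traces and trace norm on a Hilbert space -/

section Trace

variable {H : Type*} [NormedAddCommGroup H] [InnerProductSpace ℂ H] [CompleteSpace H]

/-- The index set of a fixed orthonormal basis of `H`. -/
def onbIndex (H : Type*) [NormedAddCommGroup H] [InnerProductSpace ℂ H] [CompleteSpace H] :
    Set H :=
  (exists_hilbertBasis ℂ H).choose

/-- A fixed orthonormal basis of `H`, used to write traces. -/
def onb (H : Type*) [NormedAddCommGroup H] [InnerProductSpace ℂ H] [CompleteSpace H] :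
    HilbertBasis (onbIndex H) ℂ H :=
  (exists_hilbertBasis ℂ H).choose_spec.choose

/-- The trace `∑ᵢ ⟨eᵢ, A eᵢ⟩ ∈ [0, ∞]` of a positive bounded operator `A`. It does not depend on
the orthonormal basis, see `posTrace_eq_tsum`. -/
def posTrace (A : H →L[ℂ] H) : ℝ≥0∞ :=
  ∑' i, ENNReal.ofReal (RCLike.re ⟪onb H i, A (onb H i)⟫_ℂ)

/-- The trace norm `‖A‖₁ = Tr √(A† A) ∈ [0, ∞]`. -/
def traceNorm (A : H →L[ℂ] H) : ℝ≥0∞ :=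
  posTrace (CFC.abs A)

/-- Quantum states: positive operators of unit trace. -/
structure IsState (ρ : H →L[ℂ] H) : Prop where
  isPositive : ρ.IsPositive
  trace_eq_one : posTrace ρ = 1

/-- `ρ = |ψ⟩⟨ψ|` for a unit vector `ψ`. -/
def IsPure (ρ : H →L[ℂ] H) : Prop :=
  ∃ ψ : H, ‖ψ‖ = 1 ∧ ρ = InnerProductSpace.rankOne ℂ ψ ψ

/-- Parseval's identity with values in `[0, ∞]`. -/
theorem tsum_enorm_inner_sq {ι : Type*} (b : HilbertBasis ι ℂ H) (x : H) :
    ∑' i, ‖⟪b i, x⟫_ℂ‖ₑ ^ 2 = ‖x‖ₑ ^ 2 := by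
  have h := (b.hasSum_inner_mul_inner x x).mapL Complex.reCLM
  have h' : HasSum (fun i => ‖⟪b i, x⟫_ℂ‖ ^ 2) (‖x‖ ^ 2) := by
    convert h using 1
    · funext i
      rw [← inner_conj_symm x (b i), ← Complex.normSq_eq_conj_mul_self,
        Complex.normSq_eq_norm_sq, Complex.reCLM_apply, Complex.ofReal_re]
    · rw [Complex.reCLM_apply, inner_self_eq_norm_sq_to_K]
      simp [← Complex.ofReal_pow]
  have e : ∀ r : H, ‖r‖ₑ ^ 2 = ENNReal.ofReal (‖r‖ ^ 2) := fun r => by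
    rw [ENNReal.ofReal_pow (norm_nonneg _), ofReal_norm]
  have e' : ∀ r : ℂ, ‖r‖ₑ ^ 2 = ENNReal.ofReal (‖r‖ ^ 2) := fun r => by
    rw [ENNReal.ofReal_pow (norm_nonneg _), ofReal_norm]
  simp_rw [e, e']
  rw [← ENNReal.ofReal_tsum_of_nonneg (fun i => by positivity) h'.summable, h'.tsum_eq]

/-- The trace of a positive operator can be computed in any orthonormal basis. -/
theorem posTrace_eq_tsum {ι : Type*} (b : HilbertBasis ι ℂ H) {A : H →L[ℂ] H}
    (hA : A.IsPositive) :
    posTrace A = ∑' i, ENNReal.ofReal (RCLike.re ⟪b i, A (b i)⟫_ℂ) := by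
  have hA0 : 0 ≤ A := (ContinuousLinearMap.nonneg_iff_isPositive A).2 hA
  set B := CFC.sqrt A with hB
  have hBs : ContinuousLinearMap.adjoint B = B := by
    rw [← ContinuousLinearMap.star_eq_adjoint]
    exact (IsSelfAdjoint.of_nonneg (CFC.sqrt_nonneg A)).star_eq
  have hBB : ∀ x, B (B x) = A x := fun x => by
    have := CFC.sqrt_mul_sqrt_self A hA0
    rw [← hB] at this
    exact congrArg (fun T : H →L[ℂ] H => T x) this
  have hsymm : ∀ x y, ⟪B x, y⟫_ℂ = ⟪x, B y⟫_ℂ := fun x y => by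
    conv_lhs => rw [← hBs]
    exact ContinuousLinearMap.adjoint_inner_left _ _ _
  have key : ∀ x, ENNReal.ofReal (RCLike.re ⟪x, A x⟫_ℂ) = ‖B x‖ₑ ^ 2 := fun x => by
    rw [← hBB, ← hsymm, inner_self_eq_norm_sq, ENNReal.ofReal_pow (norm_nonneg _), ofReal_norm]
  unfold posTrace
  simp_rw [key]
  simp_rw [← tsum_enorm_inner_sq b (B (onb H _))]
  rw [ENNReal.tsum_comm]
  refine tsum_congr fun i => ?_
  rw [← tsum_enorm_inner_sq (onb H) (B (b i))]
  refine tsum_congr fun j => ?_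
  rw [← hsymm, ← inner_conj_symm, ← ofReal_norm, ← ofReal_norm, RCLike.norm_conj]

/-! ### Expectation values of unbounded operators

For an unbounded self-adjoint `T` and a state `ρ`, `Tr[T² ρ]` means the squared Hilbert–Schmidt norm
of `T √ρ`, and the traces of `T ρ` and of products `S T ρ` are written by cyclicity as the
absolutely convergent series `∑ᵢ ⟨√ρ eᵢ, T √ρ eᵢ⟩` and `∑ᵢ ⟨S √ρ eᵢ, T √ρ eᵢ⟩`. -/

open scoped Classical in
/-- `T f`, with value `0` outside the domain of `T`. -/
def applyOrZero (T : H →ₗ.[ℂ] H) (f : H) : H :=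
  if h : f ∈ T.domain then T ⟨f, h⟩ else 0

open scoped Classical in
/-- The quadratic form `‖T f‖² = ⟨f, T² f⟩ ∈ [0, ∞]`, equal to `∞` outside the domain of `T`. -/
def formSq (T : H →ₗ.[ℂ] H) (f : H) : ℝ≥0∞ :=
  if h : f ∈ T.domain then ‖T ⟨f, h⟩‖ₑ ^ 2 else ∞

/-- `Tr[T² ρ] ∈ [0, ∞]` for a self-adjoint `T`. -/
def expectSq (T : H →ₗ.[ℂ] H) (ρ : H →L[ℂ] H) : ℝ≥0∞ :=
  ∑' i, formSq T (CFC.sqrt ρ (onb H i))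

/-- `Tr[T ρ]` for a self-adjoint `T` with `Tr[T² ρ] < ∞`. -/
def expect (T : H →ₗ.[ℂ] H) (ρ : H →L[ℂ] H) : ℝ :=
  ∑' i, RCLike.re ⟪CFC.sqrt ρ (onb H i), applyOrZero T (CFC.sqrt ρ (onb H i))⟫_ℂ

/-- `Tr[{S - s, T - t} ρ]`, with `{A, B} = A B + B A`, for self-adjoint `S`, `T` and real `s`, `t`
such that `Tr[S² ρ]` and `Tr[T² ρ]` are finite. -/
def expectAnticomm (S T : H →ₗ.[ℂ] H) (s t : ℝ) (ρ : H →L[ℂ] H) : ℝ :=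
  ∑' i, RCLike.re
    (⟪applyOrZero S (CFC.sqrt ρ (onb H i)) - (s : ℂ) • CFC.sqrt ρ (onb H i),
        applyOrZero T (CFC.sqrt ρ (onb H i)) - (t : ℂ) • CFC.sqrt ρ (onb H i)⟫_ℂ +
      ⟪applyOrZero T (CFC.sqrt ρ (onb H i)) - (t : ℂ) • CFC.sqrt ρ (onb H i),
        applyOrZero S (CFC.sqrt ρ (onb H i)) - (s : ℂ) • CFC.sqrt ρ (onb H i)⟫_ℂ)

/-- `σ = e^{-β T} / Tr[e^{-β T}]` for a self-adjoint operator `T` with discrete spectrum: there is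
an orthonormal basis of eigenvectors `eᵢ` of `T`, with eigenvalues `lᵢ`, in which `σ` is diagonal
with entries `e^{-β lᵢ} / ∑ⱼ e^{-β lⱼ}`, the sum being finite. -/
def IsGibbsState (β : ℝ) (T : H →ₗ.[ℂ] H) (σ : H →L[ℂ] H) : Prop :=
  ∃ (ι : Type) (e : HilbertBasis ι ℂ H) (l : ι → ℝ),
    (∀ i, ∃ h : e i ∈ T.domain, T ⟨e i, h⟩ = (l i : ℂ) • e i) ∧
    Summable (fun i => Real.exp (-β * l i)) ∧
    ∀ i, σ (e i) = ((Real.exp (-β * l i) / ∑' j, Real.exp (-β * l j) : ℝ) : ℂ) • e i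

end Trace

/-! ### The `n`-mode system -/

/-- The Hilbert space `L²(ℝⁿ)` of `n` modes. -/
abbrev Hilb (n : ℕ) : Type :=
  Lp ℂ 2 (volume : Measure (EuclideanSpace ℝ (Fin n)))

/-- Bounded operators on `L²(ℝⁿ)`. -/
abbrev Op (n : ℕ) : Type :=
  Hilb n →L[ℂ] Hilb n

/-- Schwartz functions on `ℝⁿ`. -/
abbrev Sch (n : ℕ) : Type :=
  𝓢(EuclideanSpace ℝ (Fin n), ℂ)

/-- Labels of the `2n` quadratures: `(j, 0)` stands for `x̂ⱼ` and `(j, 1)` for `p̂ⱼ`. -/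
abbrev QIdx (n : ℕ) : Type :=
  Fin n × Fin 2

/-- The inclusion of Schwartz functions in `L²(ℝⁿ)`. -/
def incl (n : ℕ) : Sch n →ₗ[ℂ] Hilb n :=
  (SchwartzMap.toLpCLM ℂ ℂ 2 (volume : Measure (EuclideanSpace ℝ (Fin n)))).toLinearMap

theorem incl_injective (n : ℕ) : Function.Injective (incl n) :=
  SchwartzMap.injective_toLp 2 (volume : Measure (EuclideanSpace ℝ (Fin n)))

/-- A linear map of Schwartz functions as a densely defined operator on `L²(ℝⁿ)`. -/
def core {n : ℕ} (A : Sch n →ₗ[ℂ] Sch n) : Hilb n →ₗ.[ℂ] Hilb n where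
  domain := LinearMap.range (incl n)
  toFun := (incl n ∘ₗ A) ∘ₗ
    (LinearEquiv.ofInjective (incl n) (incl_injective n)).symm.toLinearMap

theorem core_domain_dense {n : ℕ} (A : Sch n →ₗ[ℂ] Sch n) :
    Dense ((core A).domain : Set (Hilb n)) := by
  have h : DenseRange (SchwartzMap.toLpCLM ℝ ℂ 2
      (volume : Measure (EuclideanSpace ℝ (Fin n)))) :=
    SchwartzMap.denseRange_toLpCLM ENNReal.ofNat_ne_top
  exact h

theorem core_apply {n : ℕ} (A : Sch n →ₗ[ℂ] Sch n) (φ : Sch n) :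
    core A ⟨incl n φ, φ, rfl⟩ = incl n (A φ) := by
  have : (LinearEquiv.ofInjective (incl n) (incl_injective n)).symm ⟨incl n φ, φ, rfl⟩ = φ := by
    rw [LinearEquiv.symm_apply_eq]
    rfl
  change incl n (A ((LinearEquiv.ofInjective (incl n) (incl_injective n)).symm _)) = _
  exact congrArg (fun χ => incl n (A χ)) this

/-- The operator on `L²(ℝⁿ)` that a symmetric `A` defines in the sense of distributions, the adjoint
of `A` on Schwartz functions. Where `A` is essentially self-adjoint on Schwartz functions, as in all
the cases below, this is the self-adjoint closure of `A`. -/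
def toOperator {n : ℕ} (A : Sch n →ₗ[ℂ] Sch n) : Hilb n →ₗ.[ℂ] Hilb n :=
  (core A).adjoint

/-- `f` is in the domain of the operator and is mapped to `g` if and only if `⟨g, φ⟩ = ⟨f, A φ⟩` for
all Schwartz functions `φ`. -/
theorem toOperator_apply_iff {n : ℕ} (A : Sch n →ₗ[ℂ] Sch n) (f g : Hilb n) :
    (∃ h : f ∈ (toOperator A).domain, toOperator A ⟨f, h⟩ = g) ↔
      ∀ φ : Sch n, ⟪g, incl n φ⟫_ℂ = ⟪f, incl n (A φ)⟫_ℂ := by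
  constructor
  · rintro ⟨h, rfl⟩ φ
    have := LinearPMap.adjoint_isFormalAdjoint (core_domain_dense A) ⟨f, h⟩ ⟨incl n φ, φ, rfl⟩
    rw [core_apply] at this
    exact this
  · intro h
    have h' : ∀ x : (core A).domain, ⟪g, (x : Hilb n)⟫_ℂ = ⟪f, core A x⟫_ℂ := by
      rintro ⟨_, φ, rfl⟩
      rw [core_apply]
      exact h φ
    exact ⟨LinearPMap.mem_adjoint_domain_of_exists _ ⟨g, h'⟩,
      LinearPMap.adjoint_apply_eq (core_domain_dense A) _ h'⟩

/-- The position operator `(x̂ⱼ φ)(x) = xⱼ φ(x)` on Schwartz functions. -/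
def position {n : ℕ} (j : Fin n) : Sch n →ₗ[ℂ] Sch n :=
  (SchwartzMap.smulLeftCLM ℂ (fun x : EuclideanSpace ℝ (Fin n) => ((x j : ℝ) : ℂ))).toLinearMap

theorem position_apply {n : ℕ} (j : Fin n) (φ : Sch n) (x : EuclideanSpace ℝ (Fin n)) :
    position j φ x = ((x j : ℝ) : ℂ) * φ x := by
  have h : (fun x : EuclideanSpace ℝ (Fin n) => ((x j : ℝ) : ℂ)).HasTemperateGrowth :=
    (Complex.ofRealCLM ∘L
      (EuclideanSpace.proj j : EuclideanSpace ℝ (Fin n) →L[ℝ] ℝ)).hasTemperateGrowth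
  exact SchwartzMap.smulLeftCLM_apply_apply h φ x

/-- The momentum operator `(p̂ⱼ φ)(x) = -i ∂ⱼ φ(x)` on Schwartz functions. -/
def momentum {n : ℕ} (j : Fin n) : Sch n →ₗ[ℂ] Sch n :=
  (-Complex.I) •
    (LineDeriv.lineDerivOpCLM ℂ (Sch n) (EuclideanSpace.single j (1 : ℝ))).toLinearMap

theorem momentum_apply {n : ℕ} (j : Fin n) (φ : Sch n) (x : EuclideanSpace ℝ (Fin n)) :
    momentum j φ x = -Complex.I * fderiv ℝ φ x (EuclideanSpace.single j 1) := by
  have h := SchwartzMap.lineDerivOp_apply_eq_fderiv (EuclideanSpace.single j (1 : ℝ)) φ x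
  rw [← h]
  rfl

/-- The quadrature vector `R̂ = (x̂₁, p̂₁, …, x̂ₙ, p̂ₙ)` on Schwartz functions. -/
def quadCore {n : ℕ} (k : QIdx n) : Sch n →ₗ[ℂ] Sch n :=
  if k.2 = 0 then position k.1 else momentum k.1

/-- The self-adjoint quadrature operators `R̂ₖ` on `L²(ℝⁿ)`. -/
def quad {n : ℕ} (k : QIdx n) : Hilb n →ₗ.[ℂ] Hilb n :=
  toOperator (quadCore k)

/-- The energy `Tr[Ê ρ] ∈ [0, ∞]`, where `Ê = ½ ∑ₖ R̂ₖ²`. -/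
def energy {n : ℕ} (ρ : Op n) : ℝ≥0∞ :=
  (∑ k : QIdx n, expectSq (quad k) ρ) / 2

/-- The first moment `m(ρ)ₖ = Tr[R̂ₖ ρ]`. -/
def firstMoment {n : ℕ} (ρ : Op n) : EuclideanSpace ℝ (QIdx n) :=
  WithLp.toLp 2 fun k => expect (quad k) ρ

/-- The covariance matrix `V(ρ)ₖₗ = Tr[{R̂ₖ - mₖ(ρ), R̂ₗ - mₗ(ρ)} ρ]`. -/
def covMatrix {n : ℕ} (ρ : Op n) : Matrix (QIdx n) (QIdx n) ℝ :=
  Matrix.of fun k l => expectAnticomm (quad k) (quad l) (firstMoment ρ k) (firstMoment ρ l) ρ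

/-- The operator norm `‖A‖_∞` (largest singular value) of a real matrix. -/
def opNorm {ι : Type*} [Fintype ι] [DecidableEq ι] (A : Matrix ι ι ℝ) : ℝ :=
  ‖Matrix.toEuclideanCLM (𝕜 := ℝ) A‖

/-- The quadratic Hamiltonian `½ (R̂ - m)ᵀ h (R̂ - m)` on Schwartz functions. -/
def quadHamCore {n : ℕ} (h : Matrix (QIdx n) (QIdx n) ℝ) (m : QIdx n → ℝ) :
    Sch n →ₗ[ℂ] Sch n :=
  (1 / 2 : ℂ) • ∑ k, ∑ l, (h k l : ℂ) •
    ((quadCore k - (m k : ℂ) • LinearMap.id) ∘ₗ (quadCore l - (m l : ℂ) • LinearMap.id))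

/-- The quadratic Hamiltonian `½ (R̂ - m)ᵀ h (R̂ - m)` as an operator on `L²(ℝⁿ)`. -/
def quadHam {n : ℕ} (h : Matrix (QIdx n) (QIdx n) ℝ) (m : QIdx n → ℝ) : Hilb n →ₗ.[ℂ] Hilb n :=
  toOperator (quadHamCore h m)

/-- Gaussian states: the trace-norm closure, in the set of states, of the Gibbs states
`e^{-β Ĥ} / Tr[e^{-β Ĥ}]` of quadratic Hamiltonians `Ĥ = ½ (R̂ - m)ᵀ h (R̂ - m)` with `h` symmetric and
positive definite. The closure contains the limits `β → ∞`, that is, the ground states. -/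
def IsGaussianState {n : ℕ} (ρ : Op n) : Prop :=
  IsState ρ ∧ ∀ ε : ℝ≥0∞, 0 < ε →
    ∃ (β : ℝ) (h : Matrix (QIdx n) (QIdx n) ℝ) (m : QIdx n → ℝ) (σ : Op n),
      0 < β ∧ h.PosDef ∧ IsGibbsState β (quadHam h m) σ ∧ traceNorm (ρ - σ) < ε

end CVSystem

end

/-! Write the pure Gaussian state ψ as the vacuum of normal modes a_j = Σ_k C_jk (R̂_k − m_k), and
let N = Σ_j a_j† a_j. N annihilates ψ and is at least 1 on the orthogonal complement of ψ, so 1 −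
|ψ⟩⟨ψ| ≤ N, and the infidelity 1 − ⟨ψ, ρψ⟩ is at most Tr[Nρ] (`FockModes.gap`, `gap_state`). N + n/2
is quadratic in the quadratures: its expectation depends on ρ only through V(ρ) + 2δδᵀ, where δ =
m(ρ) − m(ψ), and equals n/2 at ψ. Subtracting the two values bounds the infidelity by ½ Σ_j ‖C_j‖²
(2‖δ‖² + ‖V(ρ) − V(ψ)‖_∞), and Σ_j ‖C_j‖² = ½ Tr V(ψ) (`one_sub_fidelity_le`). The Fuchs–van de
Graaf inequality ‖ρ − ψ‖₁ ≤ 2√(1 − ⟨ψ, ρψ⟩) (`traceNorm_sub_rankOne_le`) turns this into the first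
bound, and Tr V(ψ) ≤ 4 Tr[ψ Ê] gives the second.

Most of the work is to show that ψ is such a vacuum (`IsGaussianState.exists_vacuum`). A positive
definite h is diagonalised symplectically (`exists_normalModes`). Its modes have a Gaussian vacuum
whose number states are dense (`IsCCR.exists_fockModes`), so the leading eigenvector of a Gibbs
state is that vacuum up to a phase. A pure state in the closure is therefore a limit of vacua. Their
parameters (C, m) stay bounded (`IsCCR.parameter_bound`), a subsequence converges, and the weak
equations ⟨ψ, a_j† u⟩ = 0 pass to the limit and determine ψ.

Unbounded operators are handled weakly: a vector f enters only through the pairings of a_j f and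
a_j† f with Schwartz functions, so f need not lie in the domain of N. -/

noncomputable section

set_option linter.unusedSectionVars false
set_option linter.unusedSimpArgs false

namespace CVSystem

/-! ### Bosonic modes over a vacuum vector -/

section Fock

variable {ι E H : Type*} [Fintype ι] [DecidableEq ι] [AddCommGroup E] [Module ℂ E]
  [NormedAddCommGroup H] [InnerProductSpace ℂ H]

/-- Annihilation operators `a j` and creation operators `c j` on a common invariant domain `E`,
mapped to a Hilbert space by `J`, together with a normalised vacuum vector `g`. -/
structure FockModes (J : E →ₗ[ℂ] H) (a c : ι → E →ₗ[ℂ] E) (g : E) : Prop where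
  adj : ∀ j φ χ, ⟪J (a j φ), J χ⟫_ℂ = ⟪J φ, J (c j χ)⟫_ℂ
  comm : ∀ j k φ, a j (c k φ) = c k (a j φ) + if j = k then φ else 0
  comm_cre : ∀ j k φ, c j (c k φ) = c k (c j φ)
  vacuum : ∀ j, a j g = 0
  norm_vacuum : ‖J g‖ = 1

/-- The vector obtained from `g` by applying a list of creation operators. -/
def word (c : ι → E →ₗ[ℂ] E) (g : E) (L : List ι) : E :=
  L.foldr (fun j u => c j u) g

/-- The weighted number operator `∑ⱼ νⱼ cⱼ aⱼ`. -/
def weightedNumber (a c : ι → E →ₗ[ℂ] E) (ν : ι → ℝ) : E →ₗ[ℂ] E :=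
  ∑ j, (ν j : ℂ) • (c j ∘ₗ a j)

theorem weightedNumber_apply (a c : ι → E →ₗ[ℂ] E) (ν : ι → ℝ) (u : E) :
    weightedNumber a c ν u = ∑ j, (ν j : ℂ) • c j (a j u) := by
  simp [weightedNumber]

namespace FockModes

variable {J : E →ₗ[ℂ] H} {a c : ι → E →ₗ[ℂ] E} {g : E}

theorem adj' (h : FockModes J a c g) (j : ι) (φ χ : E) :
    ⟪J (c j φ), J χ⟫_ℂ = ⟪J φ, J (a j χ)⟫_ℂ := by
  rw [← inner_conj_symm, ← h.adj, inner_conj_symm]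

/-- Only the summand `j = k` fails to commute with `c k`. Each creation operator thus adds its
weight, which makes every word an eigenvector. -/
theorem weightedNumber_cre (h : FockModes J a c g) (ν : ι → ℝ) (k : ι) (u : E) :
    weightedNumber a c ν (c k u) = c k (weightedNumber a c ν u) + (ν k : ℂ) • c k u := by
  simp only [weightedNumber_apply, map_sum, map_smul, h.comm, map_add, smul_add,
    Finset.sum_add_distrib]
  congr 1
  · exact Finset.sum_congr rfl fun j _ => by rw [h.comm_cre]
  · rw [Finset.sum_eq_single k] <;> simp +contextual

theorem weightedNumber_word (h : FockModes J a c g) (ν : ι → ℝ) (L : List ι) :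
    weightedNumber a c ν (word c g L) = (((L.map ν).sum : ℝ) : ℂ) • word c g L := by
  induction L with
  | nil => simp [word, weightedNumber_apply, h.vacuum]
  | cons k L ih =>
    have : word c g (k :: L) = c k (word c g L) := rfl
    rw [this, h.weightedNumber_cre, ih, map_smul, ← add_smul]
    simp [add_comm]

theorem weightedNumber_symm (h : FockModes J a c g) (ν : ι → ℝ) (u v : E) :
    ⟪J (weightedNumber a c ν u), J v⟫_ℂ = ⟪J u, J (weightedNumber a c ν v)⟫_ℂ := by
  simp [weightedNumber_apply, sum_inner, inner_sum, inner_smul_left, inner_smul_right, h.adj', h.adj]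

theorem inner_vacuum_cre (h : FockModes J a c g) (j : ι) (u : E) :
    ⟪J g, J (c j u)⟫_ℂ = 0 := by
  rw [← h.adj, h.vacuum, map_zero, inner_zero_left]

end FockModes

/-- The span of the vectors with exactly `d` quanta. -/
def level (c : ι → E →ₗ[ℂ] E) (g : E) (d : ℕ) : Submodule ℂ E :=
  Submodule.span ℂ {u | ∃ L : List ι, L.length = d ∧ word c g L = u}

/-- Words are sorted by length. The range `D + 1` is never empty, so the vacuum level can always be
split off. -/
theorem exists_level_decomposition (c : ι → E →ₗ[ℂ] E) (g : E) {w : E}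
    (hw : w ∈ Submodule.span ℂ (Set.range (word c g))) :
    ∃ (D : ℕ) (U : ℕ → E), (∀ d, U d ∈ level c g d) ∧ w = ∑ d ∈ Finset.range (D + 1), U d := by
  have hle : Submodule.span ℂ (Set.range (word c g)) ≤ ⨆ d, level c g d := by
    rw [Submodule.span_le]
    rintro _ ⟨L, rfl⟩
    exact Submodule.mem_iSup_of_mem L.length (Submodule.subset_span ⟨L, rfl, rfl⟩)
  obtain ⟨U, hU, rfl⟩ := (Submodule.mem_iSup_iff_exists_finsupp _ _).1 (hle hw)
  refine ⟨U.support.sup id, U, hU, ?_⟩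
  rw [Finsupp.sum]
  refine Finset.sum_subset (fun d hd => ?_) (fun d _ hd => by simpa using hd)
  exact Finset.mem_range.2 (Nat.lt_succ_of_le (Finset.le_sup (f := id) hd))

theorem level_zero_le (c : ι → E →ₗ[ℂ] E) (g : E) {u : E} (hu : u ∈ level c g 0) :
    ∃ z : ℂ, u = z • g := by
  have : level c g 0 ≤ Submodule.span ℂ {g} := by
    rw [level, Submodule.span_le]
    rintro _ ⟨L, hL, rfl⟩
    rw [List.length_eq_zero_iff.1 hL]
    exact Submodule.mem_span_singleton_self g
  obtain ⟨z, hz⟩ := Submodule.mem_span_singleton.1 (this hu)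
  exact ⟨z, hz.symm⟩

namespace FockModes

variable {J : E →ₗ[ℂ] H} {a c : ι → E →ₗ[ℂ] E} {g : E}

theorem weightedNumber_level (h : FockModes J a c g) {d : ℕ} {u : E} (hu : u ∈ level c g d) :
    weightedNumber a c (fun _ => 1) u = (d : ℂ) • u := by
  have : level c g d ≤ LinearMap.ker (weightedNumber a c (fun _ => 1) - (d : ℂ) • LinearMap.id) := by
    rw [level, Submodule.span_le]
    rintro _ ⟨L, hL, rfl⟩
    simp [h.weightedNumber_word, hL]
  simpa [sub_eq_zero] using this hu

/-- Eigenvectors of a symmetric operator for distinct eigenvalues are orthogonal. -/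
theorem inner_level (h : FockModes J a c g) {d d' : ℕ} (hd : d ≠ d') {u v : E}
    (hu : u ∈ level c g d) (hv : v ∈ level c g d') : ⟪J u, J v⟫_ℂ = 0 := by
  have := h.weightedNumber_symm (fun _ => 1) u v
  rw [h.weightedNumber_level hu, h.weightedNumber_level hv] at this
  simp only [map_smul, inner_smul_left, inner_smul_right, map_natCast] at this
  have h2 : ((d : ℂ) - d') * ⟪J u, J v⟫_ℂ = 0 := by rw [sub_mul, this, sub_self]
  exact (mul_eq_zero.1 h2).resolve_left (sub_ne_zero.2 (by exact_mod_cast hd))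

/-- The symmetric number operator `½ ∑ⱼ (cⱼ aⱼ + aⱼ cⱼ)` bounds the energy from below. -/
theorem energy_ge (h : FockModes J a c g) {f : H} {af cf : ι → H}
    (haf : ∀ j φ, ⟪af j, J φ⟫_ℂ = ⟪f, J (c j φ)⟫_ℂ)
    (hcf : ∀ j φ, ⟪cf j, J φ⟫_ℂ = ⟪f, J (a j φ)⟫_ℂ) (v Kv : E)
    (hK : Kv = weightedNumber a c (fun _ => 1) v + ((Fintype.card ι : ℂ) / 2) • v) :
    2 * RCLike.re ⟪f, J Kv⟫_ℂ - RCLike.re ⟪J v, J Kv⟫_ℂ ≤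
      (∑ j, (‖af j‖ ^ 2 + ‖cf j‖ ^ 2)) / 2 := by
  have hK2 : (2 : ℂ) • Kv = ∑ j, (c j (a j v) + a j (c j v)) := by
    simp only [hK, weightedNumber_apply, h.comm, if_true, smul_add, Finset.sum_add_distrib,
      Finset.smul_sum, Finset.sum_const, Finset.card_univ]
    simp only [Complex.ofReal_one, one_smul, two_smul, smul_smul, Finset.sum_add_distrib]
    rw [show (2 : ℂ) * (Fintype.card ι / 2) = (Fintype.card ι : ℂ) by ring, Nat.cast_smul_eq_nsmul,
      add_assoc]
  have key : ∀ x : H, ∀ y : E, 2 * RCLike.re ⟪x, J y⟫_ℂ = RCLike.re ⟪x, J ((2 : ℂ) • y)⟫_ℂ := by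
    intro x y
    rw [map_smul, inner_smul_right]
    simp
  -- Completing the square: the weak images `af`, `cf` of `f` are compared with the true images of
  -- the test vector `v`. Expanding gives a lower bound that needs `f` only through its pairing with
  -- `Kv`.
  have h0 : 0 ≤ ∑ j, (‖af j - J (a j v)‖ ^ 2 + ‖cf j - J (c j v)‖ ^ 2) := by positivity
  have h1 : ∀ j, ‖af j - J (a j v)‖ ^ 2 + ‖cf j - J (c j v)‖ ^ 2 =
      (‖af j‖ ^ 2 + ‖cf j‖ ^ 2) - 2 * RCLike.re ⟪f, J (c j (a j v) + a j (c j v))⟫_ℂ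
        + RCLike.re ⟪J v, J (c j (a j v) + a j (c j v))⟫_ℂ := by
    intro j
    rw [@norm_sub_sq ℂ, @norm_sub_sq ℂ, haf, hcf, ← @inner_self_eq_norm_sq ℂ _ _ _ _ (J (a j v)),
      ← @inner_self_eq_norm_sq ℂ _ _ _ _ (J (c j v)), h.adj, h.adj', map_add, inner_add_right,
      inner_add_right, map_add, map_add]
    ring
  simp only [h1, Finset.sum_add_distrib, Finset.sum_sub_distrib, ← Finset.mul_sum, ← map_sum,
    ← inner_sum] at h0
  simp only [← Finset.sum_add_distrib, ← hK2] at h0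
  rw [← key, ← key] at h0
  linarith

/-- The spectral gap of the number operator, for vectors in the form domain. -/
theorem gap (h : FockModes J a c g)
    (hd : Dense (Submodule.span ℂ (Set.range fun L => J (word c g L)) : Set H))
    {f : H} {af cf : ι → H}
    (haf : ∀ j φ, ⟪af j, J φ⟫_ℂ = ⟪f, J (c j φ)⟫_ℂ)
    (hcf : ∀ j φ, ⟪cf j, J φ⟫_ℂ = ⟪f, J (a j φ)⟫_ℂ) :
    (1 + (Fintype.card ι : ℝ) / 2) * ‖f‖ ^ 2 - ‖⟪J g, f⟫_ℂ‖ ^ 2 ≤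
      (∑ j, (‖af j‖ ^ 2 + ‖cf j‖ ^ 2)) / 2 := by
  set B := (∑ j, (‖af j‖ ^ 2 + ‖cf j‖ ^ 2)) / 2
  set κ : ℝ := (Fintype.card ι : ℝ) / 2 with hκ
  have hκ0 : 0 ≤ κ := by positivity
  have main : ∀ w ∈ Submodule.span ℂ (Set.range (word c g)),
      (1 + κ) * (‖f‖ ^ 2 - ‖f - J w‖ ^ 2) - ‖⟪J g, f⟫_ℂ‖ ^ 2 ≤ B := by
    intro w hw
    obtain ⟨D, U, hU, hwU⟩ := exists_level_decomposition c g hw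
    -- The weights are chosen so that `v = ∑ t d • U d` has `(N + κ) v = ∑ μ d • U d`, where `μ d`
    -- is the eigenvalue `d + κ` cut off at `1 + κ`. Since `t d ≤ 1`, replacing `⟨v, Kv⟩` by `∑ μ d
    -- ‖U d‖²` only weakens the bound. Level zero is separate because `κ` may be zero.
    let t : ℕ → ℝ := fun d => if d = 0 then 1 else (1 + κ) / (d + κ)
    let μ : ℕ → ℝ := fun d => if d = 0 then κ else 1 + κ
    have ht0 : ∀ d, t d ≤ 1 := by
      intro d
      by_cases hd : d = 0
      · simp [t, hd]
      · have : (1 : ℝ) ≤ d := by exact_mod_cast Nat.one_le_iff_ne_zero.2 hd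
        simp only [t, hd, if_false]
        rw [div_le_one (by linarith)]
        linarith
    have hμ0 : ∀ d, 0 ≤ μ d := by
      intro d
      by_cases hd : d = 0
      · simp [μ, hd, hκ0]
      · simp only [μ, hd, if_false]; linarith
    have hμt : ∀ d : ℕ, (d + κ) * t d = μ d := by
      intro d
      by_cases hd : d = 0
      · simp [t, μ, hd]
      · have : (1 : ℝ) ≤ d := by exact_mod_cast Nat.one_le_iff_ne_zero.2 hd
        simp only [t, μ, hd, if_false]
        field_simp
    set v := ∑ d ∈ Finset.range (D + 1), (t d : ℂ) • U d with hv
    set Kv := ∑ d ∈ Finset.range (D + 1), (μ d : ℂ) • U d with hKv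
    have hK : Kv = weightedNumber a c (fun _ => 1) v + ((Fintype.card ι : ℂ) / 2) • v := by
      rw [hv, hKv, map_sum, Finset.smul_sum, ← Finset.sum_add_distrib]
      refine Finset.sum_congr rfl fun d _ => ?_
      rw [map_smul, h.weightedNumber_level (hU d), smul_smul, smul_smul, ← add_smul, ← hμt, hκ]
      congr 1
      push_cast
      ring
    have hE := h.energy_ge haf hcf v Kv hK
    have hvK : RCLike.re ⟪J v, J Kv⟫_ℂ = ∑ d ∈ Finset.range (D + 1), t d * μ d * ‖J (U d)‖ ^ 2 := by
      rw [hv, hKv]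
      simp only [map_sum, map_smul, sum_inner, inner_sum, inner_smul_left, inner_smul_right]
      refine Finset.sum_congr rfl fun d hd => ?_
      rw [Finset.sum_eq_single d]
      · rw [inner_self_eq_norm_sq_to_K]
        simp [← Complex.ofReal_pow, mul_assoc, mul_left_comm]
      · intro d' _ hne
        simp [h.inner_level hne (hU d') (hU d)]
      · exact fun hn => absurd hd hn
    have hfK : RCLike.re ⟪f, J Kv⟫_ℂ = ∑ d ∈ Finset.range (D + 1), μ d * RCLike.re ⟪f, J (U d)⟫_ℂ := by
      rw [hKv]
      simp [inner_sum, inner_smul_right]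
    have hww : ‖J w‖ ^ 2 = ∑ d ∈ Finset.range (D + 1), ‖J (U d)‖ ^ 2 := by
      rw [← @inner_self_eq_norm_sq ℂ, hwU]
      simp only [map_sum, sum_inner, inner_sum]
      refine Finset.sum_congr rfl fun d hd => ?_
      rw [Finset.sum_eq_single d]
      · rw [inner_self_eq_norm_sq]
      · intro d' _ hne
        simp [h.inner_level hne (hU d') (hU d)]
      · exact fun hn => absurd hd hn
    have hfw : RCLike.re ⟪f, J w⟫_ℂ = ∑ d ∈ Finset.range (D + 1), RCLike.re ⟪f, J (U d)⟫_ℂ := by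
      rw [hwU]; simp [inner_sum]
    have hle : ∑ d ∈ Finset.range (D + 1), μ d * (2 * RCLike.re ⟪f, J (U d)⟫_ℂ - ‖J (U d)‖ ^ 2) ≤ B := by
      refine le_trans ?_ hE
      rw [hvK, hfK, Finset.mul_sum, ← Finset.sum_sub_distrib]
      refine Finset.sum_le_sum fun d _ => ?_
      have : t d * μ d * ‖J (U d)‖ ^ 2 ≤ 1 * μ d * ‖J (U d)‖ ^ 2 := by
        have := hμ0 d
        have := ht0 d
        gcongr
      linarith
    have hμ' : ∀ d ∈ Finset.range D, μ (d + 1) = 1 + κ := fun d _ => by simp [μ]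
    have hsplit : ∑ d ∈ Finset.range (D + 1), μ d * (2 * RCLike.re ⟪f, J (U d)⟫_ℂ - ‖J (U d)‖ ^ 2) =
        (1 + κ) * (2 * RCLike.re ⟪f, J w⟫_ℂ - ‖J w‖ ^ 2) -
          (2 * RCLike.re ⟪f, J (U 0)⟫_ℂ - ‖J (U 0)‖ ^ 2) := by
      rw [hww, hfw, Finset.mul_sum, ← Finset.sum_sub_distrib, Finset.mul_sum,
        Finset.sum_range_succ', Finset.sum_range_succ' _ D,
        Finset.sum_congr rfl fun d hd => by rw [hμ' d hd]]
      simp only [μ, if_true]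
      ring
    -- Level zero is spanned by the vacuum, so this is `2 Re(z w) - |z|² ≤ |w|²`.
    have h00 : 2 * RCLike.re ⟪f, J (U 0)⟫_ℂ - ‖J (U 0)‖ ^ 2 ≤ ‖⟪J g, f⟫_ℂ‖ ^ 2 := by
      obtain ⟨z, hz⟩ := level_zero_le c g (hU 0)
      rw [hz, map_smul, inner_smul_right, norm_smul, h.norm_vacuum, mul_one]
      have h1 : RCLike.re (z * ⟪f, J g⟫_ℂ) ≤ ‖z‖ * ‖⟪J g, f⟫_ℂ‖ := by
        rw [← norm_inner_symm f, ← norm_mul]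
        exact RCLike.re_le_norm _
      nlinarith [sq_nonneg (‖z‖ - ‖⟪J g, f⟫_ℂ‖)]
    rw [@norm_sub_sq ℂ]
    rw [hsplit] at hle
    linarith
  -- By density `J w` can tend to `f`, which removes the error term `‖f - J w‖²` in `main`.
  have hcl : f ∈ closure (Submodule.span ℂ (Set.range fun L => J (word c g L)) : Set H) := hd f
  have hcont : Continuous fun x : H => (1 + κ) * (‖f‖ ^ 2 - ‖f - x‖ ^ 2) - ‖⟪J g, f⟫_ℂ‖ ^ 2 := by
    fun_prop
  have hsub : (Submodule.span ℂ (Set.range fun L => J (word c g L)) : Set H) ⊆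
      {x | (1 + κ) * (‖f‖ ^ 2 - ‖f - x‖ ^ 2) - ‖⟪J g, f⟫_ℂ‖ ^ 2 ≤ B} := by
    intro x hx
    have : (Set.range fun L => J (word c g L)) = J '' Set.range (word c g) := by
      rw [← Set.range_comp]; rfl
    rw [this, Submodule.span_image] at hx
    obtain ⟨w, hw, rfl⟩ := hx
    exact main w hw
  have := closure_minimal hsub (isClosed_le hcont continuous_const) hcl
  simpa using this

/-- A word is either `g` itself or lies in the range of a creation operator. After subtracting its
vacuum component, `f` is orthogonal to all words, which are total. -/
theorem eq_smul_vacuum_of_inner_cre (h : FockModes J a c g)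
    (hd : Dense (Submodule.span ℂ (Set.range fun L => J (word c g L)) : Set H))
    {f : H} (hf : ∀ j L, ⟪f, J (c j (word c g L))⟫_ℂ = 0) : f = ⟪J g, f⟫_ℂ • J g := by
  rw [← sub_eq_zero]
  refine hd.eq_zero_of_mem_orthogonal (K := Submodule.span ℂ _) ?_
  rw [Submodule.mem_orthogonal']
  intro u hu
  induction hu using Submodule.span_induction with
  | mem x hx =>
    obtain ⟨L, rfl⟩ := hx
    cases L with
    | nil =>
      have : word c g [] = g := rfl
      simp [this, inner_sub_left, inner_smul_left, inner_self_eq_norm_sq_to_K, h.norm_vacuum]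
    | cons j L =>
      have : word c g (j :: L) = c j (word c g L) := rfl
      simp [this, inner_sub_left, inner_smul_left, hf, h.inner_vacuum_cre]
  | zero => simp
  | add x y _ _ hx hy => simp [inner_add_right, hx, hy]
  | smul z x _ hx => simp [inner_smul_right, hx]

/-- In an orthonormal basis of weak eigenvectors of `∑ⱼ νⱼ cⱼ aⱼ + r`, with all `νⱼ > 0`, the vacuum
occurs up to a phase. -/
theorem exists_eq_smul_vacuum (h : FockModes J a c g)
    (hd : Dense (Submodule.span ℂ (Set.range fun L => J (word c g L)) : Set H))
    {κ : Type*} (e : HilbertBasis κ ℂ H) (l : κ → ℝ) (ν : ι → ℝ) (hν : ∀ j, 0 < ν j) (r : ℝ)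
    (he : ∀ i φ, ⟪(l i : ℂ) • e i, J φ⟫_ℂ = ⟪e i, J (weightedNumber a c ν φ + (r : ℂ) • φ)⟫_ℂ) :
    ∃ i, e i = ⟪J g, e i⟫_ℂ • J g ∧ ∀ i', l i ≤ l i' := by
  -- Testing the weak eigenvalue equation on a word: a nonzero overlap forces the two eigenvalues to
  -- agree.
  have hl : ∀ i L, ⟪e i, J (word c g L)⟫_ℂ ≠ 0 → l i = (L.map ν).sum + r := by
    intro i L hne
    have := he i (word c g L)
    rw [h.weightedNumber_word, ← add_smul, map_smul, inner_smul_left, inner_smul_right,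
      mul_eq_mul_right_iff] at this
    have := this.resolve_right hne
    rw [Complex.conj_ofReal] at this
    exact_mod_cast this
  -- Some basis vector overlaps the vacuum, hence has eigenvalue `r`. Nonempty words have strictly
  -- larger eigenvalues, so it is orthogonal to all of them.
  obtain ⟨i, hi⟩ : ∃ i, ⟪e i, J g⟫_ℂ ≠ 0 := by
    by_contra! hcon
    have := (e.hasSum_inner_mul_inner (J g) (J g)).tsum_eq
    simp [hcon, inner_self_eq_norm_sq_to_K, h.norm_vacuum] at this
  have h1 := hl i [] hi
  have h3 : ∀ L : List ι, 0 ≤ (L.map ν).sum := fun L =>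
    List.sum_nonneg (by simpa using fun j _ => (hν j).le)
  refine ⟨i, h.eq_smul_vacuum_of_inner_cre hd fun j L => ?_, fun i' => ?_⟩
  · by_contra hne
    have h2 := hl i (j :: L) hne
    simp only [List.map_nil, List.sum_nil, List.map_cons, List.sum_cons] at h1 h2
    linarith [hν j, h3 L]
  -- An eigenvalue below `r` belongs to no word, so `e i'` would be orthogonal to a total set.
  · by_contra! hlt
    have hz : ∀ L, ⟪e i', J (word c g L)⟫_ℂ = 0 := by
      intro L
      by_contra hne
      have h2 := hl i' L hne
      simp only [List.map_nil, List.sum_nil] at h1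
      linarith [h3 L]
    have h0 := h.eq_smul_vacuum_of_inner_cre hd (f := e i') fun j L => hz (j :: L)
    have h4 : ⟪J g, e i'⟫_ℂ = 0 := by
      rw [← inner_conj_symm]
      simp [show ⟪e i', J g⟫_ℂ = 0 from hz []]
    rw [h4, zero_smul] at h0
    have := e.orthonormal.1 i'
    rw [h0, norm_zero] at this
    exact zero_ne_one this

end FockModes


/-- First and second moment of `R = m + c + a` in the vacuum `g` of a mode with `[a, c] = s²` are
controlled by any vector close to the vacuum in the domain of `R²`. -/
theorem moment_bound {J : E →ₗ[ℂ] H} {a c : E →ₗ[ℂ] E} {g : E} {s m : ℝ} (hs : 0 ≤ s)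
    (adj : ∀ φ χ, ⟪J (a φ), J χ⟫_ℂ = ⟪J φ, J (c χ)⟫_ℂ)
    (comm : ∀ φ, a (c φ) = c (a φ) + ((s ^ 2 : ℝ) : ℂ) • φ) (vac : a g = 0) (hg : ‖J g‖ = 1)
    {R : E → E} (hR : ∀ φ, R φ = (m : ℂ) • φ + c φ + a φ) {φ : E} {θ : ℂ} (hθ : ‖θ‖ = 1)
    (hφ : ‖J φ - θ • J g‖ ≤ 1 / 10) : m ^ 2 + s ^ 2 ≤ 2 * ‖J (R (R φ))‖ := by
  have adj' : ∀ φ χ, ⟪J (c φ), J χ⟫_ℂ = ⟪J φ, J (a χ)⟫_ℂ := fun φ χ => by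
    rw [← inner_conj_symm, ← adj, inner_conj_symm]
  have hsymm : ∀ φ χ, ⟪J (R φ), J χ⟫_ℂ = ⟪J φ, J (R χ)⟫_ℂ := by
    intro φ χ
    simp only [hR, map_add, map_smul, inner_add_left, inner_add_right, inner_smul_left,
      inner_smul_right, adj, adj', Complex.conj_ofReal]
    ring
  -- `y` is the part of `R² g` orthogonal to `g`; the component along `g` is the second moment `m² +
  -- s²`. Pairing `R² g` with `φ ≈ θ g` recovers this moment up to small errors.
  set y := (2 * m : ℂ) • c g + c (c g) with hy
  have hRR : R (R g) = ((m ^ 2 + s ^ 2 : ℝ) : ℂ) • g + y := by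
    simp only [hR, map_add, map_smul, vac, map_zero, comm, hy, add_zero, zero_add]
    push_cast
    module
  have hgc : ∀ u, ⟪J g, J (c u)⟫_ℂ = 0 := fun u => by
    rw [← adj, vac, map_zero, inner_zero_left]
  have n1 : ‖J (c g)‖ = s := by
    have : ‖J (c g)‖ ^ 2 = s ^ 2 := by
      rw [← @inner_self_eq_norm_sq ℂ, adj', comm, vac]
      simp [inner_smul_right, inner_self_eq_norm_sq_to_K, hg, ← Complex.ofReal_pow]
    exact (sq_eq_sq₀ (norm_nonneg _) hs).1 this
  have n2 : ‖J (c (c g))‖ ^ 2 = 2 * (s ^ 2) ^ 2 := by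
    rw [← @inner_self_eq_norm_sq ℂ, adj', comm, comm, vac, map_zero, zero_add, map_smul, ← two_smul ℂ,
      map_smul, map_smul, inner_smul_right, inner_smul_right, inner_self_eq_norm_sq_to_K, n1,
      RCLike.ofReal_eq_complex_ofReal, RCLike.re_eq_complex_re]
    norm_cast
    ring
  have n2' : ‖J (c (c g))‖ ≤ 3 / 2 * s ^ 2 := by
    refine abs_le_of_sq_le_sq' ?_ (by positivity) |>.2
    nlinarith [sq_nonneg (s ^ 2)]
  -- Here `2|m|s ≤ m² + s²`, and `√2 ≤ 3/2` was used for `c (c g)`.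
  have ny : ‖J y‖ ≤ 5 / 2 * (m ^ 2 + s ^ 2) := by
    rw [hy, map_add, map_smul]
    refine (norm_add_le _ _).trans ?_
    rw [norm_smul, n1]
    have : ‖(2 * m : ℂ)‖ = 2 * |m| := by simp
    rw [this]
    nlinarith [sq_nonneg (|m| - s), sq_abs m, sq_nonneg m]
  have hgy : ⟪J y, J g⟫_ℂ = 0 := by
    rw [← inner_conj_symm, hy, map_add, map_smul, inner_add_right, inner_smul_right, hgc, hgc]
    simp
  have e1 : ⟪J (R (R g)), J φ⟫_ℂ = ⟪J g, J (R (R φ))⟫_ℂ := by rw [hsymm, hsymm]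
  have e2 : ⟪J (R (R g)), J φ⟫_ℂ = ((m ^ 2 + s ^ 2 : ℝ) : ℂ) * θ +
      (((m ^ 2 + s ^ 2 : ℝ) : ℂ) * ⟪J g, J φ - θ • J g⟫_ℂ + ⟪J y, J φ - θ • J g⟫_ℂ) := by
    rw [hRR, map_add, map_smul, inner_add_left, inner_smul_left, Complex.conj_ofReal,
      inner_sub_right, inner_sub_right, inner_smul_right, inner_smul_right, hgy,
      inner_self_eq_norm_sq_to_K, hg]
    simp only [RCLike.ofReal_one]
    ring
  have hMn : ‖((m ^ 2 + s ^ 2 : ℝ) : ℂ)‖ = m ^ 2 + s ^ 2 := by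
    rw [Complex.norm_real, Real.norm_of_nonneg (by positivity)]
  have e3 : ‖⟪J g, J (R (R φ))⟫_ℂ‖ ≤ ‖J (R (R φ))‖ := by
    simpa [hg] using norm_inner_le_norm (𝕜 := ℂ) (J g) (J (R (R φ)))
  have e4 : ‖⟪J g, J φ - θ • J g⟫_ℂ‖ ≤ 1 / 10 := by
    refine (norm_inner_le_norm _ _).trans ?_
    rwa [hg, one_mul]
  have e5 : ‖⟪J y, J φ - θ • J g⟫_ℂ‖ ≤ 5 / 2 * (m ^ 2 + s ^ 2) * (1 / 10) :=
    (norm_inner_le_norm _ _).trans (by gcongr)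
  rw [e1] at e2
  have e6 : ((m ^ 2 + s ^ 2 : ℝ) : ℂ) * θ = ⟪J g, J (R (R φ))⟫_ℂ -
      (((m ^ 2 + s ^ 2 : ℝ) : ℂ) * ⟪J g, J φ - θ • J g⟫_ℂ + ⟪J y, J φ - θ • J g⟫_ℂ) := by
    rw [e2]; ring
  -- The errors add up to `1/10 + 1/4 < 1/2` of `m² + s²` and are absorbed on the left, whence the
  -- factor 2 in the conclusion.
  have e7 : m ^ 2 + s ^ 2 ≤ ‖J (R (R φ))‖ + ((m ^ 2 + s ^ 2) * (1 / 10) +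
      5 / 2 * (m ^ 2 + s ^ 2) * (1 / 10)) := by
    calc m ^ 2 + s ^ 2 = ‖((m ^ 2 + s ^ 2 : ℝ) : ℂ) * θ‖ := by rw [norm_mul, hMn, hθ, mul_one]
      _ ≤ _ := by
        rw [e6]
        refine (norm_sub_le _ _).trans (add_le_add e3 ((norm_add_le _ _).trans (add_le_add ?_ e5)))
        rw [norm_mul, hMn]
        gcongr
  nlinarith [sq_nonneg m, sq_nonneg s]

end Fock

/-! ### Quadratures on Schwartz functions -/

section Quadratures

variable {n : ℕ}

theorem inner_incl (φ χ : Sch n) :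
    ⟪incl n φ, incl n χ⟫_ℂ = ∫ x, (starRingEnd ℂ) (φ x) * χ x := by
  have := SchwartzMap.inner_toL2_toL2_eq φ χ (volume : Measure (EuclideanSpace ℝ (Fin n)))
  refine this.trans (integral_congr_ae (Filter.Eventually.of_forall fun x => ?_))
  simp [mul_comm]

theorem position_symm (j : Fin n) (φ χ : Sch n) :
    ⟪incl n (position j φ), incl n χ⟫_ℂ = ⟪incl n φ, incl n (position j χ)⟫_ℂ := by
  rw [inner_incl, inner_incl]
  refine integral_congr_ae (Filter.Eventually.of_forall fun x => ?_)
  simp only [position_apply, map_mul, Complex.conj_ofReal]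
  ring

/-- Integration by parts; its sign is compensated by conjugating `-i`. -/
theorem momentum_symm (j : Fin n) (φ χ : Sch n) :
    ⟪incl n (momentum j φ), incl n χ⟫_ℂ = ⟪incl n φ, incl n (momentum j χ)⟫_ℂ := by
  rw [inner_incl, inner_incl]
  have h := SchwartzMap.integral_bilinear_lineDerivOp_right_eq_neg_left (μ := volume) φ χ
    ((ContinuousLinearMap.mul ℝ ℂ).comp (Complex.conjCLE : ℂ →L[ℝ] ℂ)) (EuclideanSpace.single j (1 : ℝ))
  simp only [SchwartzMap.lineDerivOp_apply_eq_fderiv, ContinuousLinearMap.comp_apply,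
    ContinuousLinearMap.mul_apply', ContinuousLinearEquiv.coe_coe, Complex.conjCLE_apply] at h
  simp only [momentum_apply, map_mul, map_neg, Complex.conj_I, neg_neg]
  have e1 : ∀ x, (starRingEnd ℂ) (φ x) * (-Complex.I * fderiv ℝ χ x (EuclideanSpace.single j 1)) =
      -Complex.I * ((starRingEnd ℂ) (φ x) * fderiv ℝ χ x (EuclideanSpace.single j 1)) := fun x => by ring
  have e2 : ∀ x, Complex.I * (starRingEnd ℂ) (fderiv ℝ φ x (EuclideanSpace.single j 1)) * χ x =
      Complex.I * ((starRingEnd ℂ) (fderiv ℝ φ x (EuclideanSpace.single j 1)) * χ x) := fun x => by ring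
  simp only [e1, e2, integral_const_mul, h]
  ring

theorem quadCore_symm (k : QIdx n) (φ χ : Sch n) :
    ⟪incl n (quadCore k φ), incl n χ⟫_ℂ = ⟪incl n φ, incl n (quadCore k χ)⟫_ℂ := by
  unfold quadCore
  split_ifs
  · exact position_symm _ _ _
  · exact momentum_symm _ _ _

theorem position_comm (i j : Fin n) (φ : Sch n) :
    position i (position j φ) = position j (position i φ) := by
  ext x
  simp only [position_apply]
  ring

theorem momentum_comm (i j : Fin n) (φ : Sch n) :
    momentum i (momentum j φ) = momentum j (momentum i φ) := by
  ext x
  have hd : ∀ v : EuclideanSpace ℝ (Fin n), ∀ w,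
      fderiv ℝ (fun y => fderiv ℝ φ y v) x w = fderiv ℝ (fderiv ℝ φ) x w v := by
    intro v w
    have h1 : DifferentiableAt ℝ (fderiv ℝ φ) x :=
      ((φ.smooth 2).fderiv_right (m := 1) (by norm_num)).differentiable one_ne_zero x
    rw [fderiv_clm_apply h1 (differentiableAt_const v)]
    simp
  have hs : IsSymmSndFDerivAt ℝ φ x :=
    ((φ.smooth 2).contDiffAt).isSymmSndFDerivAt (by simp)
  have hm : ∀ j : Fin n, (momentum j φ : EuclideanSpace ℝ (Fin n) → ℂ) =
      fun y => -Complex.I * fderiv ℝ φ y (EuclideanSpace.single j 1) := fun j => by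
    funext y; exact momentum_apply j φ y
  have hdd : ∀ v, DifferentiableAt ℝ (fun y => fderiv ℝ φ y v) x := fun v =>
    (((φ.smooth 2).fderiv_right (m := 1) (by norm_num)).differentiable one_ne_zero x).clm_apply
      (differentiableAt_const v)
  rw [momentum_apply, momentum_apply, hm, hm, fderiv_const_mul (hdd _), fderiv_const_mul (hdd _)]
  simp only [FunLike.coe_smul, Pi.smul_apply, hd, smul_eq_mul]
  rw [hs]

/-- The product rule: differentiating the factor `x i` produces the commutator. -/
theorem position_momentum_comm (i j : Fin n) (φ : Sch n) :
    position i (momentum j φ) =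
      momentum j (position i φ) + (if i = j then Complex.I else 0) • φ := by
  ext x
  have hp : (position i φ : EuclideanSpace ℝ (Fin n) → ℂ) = fun y => ((y i : ℝ) : ℂ) * φ y := by
    funext y; exact position_apply i φ y
  have h1 : HasFDerivAt (fun y : EuclideanSpace ℝ (Fin n) => ((y i : ℝ) : ℂ))
      (Complex.ofRealCLM ∘L (EuclideanSpace.proj i : EuclideanSpace ℝ (Fin n) →L[ℝ] ℝ)) x :=
    (Complex.ofRealCLM ∘L
      (EuclideanSpace.proj i : EuclideanSpace ℝ (Fin n) →L[ℝ] ℝ)).hasFDerivAt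
  have h3 : HasFDerivAt (fun y : EuclideanSpace ℝ (Fin n) => ((y i : ℝ) : ℂ) * φ y) _ x :=
    h1.mul (φ.hasFDerivAt x)
  rw [add_apply, smul_apply, position_apply, momentum_apply, momentum_apply, hp, h3.fderiv]
  simp only [FunLike.coe_add, Pi.add_apply, FunLike.coe_smul,
    Pi.smul_apply, ContinuousLinearMap.comp_apply, smul_eq_mul,
    Complex.ofRealCLM_apply]
  have hs : (EuclideanSpace.proj i : EuclideanSpace ℝ (Fin n) →L[ℝ] ℝ)
      (EuclideanSpace.single j 1) = if i = j then 1 else 0 := by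
    simp
  rw [hs]
  by_cases hij : i = j
  · simp only [hij, if_true, Complex.ofReal_one]
    ring
  · simp only [hij, if_false, Complex.ofReal_zero]
    ring

/-- The symplectic form: `[R̂ₖ, R̂ₗ] = i Ωₖₗ`. -/
def sympl (k l : QIdx n) : ℝ :=
  if k.1 = l.1 then (if k.2 = 0 then (if l.2 = 0 then 0 else 1) else (if l.2 = 0 then -1 else 0))
  else 0

theorem quadCore_comm (k l : QIdx n) (φ : Sch n) :
    quadCore k (quadCore l φ) =
      quadCore l (quadCore k φ) + (Complex.I * (sympl k l : ℂ)) • φ := by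
  unfold quadCore sympl
  by_cases hk : k.2 = 0 <;> by_cases hl : l.2 = 0
  · simp [hk, hl, position_comm k.1 l.1]
  · by_cases h : k.1 = l.1 <;> simp [hk, hl, position_momentum_comm, h]
  · by_cases h : k.1 = l.1
    · simp [hk, hl, position_momentum_comm, h]
    · simp [hk, hl, position_momentum_comm, h, Ne.symm h]
  · simp [hk, hl, momentum_comm k.1 l.1]

theorem sympl_antisymm (k l : QIdx n) : sympl k l = -sympl l k := by
  unfold sympl
  by_cases h : k.1 = l.1
  · by_cases hk : k.2 = 0 <;> by_cases hl : l.2 = 0 <;> simp [h, hk, hl]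
  · simp [h, Ne.symm h]

theorem sum_sympl_zero (i : Fin n) (c : QIdx n → ℂ) :
    ∑ l, (sympl (i, 0) l : ℂ) * c l = c (i, 1) := by
  rw [Fintype.sum_prod_type, Finset.sum_eq_single i]
  · simp [sympl]
  · intro j _ hj
    simp [sympl, hj.symm]
  · simp

theorem sum_sympl_one (i : Fin n) (c : QIdx n → ℂ) :
    ∑ l, (sympl (i, 1) l : ℂ) * c l = -c (i, 0) := by
  rw [Fintype.sum_prod_type, Finset.sum_eq_single i]
  · simp [sympl]
  · intro j _ hj
    simp [sympl, hj.symm]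
  · simp

/-- The operator `∑ₖ wₖ (R̂ₖ - mₖ)`. -/
def linQuad (w : QIdx n → ℂ) (m : QIdx n → ℝ) : Sch n →ₗ[ℂ] Sch n :=
  ∑ k, w k • (quadCore k - (m k : ℂ) • LinearMap.id)

theorem linQuad_apply (w : QIdx n → ℂ) (m : QIdx n → ℝ) (φ : Sch n) :
    linQuad w m φ = ∑ k, w k • (quadCore k φ - (m k : ℂ) • φ) := by
  simp [linQuad]

/-- The symplectic pairing `i ∑ₖₗ wₖ w'ₗ Ωₖₗ`, the commutator of two linear operators. -/
def commPair (w w' : QIdx n → ℂ) : ℂ :=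
  Complex.I * ∑ k, ∑ l, w k * w' l * (sympl k l : ℂ)

/-- The shifts `m k` are scalars and drop out, so the commutator of linear combinations is the
bilinear extension of `[R̂ₖ, R̂ₗ] = i Ωₖₗ`. -/
theorem linQuad_comm (w w' : QIdx n → ℂ) (m : QIdx n → ℝ) (φ : Sch n) :
    linQuad w m (linQuad w' m φ) = linQuad w' m (linQuad w m φ) + commPair w w' • φ := by
  have key : ∀ k l, (quadCore k - (m k : ℂ) • LinearMap.id : Sch n →ₗ[ℂ] Sch n)
      ((quadCore l - (m l : ℂ) • LinearMap.id : Sch n →ₗ[ℂ] Sch n) φ) =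
      (quadCore l - (m l : ℂ) • LinearMap.id : Sch n →ₗ[ℂ] Sch n)
      ((quadCore k - (m k : ℂ) • LinearMap.id : Sch n →ₗ[ℂ] Sch n) φ) +
        (Complex.I * (sympl k l : ℂ)) • φ := by
    intro k l
    simp only [LinearMap.sub_apply, LinearMap.smul_apply, LinearMap.id_apply, map_sub, map_smul,
      quadCore_comm k l φ]
    module
  simp only [linQuad, LinearMap.sum_apply, LinearMap.smul_apply, map_sum, map_smul, commPair,
    Finset.smul_sum, Finset.mul_sum, Finset.sum_smul]
  conv_rhs => arg 2; rw [Finset.sum_comm]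
  conv_rhs => arg 1; rw [Finset.sum_comm]
  rw [← Finset.sum_add_distrib]
  refine Finset.sum_congr rfl fun k _ => ?_
  rw [← Finset.sum_add_distrib]
  refine Finset.sum_congr rfl fun l _ => ?_
  rw [key l k, smul_add, smul_add, smul_smul, smul_smul, smul_smul, smul_smul, mul_comm (w' k)]
  congr 2
  ring

theorem linQuad_adj (w : QIdx n → ℂ) (m : QIdx n → ℝ) (φ χ : Sch n) :
    ⟪incl n (linQuad w m φ), incl n χ⟫_ℂ =
      ⟪incl n φ, incl n (linQuad (fun k => (starRingEnd ℂ) (w k)) m χ)⟫_ℂ := by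
  rw [linQuad_apply, linQuad_apply, map_sum, map_sum, sum_inner, inner_sum]
  refine Finset.sum_congr rfl fun k _ => ?_
  rw [map_smul, map_smul, map_sub, map_sub, map_smul, map_smul, inner_smul_left, inner_smul_right,
    inner_sub_left, inner_sub_right, quadCore_symm, inner_smul_left, inner_smul_right,
    Complex.conj_ofReal]

theorem linQuad_eq_quadCore (k : QIdx n) (m : QIdx n → ℝ) (φ : Sch n) :
    linQuad (fun l => if l = k then 1 else 0) m φ = quadCore k φ - (m k : ℂ) • φ := by
  rw [linQuad_apply, Finset.sum_eq_single k]
  · rw [if_pos rfl, one_smul]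
  · intro l _ hl
    rw [if_neg hl, zero_smul]
  · exact fun h => absurd (Finset.mem_univ k) h

end Quadratures

/-! ### Normal modes -/

section NormalModes

variable {n : ℕ}

/-- The coefficients `C` of annihilation operators `aⱼ = ∑ₖ Cⱼₖ (R̂ₖ - mₖ)` satisfying the canonical
commutation relations. -/
structure IsCCR (C : Fin n → QIdx n → ℂ) : Prop where
  ann_ann : ∀ i j, commPair (C i) (C j) = 0
  ann_cre : ∀ i j, commPair (C i) (fun k => (starRingEnd ℂ) (C j k)) = if i = j then 1 else 0

/-- The annihilation operators with coefficients `C`. -/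
def ann (C : Fin n → QIdx n → ℂ) (m : QIdx n → ℝ) (j : Fin n) : Sch n →ₗ[ℂ] Sch n :=
  linQuad (C j) m

/-- The creation operators, formally adjoint to `ann C m`. -/
def cre (C : Fin n → QIdx n → ℂ) (m : QIdx n → ℝ) (j : Fin n) : Sch n →ₗ[ℂ] Sch n :=
  linQuad (fun k => (starRingEnd ℂ) (C j k)) m

theorem commPair_conj (w w' : QIdx n → ℂ) :
    commPair (fun k => (starRingEnd ℂ) (w k)) (fun k => (starRingEnd ℂ) (w' k)) =
      -(starRingEnd ℂ) (commPair w w') := by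
  simp [commPair]

theorem commPair_antisymm (w w' : QIdx n → ℂ) : commPair w w' = -commPair w' w := by
  simp only [commPair]
  rw [Finset.sum_comm, ← mul_neg, ← Finset.sum_neg_distrib]
  congr 1
  refine Finset.sum_congr rfl fun l _ => ?_
  rw [← Finset.sum_neg_distrib]
  refine Finset.sum_congr rfl fun k _ => ?_
  rw [sympl_antisymm k l]
  push_cast
  ring

theorem IsCCR.fockModes {C : Fin n → QIdx n → ℂ} (hC : IsCCR C) {m : QIdx n → ℝ} {g : Sch n}
    (hg : ∀ j, ann C m j g = 0) (hg1 : ‖incl n g‖ = 1) :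
    FockModes (incl n) (ann C m) (cre C m) g where
  adj j φ χ := linQuad_adj _ _ _ _
  comm j k φ := by
    unfold ann cre
    rw [linQuad_comm, hC.ann_cre]
    split_ifs <;> simp
  comm_cre j k φ := by
    unfold cre
    rw [linQuad_comm, commPair_conj, hC.ann_ann]
    simp
  vacuum := hg
  norm_vacuum := hg1

/-- The coefficients of the creation operators in the quadratures. -/
def creCoeff (C : Fin n → QIdx n → ℂ) (k : QIdx n) (j : Fin n) : ℂ :=
  -Complex.I * ∑ l, (sympl k l : ℂ) * C j l

/-- The quadratures are recovered from the annihilation and creation operators. -/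
theorem IsCCR.inversion {C : Fin n → QIdx n → ℂ} (hC : IsCCR C) (k k' : QIdx n) :
    ∑ j, (creCoeff C k j * (starRingEnd ℂ) (C j k') + (starRingEnd ℂ) (creCoeff C k j) * C j k') =
      if k' = k then 1 else 0 := by
  let A : Matrix (Fin n ⊕ Fin n) (QIdx n) ℂ :=
    Matrix.of fun s k => Sum.elim (fun j => C j k) (fun j => (starRingEnd ℂ) (C j k)) s
  let B : Matrix (QIdx n) (Fin n ⊕ Fin n) ℂ :=
    Matrix.of fun k s => Sum.elim (fun j => (starRingEnd ℂ) (creCoeff C k j)) (fun j => creCoeff C k j) s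
  have e : (Fin n ⊕ Fin n) ≃ QIdx n := Fintype.equivOfCardEq (by simp [mul_two])
  have h1 : ∀ (w w' : QIdx n → ℂ), ∑ k, w k * (Complex.I * ∑ l, (sympl k l : ℂ) * w' l) =
      commPair w w' := by
    intro w w'
    simp only [commPair, Finset.mul_sum]
    refine Finset.sum_congr rfl fun k _ => Finset.sum_congr rfl fun l _ => ?_
    ring
  have hconj : ∀ k j, (starRingEnd ℂ) (creCoeff C k j) =
      Complex.I * ∑ l, (sympl k l : ℂ) * (starRingEnd ℂ) (C j l) := by
    intro k j
    simp [creCoeff]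
  have hneg : ∀ k j, creCoeff C k j = -(Complex.I * ∑ l, (sympl k l : ℂ) * C j l) := by
    intro k j
    simp [creCoeff]
  -- The commutation relations say that the symplectic transpose `B` is a right inverse of the
  -- coefficient matrix `A`. Both have size `2n`, so it is also a left inverse, and `B * A = 1` is
  -- the inversion formula.
  have hAB : A * B = 1 := by
    ext s t
    rw [Matrix.mul_apply]
    rcases s with i | i <;> rcases t with j | j
    · simp only [A, B, Matrix.of_apply, Sum.elim_inl, hconj, h1, hC.ann_cre, Matrix.one_apply,
        Sum.inl.injEq]
    · simp only [A, B, Matrix.of_apply, Sum.elim_inl, Sum.elim_inr, hneg, mul_neg,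
        Finset.sum_neg_distrib, h1, hC.ann_ann, Matrix.one_apply]
      simp
    · simp only [A, B, Matrix.of_apply, Sum.elim_inl, Sum.elim_inr, hconj, h1, commPair_conj,
        hC.ann_ann, Matrix.one_apply]
      simp
    · simp only [A, B, Matrix.of_apply, Sum.elim_inr, hneg, mul_neg, Finset.sum_neg_distrib, h1,
        Matrix.one_apply, Sum.inr.injEq]
      rw [commPair_antisymm, hC.ann_cre, neg_neg]
      simp [eq_comm]
  have hBA : B * A = 1 := (Matrix.mul_eq_one_comm_of_equiv e).1 hAB
  have := congrFun (congrFun hBA k) k'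
  rw [Matrix.mul_apply, Fintype.sum_sum_type, Matrix.one_apply] at this
  simp only [A, B, Matrix.of_apply, Sum.elim_inl, Sum.elim_inr] at this
  rw [Finset.sum_add_distrib, add_comm, this]
  simp [eq_comm]

theorem IsCCR.quadCore_eq {C : Fin n → QIdx n → ℂ} (hC : IsCCR C) (m : QIdx n → ℝ) (k : QIdx n)
    (φ : Sch n) :
    quadCore k φ = (m k : ℂ) • φ + ∑ j, creCoeff C k j • cre C m j φ +
      ∑ j, (starRingEnd ℂ) (creCoeff C k j) • ann C m j φ := by
  have h := linQuad_eq_quadCore k m φ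
  rw [add_assoc, ← sub_eq_iff_eq_add', ← h, ← Finset.sum_add_distrib]
  simp only [cre, ann, linQuad_apply, Finset.smul_sum, smul_smul, ← Finset.sum_add_distrib, ← add_smul]
  rw [Finset.sum_comm]
  refine Finset.sum_congr rfl fun k' _ => ?_
  rw [← Finset.sum_smul, hC.inversion]

/-- The symplectic form only swaps position and momentum coefficients up to sign. -/
theorem sum_norm_creCoeff (C : Fin n → QIdx n → ℂ) (j : Fin n) :
    ∑ k, ‖creCoeff C k j‖ ^ 2 = ∑ k, ‖C j k‖ ^ 2 := by
  have h0 : ∀ i, ‖creCoeff C (i, 0) j‖ = ‖C j (i, 1)‖ := fun i => by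
    simp only [creCoeff, sum_sympl_zero, norm_mul, norm_neg, Complex.norm_I, one_mul]
  have h1 : ∀ i, ‖creCoeff C (i, 1) j‖ = ‖C j (i, 0)‖ := fun i => by
    simp only [creCoeff, sum_sympl_one, norm_mul, norm_neg, Complex.norm_I, one_mul]
  rw [Fintype.sum_prod_type, Fintype.sum_prod_type]
  refine Finset.sum_congr rfl fun i _ => ?_
  rw [Fin.sum_univ_two, Fin.sum_univ_two, h0, h1, add_comm]

/-- The number operators of the normal modes reproduce the symmetric quadratic forms. -/
theorem sum_ann_cre_eq (C : Fin n → QIdx n → ℂ) (m : QIdx n → ℝ) (j : Fin n) (φ : Sch n) :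
    cre C m j (ann C m j φ) + ann C m j (cre C m j φ) =
      ∑ k, ∑ l, ((starRingEnd ℂ) (C j k) * C j l + C j k * (starRingEnd ℂ) (C j l)) •
        ((quadCore k - (m k : ℂ) • LinearMap.id : Sch n →ₗ[ℂ] Sch n)
          ((quadCore l - (m l : ℂ) • LinearMap.id : Sch n →ₗ[ℂ] Sch n) φ)) := by
  simp only [ann, cre, linQuad, LinearMap.sum_apply, LinearMap.smul_apply, map_sum, map_smul,
    Finset.smul_sum, smul_smul, ← Finset.sum_add_distrib, ← add_smul]
  rw [Finset.sum_comm]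
  refine Finset.sum_congr rfl fun k _ => Finset.sum_congr rfl fun l _ => ?_
  congr 1
  ring

end NormalModes

/-! ### The closed quadratures -/

section Closed

variable {n : ℕ}

theorem toOperator_incl {A : Sch n →ₗ[ℂ] Sch n}
    (hA : ∀ φ χ, ⟪incl n (A φ), incl n χ⟫_ℂ = ⟪incl n φ, incl n (A χ)⟫_ℂ) (φ : Sch n) :
    ∃ h : incl n φ ∈ (toOperator A).domain, toOperator A ⟨incl n φ, h⟩ = incl n (A φ) :=
  (toOperator_apply_iff A _ _).2 fun χ => hA φ χ

theorem applyOrZero_toOperator {A : Sch n →ₗ[ℂ] Sch n} {f : Hilb n}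
    (hf : f ∈ (toOperator A).domain) (φ : Sch n) :
    ⟪applyOrZero (toOperator A) f, incl n φ⟫_ℂ = ⟪f, incl n (A φ)⟫_ℂ := by
  rw [applyOrZero, dif_pos hf]
  exact (toOperator_apply_iff A f _).1 ⟨hf, rfl⟩ φ

theorem applyOrZero_smul {H : Type*} [NormedAddCommGroup H] [InnerProductSpace ℂ H]
    (T : H →ₗ.[ℂ] H) {f : H} (hf : f ∈ T.domain) (z : ℂ) :
    applyOrZero T (z • f) = z • applyOrZero T f := by
  rw [applyOrZero, applyOrZero, dif_pos hf, dif_pos (T.domain.smul_mem z hf), ← T.map_smul]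
  rfl

theorem quad_incl_mem (k : QIdx n) (φ : Sch n) : incl n φ ∈ (quad k).domain :=
  (toOperator_incl (quadCore_symm k) φ).choose

theorem applyOrZero_quad_incl (k : QIdx n) (φ : Sch n) :
    applyOrZero (quad k) (incl n φ) = incl n (quadCore k φ) := by
  rw [applyOrZero, dif_pos (quad_incl_mem k φ)]
  exact (toOperator_incl (quadCore_symm k) φ).choose_spec

end Closed

/-! ### Gaussian Schwartz functions -/

section GaussianSchwartz

/-- The power is at most `N! e^(1 + t)`, and `t ≤ ε t² + 1 / (4 ε)` lets the Gaussian factor absorb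
the remaining exponential. -/
theorem exists_one_add_pow_mul_exp_le (N : ℕ) (c : ℝ) {ε : ℝ} (hε : 0 < ε) :
    ∃ M : ℝ, 0 ≤ M ∧ ∀ t : ℝ, 0 ≤ t → (1 + t) ^ N * Real.exp (c - ε * t ^ 2) ≤ M := by
  refine ⟨N.factorial * Real.exp (1 + 1 / (4 * ε) + c), by positivity, fun t ht => ?_⟩
  have h1 : (1 + t) ^ N ≤ N.factorial * Real.exp (1 + t) := by
    have := Real.pow_div_factorial_le_exp (1 + t) (by linarith) N
    rwa [div_le_iff₀ (by positivity), mul_comm] at this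
  have h2 : t ≤ ε * t ^ 2 + 1 / (4 * ε) := by
    have : ε * t ^ 2 + 1 / (4 * ε) - t = ε * (t - 1 / (2 * ε)) ^ 2 := by
      field_simp
      ring
    have h3 : 0 ≤ ε * (t - 1 / (2 * ε)) ^ 2 := by positivity
    linarith
  calc (1 + t) ^ N * Real.exp (c - ε * t ^ 2)
      ≤ N.factorial * Real.exp (1 + t) * Real.exp (c - ε * t ^ 2) := by gcongr
    _ = N.factorial * Real.exp (1 + t + (c - ε * t ^ 2)) := by rw [mul_assoc, ← Real.exp_add]
    _ ≤ _ := mul_le_mul_of_nonneg_left (Real.exp_le_exp.2 (by linarith)) (by positivity)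

theorem norm_iteratedFDeriv_cexp (i : ℕ) (z : ℂ) :
    ‖iteratedFDeriv ℝ i Complex.exp z‖ = ‖Complex.exp z‖ := by
  have h : ContDiffAt ℂ i Complex.exp z := Complex.contDiff_exp.contDiffAt
  rw [← h.restrictScalars_iteratedFDeriv (𝕜 := ℝ), Function.comp_apply,
    ContinuousMultilinearMap.norm_restrictScalars, norm_iteratedFDeriv_eq_norm_iteratedDeriv,
    iteratedDeriv_eq_iterate, Complex.iter_deriv_exp]

variable {E : Type*} [NormedAddCommGroup E] [NormedSpace ℝ E]

/-- The exponential of a function of temperate growth whose real part is at most `c - ε ‖x‖²`. -/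
def expSchwartz (q : E → ℂ) (hq : q.HasTemperateGrowth) {c ε : ℝ} (hε : 0 < ε)
    (hle : ∀ x, (q x).re ≤ c - ε * ‖x‖ ^ 2) : 𝓢(E, ℂ) where
  toFun x := Complex.exp (q x)
  smooth' := Complex.contDiff_exp.comp hq.1
  decay' := by
    intro k N
    obtain ⟨r, K, hK0, hK⟩ := hq.norm_iteratedFDeriv_le_uniform N
    obtain ⟨M, hM0, hM⟩ := exists_one_add_pow_mul_exp_le (k + r * N) c hε
    refine ⟨N.factorial * (1 + K) ^ N * M, fun x => ?_⟩
    have hexp : ‖Complex.exp (q x)‖ ≤ Real.exp (c - ε * ‖x‖ ^ 2) := by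
      rw [Complex.norm_exp]
      exact Real.exp_le_exp.2 (hle x)
    have hx : (1 : ℝ) ≤ (1 + ‖x‖) ^ r := one_le_pow₀ (by linarith [norm_nonneg x])
    have hD1 : 1 ≤ (1 + K) * (1 + ‖x‖) ^ r := by nlinarith
    -- The Faà di Bruno estimate wants the `i`-th derivative of `q` bounded by `D ^ i`. Taking `1 +
    -- K` rather than `K` ensures `D ≥ 1`, so a single bound serves all `i ≥ 1`.
    have hb := norm_iteratedFDeriv_comp_le (𝕜 := ℝ) (g := Complex.exp) (f := q) (n := N) (N := N)
      Complex.contDiff_exp (hq.1.of_le (by exact_mod_cast le_top)) le_rfl x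
      (C := Real.exp (c - ε * ‖x‖ ^ 2)) (D := (1 + K) * (1 + ‖x‖) ^ r)
      (fun i _ => by rw [norm_iteratedFDeriv_cexp]; exact hexp)
      (fun i hi hiN => by
        calc ‖iteratedFDeriv ℝ i q x‖ ≤ K * (1 + ‖x‖) ^ r := hK i hiN x
          _ ≤ (1 + K) * (1 + ‖x‖) ^ r := by nlinarith
          _ ≤ _ := le_self_pow₀ hD1 (by omega))
    calc ‖x‖ ^ k * ‖iteratedFDeriv ℝ N (fun x => Complex.exp (q x)) x‖
        ≤ (1 + ‖x‖) ^ k * (N.factorial * Real.exp (c - ε * ‖x‖ ^ 2) *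
            ((1 + K) * (1 + ‖x‖) ^ r) ^ N) := by
          gcongr
          · linarith
          · exact hb
      _ = N.factorial * (1 + K) ^ N * ((1 + ‖x‖) ^ (k + r * N) * Real.exp (c - ε * ‖x‖ ^ 2)) := by
          rw [mul_pow, ← pow_mul, pow_add]
          ring
      _ ≤ _ := by
          gcongr
          exact hM _ (norm_nonneg x)

end GaussianSchwartz

/-! ### The Gaussian wave function annihilated by given normal modes -/

section Vacuum

variable {n : ℕ}

/-- The polynomial `-½ ∑ᵢⱼ Zᵢⱼ xᵢ xⱼ + ∑ᵢ bᵢ xᵢ`. -/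
def quadPoly (Z : Matrix (Fin n) (Fin n) ℂ) (b : Fin n → ℂ) (x : EuclideanSpace ℝ (Fin n)) : ℂ :=
  -(1 / 2) * ∑ i, ∑ j, Z i j * ((x i : ℂ) * (x j : ℂ)) + ∑ i, b i * (x i : ℂ)

/-- A coordinate as a complex-valued linear map. -/
def coordCLM (i : Fin n) : EuclideanSpace ℝ (Fin n) →L[ℝ] ℂ :=
  Complex.ofRealCLM ∘L (EuclideanSpace.proj i : EuclideanSpace ℝ (Fin n) →L[ℝ] ℝ)

theorem coordCLM_apply (i : Fin n) (x : EuclideanSpace ℝ (Fin n)) : coordCLM i x = (x i : ℂ) := rfl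

theorem quadPoly_hasTemperateGrowth (Z : Matrix (Fin n) (Fin n) ℂ) (b : Fin n → ℂ) :
    (quadPoly Z b).HasTemperateGrowth := by
  have hc : ∀ i : Fin n, (fun x : EuclideanSpace ℝ (Fin n) => (x i : ℂ)).HasTemperateGrowth :=
    fun i => (coordCLM i).hasTemperateGrowth
  refine Function.HasTemperateGrowth.add ?_ ?_
  · refine (Function.HasTemperateGrowth.const _).mul ?_
    refine Function.HasTemperateGrowth.sum fun i _ => Function.HasTemperateGrowth.sum fun j _ => ?_
    exact (Function.HasTemperateGrowth.const _).mul ((hc i).mul (hc j))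
  · refine Function.HasTemperateGrowth.sum fun i _ => ?_
    exact (Function.HasTemperateGrowth.const _).mul (hc i)

theorem hasFDerivAt_quadPoly (Z : Matrix (Fin n) (Fin n) ℂ) (b : Fin n → ℂ)
    (x : EuclideanSpace ℝ (Fin n)) :
    HasFDerivAt (quadPoly Z b)
      ((-(1 / 2) : ℂ) • ∑ i, ∑ j, Z i j • ((x i : ℂ) • coordCLM j + (x j : ℂ) • coordCLM i) +
        ∑ i, b i • coordCLM i) x := by
  have hc : ∀ i : Fin n, HasFDerivAt (fun x : EuclideanSpace ℝ (Fin n) => (x i : ℂ)) (coordCLM i) x :=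
    fun i => (coordCLM i).hasFDerivAt
  refine HasFDerivAt.add ?_ ?_
  · refine HasFDerivAt.const_mul ?_ _
    refine HasFDerivAt.fun_sum fun i _ => HasFDerivAt.fun_sum fun j _ => ?_
    exact ((hc i).mul (hc j)).const_mul _
  · exact HasFDerivAt.fun_sum fun i _ => (hc i).const_mul _

theorem fderiv_quadPoly_single {Z : Matrix (Fin n) (Fin n) ℂ} (hZ : Z.transpose = Z) (b : Fin n → ℂ)
    (x : EuclideanSpace ℝ (Fin n)) (k : Fin n) :
    ((-(1 / 2) : ℂ) • ∑ i, ∑ j, Z i j • ((x i : ℂ) • coordCLM j + (x j : ℂ) • coordCLM i) +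
        ∑ i, b i • coordCLM i : EuclideanSpace ℝ (Fin n) →L[ℝ] ℂ) (EuclideanSpace.single k 1) =
      -(∑ l, Z k l * (x l : ℂ)) + b k := by
  have hs : ∀ i, coordCLM i (EuclideanSpace.single k (1 : ℝ)) = if i = k then 1 else 0 := by
    intro i
    rw [coordCLM_apply]
    by_cases h : i = k <;> simp [h]
  have hZ' : ∀ i, Z i k = Z k i := fun i => congrFun (congrFun hZ k) i
  simp only [FunLike.coe_add, FunLike.coe_smul, FunLike.coe_sum, Pi.add_apply, Pi.smul_apply,
    Finset.sum_apply, hs, smul_eq_mul, mul_ite, mul_one, mul_zero, mul_add, Finset.sum_add_distrib,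
    Finset.sum_ite_eq', Finset.mem_univ, if_true]
  rw [Finset.sum_comm (γ := Fin n) (f := fun i j => if i = k then Z i j * (x j : ℂ) else 0)]
  simp only [Finset.sum_ite_eq', Finset.mem_univ, if_true, hZ']
  ring

variable {C : Fin n → QIdx n → ℂ}

/-- The position block of the coefficients. -/
def posBlock (C : Fin n → QIdx n → ℂ) : Matrix (Fin n) (Fin n) ℂ := Matrix.of fun i k => C i (k, 0)

/-- The momentum block of the coefficients. -/
def momBlock (C : Fin n → QIdx n → ℂ) : Matrix (Fin n) (Fin n) ℂ := Matrix.of fun i k => C i (k, 1)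

theorem commPair_eq (w w' : QIdx n → ℂ) :
    commPair w w' = Complex.I * ∑ k, (w (k, 0) * w' (k, 1) - w (k, 1) * w' (k, 0)) := by
  have h : ∀ k, ∑ l, w k * w' l * (sympl k l : ℂ) = w k * ∑ l, (sympl k l : ℂ) * w' l := by
    intro k
    rw [Finset.mul_sum]
    exact Finset.sum_congr rfl fun l _ => by ring
  rw [commPair]
  simp only [h]
  rw [Fintype.sum_prod_type]
  congr 1
  refine Finset.sum_congr rfl fun k _ => ?_
  rw [Fin.sum_univ_two, sum_sympl_zero, sum_sympl_one]
  ring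

/-- With `X` the position block and `P` the momentum block, this encodes `[aᵢ, aⱼ] = 0`;
`block_comm` encodes `[aᵢ, aⱼ†] = δᵢⱼ`. -/
theorem IsCCR.block_symm (hC : IsCCR C) :
    posBlock C * (momBlock C).transpose = momBlock C * (posBlock C).transpose := by
  ext i j
  have := hC.ann_ann i j
  rw [commPair_eq, mul_eq_zero, Finset.sum_sub_distrib, sub_eq_zero] at this
  simpa [Matrix.mul_apply, posBlock, momBlock] using this.resolve_left Complex.I_ne_zero

theorem IsCCR.block_comm (hC : IsCCR C) :
    Complex.I • (posBlock C * (momBlock C).conjTranspose -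
      momBlock C * (posBlock C).conjTranspose) = 1 := by
  ext i j
  have := hC.ann_cre i j
  rw [commPair_eq, Finset.sum_sub_distrib] at this
  rw [Matrix.one_apply, ← this]
  simp [Matrix.mul_apply, posBlock, momBlock]

-- If `v P = 0`, both terms of `i (X Pᴴ - P Xᴴ) = 1` vanish when sandwiched between `v` and its
-- conjugate, leaving `‖v‖² = 0`.
open Matrix ComplexOrder in
theorem IsCCR.isUnit_momBlock (hC : IsCCR C) : IsUnit (momBlock C).det := by
  rw [isUnit_iff_ne_zero]
  intro hdet
  obtain ⟨v, hv, hv0⟩ := Matrix.exists_vecMul_eq_zero_iff.2 hdet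
  refine hv ?_
  have h2 : (momBlock C)ᴴ *ᵥ star v = 0 := by
    rw [Matrix.mulVec_conjTranspose, star_star, hv0, star_zero]
  have h3 : v ⬝ᵥ ((1 : Matrix (Fin n) (Fin n) ℂ) *ᵥ star v) = 0 := by
    rw [← hC.block_comm, Matrix.smul_mulVec, Matrix.sub_mulVec, ← Matrix.mulVec_mulVec, h2,
      ← Matrix.mulVec_mulVec, Matrix.mulVec_zero, zero_sub, dotProduct_smul, dotProduct_neg,
      Matrix.dotProduct_mulVec, hv0, zero_dotProduct]
    simp
  rw [Matrix.one_mulVec] at h3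
  exact dotProduct_self_star_eq_zero.1 h3

/-- The matrix of the Gaussian wave function annihilated by `ann C m`. -/
def vacuumMatrix (C : Fin n → QIdx n → ℂ) : Matrix (Fin n) (Fin n) ℂ :=
  Complex.I • ((momBlock C)⁻¹ * posBlock C)

theorem IsCCR.momBlock_mul_vacuumMatrix (hC : IsCCR C) :
    momBlock C * vacuumMatrix C = Complex.I • posBlock C := by
  rw [vacuumMatrix, Matrix.mul_smul, ← Matrix.mul_assoc, Matrix.mul_nonsing_inv _ hC.isUnit_momBlock,
    Matrix.one_mul]

/-- `P⁻¹ X` is symmetric because `X Pᵀ = P Xᵀ`. -/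
theorem IsCCR.transpose_vacuumMatrix (hC : IsCCR C) :
    (vacuumMatrix C).transpose = vacuumMatrix C := by
  have hP := hC.isUnit_momBlock
  have hPt : IsUnit (momBlock C).transpose.det := by rwa [Matrix.det_transpose]
  rw [vacuumMatrix, Matrix.transpose_smul, Matrix.transpose_mul, Matrix.transpose_nonsing_inv]
  congr 1
  calc (posBlock C).transpose * (momBlock C).transpose⁻¹
      = (momBlock C)⁻¹ * (momBlock C * (posBlock C).transpose) * (momBlock C).transpose⁻¹ := by
        rw [← Matrix.mul_assoc, Matrix.nonsing_inv_mul _ hP, Matrix.one_mul]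
    _ = (momBlock C)⁻¹ * posBlock C := by
        rw [← hC.block_symm, Matrix.mul_assoc, Matrix.mul_assoc, Matrix.mul_nonsing_inv _ hPt,
          Matrix.mul_one]

-- Substituting `x = Pᴴ y` and using `i (X Pᴴ - P Xᴴ) = 1` gives `Re xᵀ Z x = ½ ‖y‖²`. So the
-- Gaussian decays, and `‖x‖ ≤ ‖Pᴴ‖ ‖y‖` makes the rate explicit.
open Matrix in
theorem IsCCR.re_vacuumMatrix (hC : IsCCR C) :
    ∃ δ : ℝ, 0 < δ ∧ ∀ x : EuclideanSpace ℝ (Fin n),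
      δ * ‖x‖ ^ 2 ≤ (∑ i, ∑ j, vacuumMatrix C i j * ((x i : ℂ) * (x j : ℂ))).re := by
  set P := momBlock C with hPdef
  set X := posBlock C with hXdef
  have hP : IsUnit P.det := hC.isUnit_momBlock
  have hPh : IsUnit Pᴴ.det := by rw [Matrix.det_conjTranspose]; exact hP.star
  set T := Matrix.toEuclideanCLM (𝕜 := ℂ) Pᴴ
  refine ⟨1 / (2 * (‖T‖ ^ 2 + 1)), by positivity, fun x => ?_⟩
  set xc : Fin n → ℂ := fun i => (x i : ℂ) with hxc
  have hstar : star xc = xc := by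
    funext i
    simp [xc]
  set y : Fin n → ℂ := (Pᴴ)⁻¹ *ᵥ xc with hy
  have hxy : xc = Pᴴ *ᵥ y := by
    rw [hy, Matrix.mulVec_mulVec, Matrix.mul_nonsing_inv _ hPh, Matrix.one_mulVec]
  have hxy' : xc = star y ᵥ* P := by
    rw [← hstar, hxy, Matrix.star_mulVec, Matrix.conjTranspose_conjTranspose]
  have hsum : ∑ i, ∑ j, vacuumMatrix C i j * ((x i : ℂ) * (x j : ℂ)) =
      xc ⬝ᵥ (vacuumMatrix C *ᵥ xc) := by
    simp only [dotProduct, Matrix.mulVec, Finset.mul_sum, hxc]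
    refine Finset.sum_congr rfl fun i _ => Finset.sum_congr rfl fun j _ => ?_
    ring
  have h1 : xc ⬝ᵥ (vacuumMatrix C *ᵥ xc) = Complex.I * (star y ⬝ᵥ ((X * Pᴴ) *ᵥ y)) := by
    nth_rewrite 1 [hxy']
    rw [← Matrix.dotProduct_mulVec, Matrix.mulVec_mulVec, hC.momBlock_mul_vacuumMatrix,
      Matrix.smul_mulVec, dotProduct_smul, smul_eq_mul]
    nth_rewrite 1 [hxy]
    rw [Matrix.mulVec_mulVec]
  have h2 : star (xc ⬝ᵥ (vacuumMatrix C *ᵥ xc)) = -Complex.I * (star y ⬝ᵥ ((P * Xᴴ) *ᵥ y)) := by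
    rw [h1, star_mul, ← star_dotProduct_star, star_star, Matrix.star_mulVec,
      Matrix.conjTranspose_mul, Matrix.conjTranspose_conjTranspose]
    simp only [Complex.star_def, Complex.conj_I]
    rw [← Matrix.dotProduct_mulVec, mul_comm]
  have h3 : xc ⬝ᵥ (vacuumMatrix C *ᵥ xc) + star (xc ⬝ᵥ (vacuumMatrix C *ᵥ xc)) = star y ⬝ᵥ y := by
    rw [h2, h1]
    have h0 : star y ⬝ᵥ y = star y ⬝ᵥ ((1 : Matrix (Fin n) (Fin n) ℂ) *ᵥ y) := by
      rw [Matrix.one_mulVec]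
    rw [h0, ← hC.block_comm, Matrix.smul_mulVec, Matrix.sub_mulVec, dotProduct_smul, dotProduct_sub,
      smul_eq_mul]
    ring
  have h4 : (xc ⬝ᵥ (vacuumMatrix C *ᵥ xc)).re = (1 / 2) * ∑ i, ‖y i‖ ^ 2 := by
    have := congrArg Complex.re h3
    rw [Complex.star_def, Complex.add_conj] at this
    have hyy : star y ⬝ᵥ y = ((∑ i, ‖y i‖ ^ 2 : ℝ) : ℂ) := by
      simp only [dotProduct, Pi.star_apply, Complex.star_def]
      push_cast
      exact Finset.sum_congr rfl fun i _ => Complex.conj_mul' (y i)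
    rw [hyy, Complex.ofReal_re, Complex.ofReal_re] at this
    linarith
  have h5 : ‖x‖ ^ 2 ≤ ‖T‖ ^ 2 * ∑ i, ‖y i‖ ^ 2 := by
    have hle := T.le_opNorm (WithLp.toLp 2 y)
    have e1 : ‖T (WithLp.toLp 2 y)‖ ^ 2 = ‖x‖ ^ 2 := by
      have : T (WithLp.toLp 2 y) = WithLp.toLp 2 xc := by
        rw [hxy]; rfl
      rw [this, EuclideanSpace.norm_sq_eq, EuclideanSpace.norm_sq_eq]
      simp [xc]
    have e2 : ‖(WithLp.toLp 2 y : EuclideanSpace ℂ (Fin n))‖ ^ 2 = ∑ i, ‖y i‖ ^ 2 := by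
      rw [EuclideanSpace.norm_sq_eq]
    rw [← e1, ← e2, ← mul_pow]
    gcongr
  rw [hsum, h4]
  have hS : 0 ≤ ∑ i, ‖y i‖ ^ 2 := by positivity
  rw [div_mul_eq_mul_div, one_mul, div_le_iff₀ (by positivity)]
  nlinarith

/-- Every set of normal modes has a normalised Gaussian vacuum. -/
theorem IsCCR.exists_vacuum (hC : IsCCR C) (m : QIdx n → ℝ) :
    ∃ g : Sch n, (∀ j, ann C m j g = 0) ∧ ‖incl n g‖ = 1 ∧ (∀ x, g x ≠ 0) ∧
      ∃ c ε : ℝ, 0 < ε ∧ ∀ x, ‖g x‖ ≤ Real.exp (c - ε * ‖x‖ ^ 2) := by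
  obtain ⟨δ, hδ, hre⟩ := hC.re_vacuumMatrix
  -- For `exp (-½ xᵀ Z x + b·x)` the equation `a g = 0` reads `X x - i P (b - Z x) = d`. It is
  -- solved by `P Z = i X` and `P b = i d`.
  set d : Fin n → ℂ := fun j => ∑ k, C j k * (m k : ℂ) with hd
  set b : Fin n → ℂ := Complex.I • ((momBlock C)⁻¹.mulVec d) with hb
  have hq := quadPoly_hasTemperateGrowth (vacuumMatrix C) b
  set K : ℝ := ∑ i, ‖b i‖ with hK
  have hle : ∀ x, (quadPoly (vacuumMatrix C) b x).re ≤ K ^ 2 / δ - (δ / 4) * ‖x‖ ^ 2 := by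
    intro x
    have h1 : (∑ i, b i * (x i : ℂ)).re ≤ K * ‖x‖ := by
      refine (Complex.re_le_norm _).trans ((norm_sum_le _ _).trans ?_)
      rw [hK, Finset.sum_mul]
      refine Finset.sum_le_sum fun i _ => ?_
      rw [norm_mul, Complex.norm_real]
      gcongr
      exact PiLp.norm_apply_le x i
    have h2 := hre x
    have h3 : (quadPoly (vacuumMatrix C) b x).re =
        -(1 / 2) * (∑ i, ∑ j, vacuumMatrix C i j * ((x i : ℂ) * (x j : ℂ))).re +
          (∑ i, b i * (x i : ℂ)).re := by
      rw [quadPoly, Complex.add_re]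
      congr 1
      rw [show (-(1 / 2) : ℂ) = ((-(1 / 2) : ℝ) : ℂ) by push_cast; rfl, Complex.re_ofReal_mul]
    -- Half of the decay `δ/2 ‖x‖²` is spent on absorbing the linear term.
    have h4 : K * ‖x‖ ≤ K ^ 2 / δ + δ / 4 * ‖x‖ ^ 2 := by
      have : K ^ 2 / δ + δ / 4 * ‖x‖ ^ 2 - K * ‖x‖ = (K - δ / 2 * ‖x‖) ^ 2 / δ := by
        field_simp
        ring
      have h5 : 0 ≤ (K - δ / 2 * ‖x‖) ^ 2 / δ := by positivity
      linarith
    rw [h3]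
    linarith
  have hε : 0 < δ / 4 := by positivity
  set g0 : Sch n := expSchwartz _ hq hε hle with hg0
  have hg0x : ∀ x, g0 x = Complex.exp (quadPoly (vacuumMatrix C) b x) := fun x => rfl
  have hpos : ∀ k x, quadCore (k, 0) g0 x = (x k : ℂ) * g0 x := fun k x => position_apply k g0 x
  have hmom : ∀ k x, quadCore (k, 1) g0 x =
      -Complex.I * ((-(∑ l, vacuumMatrix C k l * (x l : ℂ)) + b k) * g0 x) := by
    intro k x
    have h1 := (hasFDerivAt_quadPoly (vacuumMatrix C) b x).cexp
    have : (g0 : EuclideanSpace ℝ (Fin n) → ℂ) = fun x => Complex.exp (quadPoly (vacuumMatrix C) b x) := rfl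
    change momentum k g0 x = _
    rw [momentum_apply, this, h1.fderiv, FunLike.coe_smul, Pi.smul_apply,
      fderiv_quadPoly_single hC.transpose_vacuumMatrix, smul_eq_mul]
    ring
  have hann : ∀ j, ann C m j g0 = 0 := by
    intro j
    ext x
    have e1 : ∀ l, ∑ k, C j (k, 1) * vacuumMatrix C k l = Complex.I * C j (l, 0) := by
      intro l
      have := congrFun (congrFun hC.momBlock_mul_vacuumMatrix j) l
      simpa [Matrix.mul_apply, momBlock, posBlock] using this
    have e2 : ∑ k, C j (k, 1) * b k = Complex.I * d j := by
      have : (momBlock C).mulVec b = Complex.I • d := by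
        rw [hb, Matrix.mulVec_smul, Matrix.mulVec_mulVec,
          Matrix.mul_nonsing_inv _ hC.isUnit_momBlock, Matrix.one_mulVec]
      have := congrFun this j
      simpa [Matrix.mulVec, dotProduct, momBlock] using this
    have e3 : ∑ k, C j (k, 1) * ∑ l, vacuumMatrix C k l * (x l : ℂ) =
        Complex.I * ∑ l, C j (l, 0) * (x l : ℂ) := by
      simp only [Finset.mul_sum]
      rw [Finset.sum_comm]
      refine Finset.sum_congr rfl fun l _ => ?_
      rw [← mul_assoc, ← e1, Finset.sum_mul]
      exact Finset.sum_congr rfl fun k _ => by ring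
    have e4 : (ann C m j g0) x = ∑ k, C j k * (quadCore k g0 x - (m k : ℂ) * g0 x) := by
      rw [ann, linQuad_apply, sum_apply]
      exact Finset.sum_congr rfl fun k _ => rfl
    rw [e4]
    simp only [mul_sub, Finset.sum_sub_distrib]
    have e5 : ∑ k, C j k * ((m k : ℂ) * g0 x) = d j * g0 x := by
      rw [hd, Finset.sum_mul]
      exact Finset.sum_congr rfl fun k _ => by ring
    have e6 : ∑ k, C j k * quadCore k g0 x = (∑ l, C j (l, 0) * (x l : ℂ)) * g0 x +
        Complex.I * (∑ k, C j (k, 1) * ∑ l, vacuumMatrix C k l * (x l : ℂ)) * g0 x -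
        Complex.I * (∑ k, C j (k, 1) * b k) * g0 x := by
      rw [Fintype.sum_prod_type]
      simp only [Fin.sum_univ_two, hpos, hmom, Finset.sum_add_distrib, Finset.mul_sum (s := Finset.univ)
        (a := Complex.I), Finset.sum_mul (s := Finset.univ) (a := g0 x)]
      rw [add_sub_assoc, ← Finset.sum_sub_distrib]
      congr 1
      · exact Finset.sum_congr rfl fun k _ => by ring
      · exact Finset.sum_congr rfl fun k _ => by ring
    rw [e5, e6, e3, e2]
    have hI := Complex.I_mul_I
    simp only [zero_apply]
    linear_combination ((∑ l, C j (l, 0) * (x l : ℂ)) * g0 x - d j * g0 x) * hI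
  have hg0n : ∀ x, g0 x ≠ 0 := fun x => Complex.exp_ne_zero _
  have hne : incl n g0 ≠ 0 := by
    intro h0
    have : g0 = 0 := incl_injective n (by rw [h0, map_zero])
    exact hg0n 0 (by rw [this]; rfl)
  have hnpos : 0 < ‖incl n g0‖ := norm_pos_iff.2 hne
  set r : ℂ := ((‖incl n g0‖⁻¹ : ℝ) : ℂ) with hr
  have hr0 : r ≠ 0 := by
    rw [hr, Complex.ofReal_ne_zero]
    exact inv_ne_zero hnpos.ne'
  refine ⟨r • g0, fun j => ?_, ?_, fun x => ?_, K ^ 2 / δ + Real.log ‖r‖, δ / 4, hε, fun x => ?_⟩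
  · rw [map_smul, hann, smul_zero]
  · rw [map_smul, norm_smul, hr, Complex.norm_real, norm_inv, norm_norm, inv_mul_cancel₀ hnpos.ne']
  · exact mul_ne_zero hr0 (hg0n x)
  · have h1 : (r • g0) x = r * g0 x := rfl
    rw [h1, norm_mul, hg0x, Complex.norm_exp, add_sub_right_comm, Real.exp_add,
      Real.exp_log (norm_pos_iff.2 hr0), mul_comm]
    gcongr
    exact hle x

end Vacuum

/-! ### Completeness of the number states -/

section Moments

open scoped FourierTransform ContDiff

variable {V : Type*} [NormedAddCommGroup V] [InnerProductSpace ℝ V] [FiniteDimensional ℝ V]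
  [MeasurableSpace V] [BorelSpace V]

/-- The exponential series of the Fourier kernel may be integrated termwise, since `exp (2π‖t‖‖x‖)
‖F x‖` is an integrable majorant. Each term is a multiple of a moment. -/
theorem fourier_eq_zero_of_moments {F : V → ℂ} (hF : AEStronglyMeasurable F)
    (hint : ∀ s : ℝ, Integrable (fun x => Real.exp (s * ‖x‖) * ‖F x‖))
    (hmom : ∀ (t : V) (k : ℕ), ∫ x, ((⟪x, t⟫_ℝ : ℝ) : ℂ) ^ k * F x = 0) (t : V) : 𝓕 F t = 0 := by
  rw [Real.fourier_eq']
  have h := hasSum_integral_of_dominated_convergence (μ := (volume : Measure V))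
    (F := fun k x => ((k.factorial : ℂ)⁻¹ * (-2 * Real.pi * Complex.I) ^ k) *
      (((⟪x, t⟫_ℝ : ℝ) : ℂ) ^ k * F x))
    (f := fun x => Complex.exp ((↑(-2 * Real.pi * ⟪x, t⟫_ℝ) * Complex.I)) • F x)
    (fun k x => (2 * Real.pi * ‖t‖ * ‖x‖) ^ k / k.factorial * ‖F x‖)
    (fun k => by
      refine AEStronglyMeasurable.const_mul (AEStronglyMeasurable.mul ?_ hF) _
      exact Continuous.aestronglyMeasurable (by fun_prop))
    (fun k => Filter.Eventually.of_forall fun x => by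
      rw [norm_mul, norm_mul, norm_mul, norm_inv, norm_pow, norm_pow, Complex.norm_natCast,
        Complex.norm_real, ← mul_assoc]
      gcongr
      have h1 : ‖(-2 * Real.pi * Complex.I : ℂ)‖ = 2 * Real.pi := by
        simp [abs_of_pos Real.pi_pos]
      rw [h1, div_eq_inv_mul, mul_assoc, ← mul_pow]
      have h2 := norm_inner_le_norm (𝕜 := ℝ) x t
      have h3 : 2 * Real.pi * ‖⟪x, t⟫_ℝ‖ ≤ 2 * Real.pi * ‖t‖ * ‖x‖ := by
        have := Real.pi_pos
        nlinarith
      gcongr)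
    (Filter.Eventually.of_forall fun x => by
      have h1 := Real.summable_pow_div_factorial (2 * Real.pi * ‖t‖ * ‖x‖)
      exact h1.mul_right ‖F x‖)
    (by
      have : (fun x => ∑' k : ℕ, (2 * Real.pi * ‖t‖ * ‖x‖) ^ k / k.factorial * ‖F x‖) =
          fun x => Real.exp (2 * Real.pi * ‖t‖ * ‖x‖) * ‖F x‖ := by
        funext x
        rw [tsum_mul_right, Real.exp_eq_exp_ℝ, NormedSpace.exp_eq_tsum_div]
      rw [this]
      exact hint _)
    (Filter.Eventually.of_forall fun x => by
      have h1 := NormedSpace.expSeries_div_hasSum_exp (𝔸 := ℂ)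
        (↑(-2 * Real.pi * ⟪x, t⟫_ℝ) * Complex.I)
      rw [← Complex.exp_eq_exp_ℂ] at h1
      have h2 := h1.mul_right (F x)
      have h3 : (fun k : ℕ => ((k.factorial : ℂ)⁻¹ * (-2 * Real.pi * Complex.I) ^ k) *
          (((⟪x, t⟫_ℝ : ℝ) : ℂ) ^ k * F x)) =
          fun k : ℕ => (↑(-2 * Real.pi * ⟪x, t⟫_ℝ) * Complex.I) ^ k / k.factorial * F x := by
        funext k
        push_cast
        rw [mul_right_comm _ ((⟪x, t⟫_ℝ : ℝ) : ℂ), mul_pow _ ((⟪x, t⟫_ℝ : ℝ) : ℂ)]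
        ring
      rw [h3]
      exact h2)
  refine h.unique ?_
  convert hasSum_zero with k
  rw [integral_const_mul, hmom, mul_zero]

/-- An exponentially decaying function all of whose moments vanish is zero. -/
theorem ae_eq_zero_of_moments {F : V → ℂ} (hF : AEStronglyMeasurable F)
    (hint : ∀ s : ℝ, Integrable (fun x => Real.exp (s * ‖x‖) * ‖F x‖))
    (hmom : ∀ (t : V) (k : ℕ), ∫ x, ((⟪x, t⟫_ℝ : ℝ) : ℂ) ^ k * F x = 0) : ∀ᵐ x, F x = 0 := by
  have hFi : Integrable F := by
    rw [← integrable_norm_iff hF]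
    simpa using hint 0
  refine ae_eq_zero_of_integral_contDiff_smul_eq_zero hFi.locallyIntegrable fun g hg hgc => ?_
  have hg' : ContDiff ℝ ∞ (fun x => (g x : ℂ)) := Complex.ofRealCLM.contDiff.comp hg
  have hgc' : HasCompactSupport (fun x => (g x : ℂ)) :=
    hgc.comp_left (g := fun r : ℝ => (r : ℂ)) Complex.ofReal_zero
  set χ : 𝓢(V, ℂ) := hgc'.toSchwartzMap hg' with hχ
  have hχx : ∀ x, χ x = (g x : ℂ) := fun x => rfl
  have hinv : 𝓕 (𝓕⁻ χ) = χ := FourierTransform.fourier_fourierInv_eq χ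
  -- The test function is the Fourier transform of a Schwartz function; the multiplication formula
  -- moves the transform onto `F`, where it vanishes.
  have h := VectorFourier.integral_fourierIntegral_smul_eq_flip (e := Real.fourierChar)
    (L := innerₗ V) (μ := (volume : Measure V)) (ν := (volume : Measure V)) (f := F)
    (g := (𝓕⁻ χ : 𝓢(V, ℂ))) Real.continuous_fourierChar (by exact continuous_inner) hFi
    (𝓕⁻ χ : 𝓢(V, ℂ)).integrable
  have h1 : ∀ ξ, VectorFourier.fourierIntegral Real.fourierChar volume (innerₗ V) F ξ = 0 :=
    fun ξ => fourier_eq_zero_of_moments hF hint hmom ξ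
  have h2 : ∀ x, VectorFourier.fourierIntegral Real.fourierChar volume (innerₗ V).flip
      (𝓕⁻ χ : 𝓢(V, ℂ)) x = χ x := by
    intro x
    rw [flip_innerₗ]
    have := congrArg (fun φ : 𝓢(V, ℂ) => φ x) hinv
    exact this
  simp only [h1, h2, zero_smul, integral_zero, hχx] at h
  rw [h]
  refine integral_congr_ae (Filter.Eventually.of_forall fun x => ?_)
  simp [mul_comm]

end Moments

/-! ### Density of the number states over a Gaussian vacuum -/

section Completeness

variable {n : ℕ}

/-- Completing the square absorbs `s ‖x‖` into half of the Gaussian decay, leaving a Schwartz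
majorant. -/
theorem memLp_of_norm_le_exp {g : Sch n} {c ε : ℝ} (hε : 0 < ε)
    (hg : ∀ x, ‖g x‖ ≤ Real.exp (c - ε * ‖x‖ ^ 2)) (s : ℝ) :
    MemLp (fun x => Real.exp (s * ‖x‖) * ‖g x‖) 2 := by
  have hq : (fun x : EuclideanSpace ℝ (Fin n) =>
      ((c + s ^ 2 / (2 * ε) - ε / 2 * ‖x‖ ^ 2 : ℝ) : ℂ)).HasTemperateGrowth := by
    have h1 : (fun x : EuclideanSpace ℝ (Fin n) =>
        c + s ^ 2 / (2 * ε) - ε / 2 * ‖x‖ ^ 2).HasTemperateGrowth :=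
      (Function.HasTemperateGrowth.const _).sub
        ((Function.HasTemperateGrowth.const _).mul (Function.hasTemperateGrowth_norm_sq _))
    exact Complex.ofRealCLM.hasTemperateGrowth.comp h1
  set χ : Sch n := expSchwartz _ hq (c := c + s ^ 2 / (2 * ε)) (half_pos hε)
    (fun x => by rw [Complex.ofReal_re])
  refine MemLp.of_le (χ.memLp 2 volume) ?_ (Filter.Eventually.of_forall fun x => ?_)
  · exact (Continuous.mul (by fun_prop) g.continuous.norm).aestronglyMeasurable
  · have h1 : χ x = Complex.exp ((c + s ^ 2 / (2 * ε) - ε / 2 * ‖x‖ ^ 2 : ℝ) : ℂ) := rfl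
    rw [h1, Complex.norm_exp, Complex.ofReal_re, norm_mul, norm_norm, Real.norm_eq_abs,
      Real.abs_exp]
    refine (mul_le_mul_of_nonneg_left (hg x) (Real.exp_pos _).le).trans ?_
    rw [← Real.exp_add, Real.exp_le_exp]
    have : (c + s ^ 2 / (2 * ε) - ε / 2 * ‖x‖ ^ 2) - (s * ‖x‖ + (c - ε * ‖x‖ ^ 2)) =
        (s - ε * ‖x‖) ^ 2 / (2 * ε) := by
      field_simp
      ring
    have h2 : 0 ≤ (s - ε * ‖x‖) ^ 2 / (2 * ε) := by positivity
    linarith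

/-- The position operator in the direction `t`. -/
def positionAlong (t : EuclideanSpace ℝ (Fin n)) : Sch n →ₗ[ℂ] Sch n :=
  ∑ i, (t i : ℂ) • quadCore (i, 0)

theorem positionAlong_apply (t : EuclideanSpace ℝ (Fin n)) (φ : Sch n)
    (x : EuclideanSpace ℝ (Fin n)) :
    positionAlong t φ x = ((⟪x, t⟫_ℝ : ℝ) : ℂ) * φ x := by
  have hpos : ∀ k, quadCore (k, 0) φ x = (x k : ℂ) * φ x := fun k => position_apply k φ x
  have h1 : positionAlong t φ x = ∑ i, (t i : ℂ) * quadCore (i, 0) φ x := by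
    simp only [positionAlong, LinearMap.sum_apply, LinearMap.smul_apply, sum_apply]
    rfl
  rw [h1, PiLp.inner_apply]
  simp only [hpos]
  push_cast
  rw [Finset.sum_mul]
  refine Finset.sum_congr rfl fun i _ => ?_
  simp
  ring

theorem positionAlong_iterate (t : EuclideanSpace ℝ (Fin n)) (φ : Sch n) (k : ℕ)
    (x : EuclideanSpace ℝ (Fin n)) :
    ((positionAlong t)^[k] φ) x = ((⟪x, t⟫_ℝ : ℝ) : ℂ) ^ k * φ x := by
  induction k with
  | zero => simp
  | succ k ih => rw [Function.iterate_succ_apply', positionAlong_apply, ih, pow_succ]; ring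

theorem cre_mem_span_word {C : Fin n → QIdx n → ℂ} {m : QIdx n → ℝ} {g : Sch n} (j : Fin n)
    {u : Sch n} (hu : u ∈ Submodule.span ℂ (Set.range (word (cre C m) g))) :
    cre C m j u ∈ Submodule.span ℂ (Set.range (word (cre C m) g)) := by
  have : Submodule.span ℂ (Set.range (word (cre C m) g)) ≤
      (Submodule.span ℂ (Set.range (word (cre C m) g))).comap (cre C m j) := by
    rw [Submodule.span_le]
    rintro _ ⟨L, rfl⟩
    exact Submodule.subset_span ⟨j :: L, rfl⟩
  exact this hu

/-- The annihilator is commuted to the right until it meets the vacuum. -/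
theorem ann_mem_span_word {C : Fin n → QIdx n → ℂ} {m : QIdx n → ℝ} {g : Sch n}
    (h : FockModes (incl n) (ann C m) (cre C m) g) (j : Fin n)
    {u : Sch n} (hu : u ∈ Submodule.span ℂ (Set.range (word (cre C m) g))) :
    ann C m j u ∈ Submodule.span ℂ (Set.range (word (cre C m) g)) := by
  have : Submodule.span ℂ (Set.range (word (cre C m) g)) ≤
      (Submodule.span ℂ (Set.range (word (cre C m) g))).comap (ann C m j) := by
    rw [Submodule.span_le]
    rintro _ ⟨L, rfl⟩
    rw [SetLike.mem_coe, Submodule.mem_comap]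
    induction L with
    | nil =>
      have : word (cre C m) g [] = g := rfl
      rw [this, h.vacuum]
      exact Submodule.zero_mem _
    | cons k L ih =>
      have : word (cre C m) g (k :: L) = cre C m k (word (cre C m) g L) := rfl
      rw [this, h.comm]
      refine Submodule.add_mem _ (cre_mem_span_word k ih) ?_
      split_ifs
      · exact Submodule.subset_span ⟨L, rfl⟩
      · exact Submodule.zero_mem _
  exact this hu

/-- The number states over a Gaussian vacuum span a dense subspace. -/
theorem IsCCR.dense_words {C : Fin n → QIdx n → ℂ} (hC : IsCCR C) {m : QIdx n → ℝ} {g : Sch n}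
    (h : FockModes (incl n) (ann C m) (cre C m) g) (hg0 : ∀ x, g x ≠ 0) {c ε : ℝ} (hε : 0 < ε)
    (hg : ∀ x, ‖g x‖ ≤ Real.exp (c - ε * ‖x‖ ^ 2)) :
    Dense (Submodule.span ℂ (Set.range fun L => incl n (word (cre C m) g L)) : Set (Hilb n)) := by
  set W := Submodule.span ℂ (Set.range (word (cre C m) g)) with hW
  -- The span of words is invariant under all quadratures, hence contains every `⟨x, t⟩ ^ k g`. A
  -- vector `f` orthogonal to it makes all moments of `conj f * g` vanish.
  have hquad : ∀ k, ∀ u ∈ W, quadCore k u ∈ W := by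
    intro k u hu
    rw [hC.quadCore_eq m k u]
    refine W.add_mem (W.add_mem (W.smul_mem _ hu) ?_) ?_
    · exact W.sum_mem fun j _ => W.smul_mem _ (cre_mem_span_word j hu)
    · exact W.sum_mem fun j _ => W.smul_mem _ (ann_mem_span_word h j hu)
  have hpos : ∀ (t : EuclideanSpace ℝ (Fin n)) (k : ℕ), (positionAlong t)^[k] g ∈ W := by
    intro t k
    induction k with
    | zero => exact Submodule.subset_span ⟨[], rfl⟩
    | succ k ih =>
      rw [Function.iterate_succ_apply', positionAlong, LinearMap.sum_apply]
      exact W.sum_mem fun i _ => W.smul_mem _ (hquad _ _ ih)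
  have hrange : (Set.range fun L => incl n (word (cre C m) g L)) =
      incl n '' Set.range (word (cre C m) g) := by
    rw [← Set.range_comp]; rfl
  rw [hrange, Submodule.span_image, Submodule.dense_iff_topologicalClosure_eq_top,
    Submodule.topologicalClosure_eq_top_iff, Submodule.eq_bot_iff]
  intro f hf
  have horth : ∀ u ∈ W, ⟪f, incl n u⟫_ℂ = 0 := fun u hu =>
    (Submodule.mem_orthogonal' _ _).1 hf _ (Submodule.mem_map_of_mem hu)
  have hinner : ∀ u : Sch n, ⟪f, incl n u⟫_ℂ = ∫ x, (starRingEnd ℂ) (f x) * u x := by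
    intro u
    rw [L2.inner_def]
    refine integral_congr_ae ?_
    filter_upwards [u.coeFn_toLp 2 volume] with x hx
    have : (incl n u : EuclideanSpace ℝ (Fin n) → ℂ) x = u x := hx
    rw [this]
    simp [mul_comm]
  have hfm : MemLp f 2 volume := Lp.memLp f
  set F : EuclideanSpace ℝ (Fin n) → ℂ := fun x => (starRingEnd ℂ) (f x) * g x with hF
  have hFm : AEStronglyMeasurable F :=
    (Complex.continuous_conj.comp_aestronglyMeasurable hfm.1).mul g.continuous.aestronglyMeasurable
  have hFint : ∀ s : ℝ, Integrable (fun x => Real.exp (s * ‖x‖) * ‖F x‖) := by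
    intro s
    have h1 := hfm.norm.integrable_mul (memLp_of_norm_le_exp hε hg s)
    refine h1.congr (Filter.Eventually.of_forall fun x => ?_)
    simp only [Pi.mul_apply, hF, norm_mul, RCLike.norm_conj]
    ring
  have hFmom : ∀ (t : EuclideanSpace ℝ (Fin n)) (k : ℕ),
      ∫ x, ((⟪x, t⟫_ℝ : ℝ) : ℂ) ^ k * F x = 0 := by
    intro t k
    rw [← horth _ (hpos t k), hinner]
    refine integral_congr_ae (Filter.Eventually.of_forall fun x => ?_)
    simp only [positionAlong_iterate, hF]
    ring
  have hz := ae_eq_zero_of_moments hFm hFint hFmom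
  rw [Lp.ext_iff]
  filter_upwards [hz, Lp.coeFn_zero ℂ 2 (volume : Measure (EuclideanSpace ℝ (Fin n)))] with x hx h0
  rw [h0, Pi.zero_apply]
  -- The Gaussian `g` has no zeros, so it can be divided out.
  have := (mul_eq_zero.1 hx).resolve_right (hg0 x)
  simpa using this

/-- Every set of normal modes is realised as Fock modes with a dense set of number states. -/
theorem IsCCR.exists_fockModes {C : Fin n → QIdx n → ℂ} (hC : IsCCR C) (m : QIdx n → ℝ) :
    ∃ g : Sch n, FockModes (incl n) (ann C m) (cre C m) g ∧
      Dense (Submodule.span ℂ (Set.range fun L => incl n (word (cre C m) g L)) : Set (Hilb n)) := by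
  obtain ⟨g, hg, hg1, hg0, c, ε, hε, hle⟩ := hC.exists_vacuum m
  have h := hC.fockModes hg hg1
  exact ⟨g, h, hC.dense_words h hg0 hε hle⟩

end Completeness

/-! ### Normal modes of a positive definite quadratic Hamiltonian -/

section Williamson

open Matrix
open scoped MatrixOrder

/-- Entrywise complex conjugation of a vector. -/
def conjVec {ι : Type*} (v : EuclideanSpace ℂ ι) : EuclideanSpace ℂ ι :=
  WithLp.toLp 2 fun s => (starRingEnd ℂ) (v s)

theorem inner_eq_sum {ι : Type*} [Fintype ι] (u v : EuclideanSpace ℂ ι) :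
    ⟪u, v⟫_ℂ = ∑ s, (starRingEnd ℂ) (u s) * v s := by
  rw [PiLp.inner_apply]
  exact Finset.sum_congr rfl fun s _ => by simp [mul_comm]

theorem inner_conjVec {ι : Type*} [Fintype ι] (u v : EuclideanSpace ℂ ι) :
    ⟪conjVec u, conjVec v⟫_ℂ = (starRingEnd ℂ) ⟪u, v⟫_ℂ := by
  simp [inner_eq_sum, conjVec]

/-- A Hermitian matrix with purely imaginary entries and trivial kernel has half of its eigenvalues
positive, and the corresponding eigenvectors and their complex conjugates form an orthonormal
basis. -/
theorem exists_conjugate_eigenbasis {ι : Type*} [Fintype ι] [DecidableEq ι] {M : Matrix ι ι ℂ}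
    (hM : M.IsHermitian) (hconj : ∀ s t, (starRingEnd ℂ) (M s t) = -M s t) (hunit : IsUnit M)
    {n : ℕ} (hcard : Fintype.card ι = 2 * n) :
    ∃ (v : Fin n → EuclideanSpace ℂ ι) (ν : Fin n → ℝ), (∀ j, 0 < ν j) ∧
      (∀ j s, ∑ t, M s t * v j t = (ν j : ℂ) * v j s) ∧ (∀ i j, ⟪v i, v j⟫_ℂ = if i = j then 1 else 0) ∧
      (∀ i j, ⟪v i, conjVec (v j)⟫_ℂ = 0) ∧
      ∀ x y : EuclideanSpace ℂ ι, ⟪x, y⟫_ℂ =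
        ∑ j, (⟪x, v j⟫_ℂ * ⟪v j, y⟫_ℂ + ⟪x, conjVec (v j)⟫_ℂ * ⟪conjVec (v j), y⟫_ℂ) := by
  set e := hM.eigenvectorBasis with he
  set l := hM.eigenvalues with hl
  have heig : ∀ j s, ∑ t, M s t * e j t = (l j : ℂ) * e j s := by
    intro j s
    have := congrFun (hM.mulVec_eigenvectorBasis j) s
    simpa [Matrix.mulVec, dotProduct] using this
  have hl0 : ∀ j, l j ≠ 0 := by
    intro j h0
    have h1 : M.mulVec (e j) = 0 := by
      funext s
      have := heig j s
      rw [h0] at this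
      simpa [Matrix.mulVec, dotProduct] using this
    have h2 : (e j : ι → ℂ) = 0 :=
      (Matrix.mulVec_injective_iff_isUnit.2 hunit) (by rw [h1, Matrix.mulVec_zero])
    have h3 : e j = 0 := by
      ext s
      exact congrFun h2 s
    have := e.orthonormal.1 j
    rw [h3, norm_zero] at this
    exact zero_ne_one this
  -- The entries are imaginary, so conjugation sends the eigenvalue `l` to `-l`.
  have hconj_eig : ∀ j s, ∑ t, M s t * conjVec (e j) t = -(l j : ℂ) * conjVec (e j) s := by
    intro j s
    have := congrArg (starRingEnd ℂ) (heig j s)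
    rw [map_sum, map_mul, Complex.conj_ofReal] at this
    simp only [map_mul, hconj, neg_mul, Finset.sum_neg_distrib] at this
    simp only [conjVec, neg_mul, ← this, neg_neg]
  have hherm : ∀ s t, (starRingEnd ℂ) (M s t) = M t s := fun s t => hM.apply t s
  have horth : ∀ i j, l i + l j ≠ 0 → ⟪e i, conjVec (e j)⟫_ℂ = 0 := by
    intro i j hij
    have h1 : ∑ s, ∑ t, (starRingEnd ℂ) (e i s) * M s t * conjVec (e j) t =
        -(l j : ℂ) * ⟪e i, conjVec (e j)⟫_ℂ := by
      rw [inner_eq_sum, Finset.mul_sum]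
      refine Finset.sum_congr rfl fun s _ => ?_
      simp only [mul_assoc]
      rw [← Finset.mul_sum, hconj_eig]
      ring
    have h2 : ∑ s, ∑ t, (starRingEnd ℂ) (e i s) * M s t * conjVec (e j) t =
        (l i : ℂ) * ⟪e i, conjVec (e j)⟫_ℂ := by
      rw [inner_eq_sum, Finset.mul_sum, Finset.sum_comm]
      refine Finset.sum_congr rfl fun t _ => ?_
      rw [← Finset.sum_mul, ← mul_assoc]
      congr 1
      have := congrArg (starRingEnd ℂ) (heig i t)
      rw [map_sum, map_mul, Complex.conj_ofReal] at this
      rw [← this]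
      refine Finset.sum_congr rfl fun s _ => ?_
      rw [map_mul, hherm, mul_comm]
    have h3 : ((l i + l j : ℝ) : ℂ) * ⟪e i, conjVec (e j)⟫_ℂ = 0 := by
      push_cast
      linear_combination h1 - h2
    exact (mul_eq_zero.1 h3).resolve_left (by exact_mod_cast hij)
  have hee : ∀ i j, ⟪e i, e j⟫_ℂ = if i = j then 1 else 0 := orthonormal_iff_ite.1 e.orthonormal
  have hon : ∀ S : Finset ι, (∀ i ∈ S, ∀ j ∈ S, l i + l j ≠ 0) →
      Orthonormal ℂ (Sum.elim (fun i : S => e i) (fun i : S => conjVec (e i))) := by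
    intro S hS
    rw [orthonormal_iff_ite]
    rintro (i | i) (j | j)
    · simp only [Sum.elim_inl, hee, Subtype.ext_iff, Sum.inl.injEq]
    · simp only [Sum.elim_inl, Sum.elim_inr, horth i j (hS i i.2 j j.2), reduceCtorEq, if_false]
    · rw [← inner_conj_symm]
      simp only [Sum.elim_inl, Sum.elim_inr, horth j i (hS j j.2 i i.2), reduceCtorEq, if_false,
        map_zero]
    · simp only [Sum.elim_inr, inner_conjVec, hee, Subtype.ext_iff, Sum.inr.injEq]
      split_ifs <;> simp
  -- If no two eigenvalues in `S` cancel, the eigenvectors from `S` and their conjugates are `2 |S|`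
  -- orthonormal vectors in dimension `2n`. Applied to the positive and to the negative eigenvalues,
  -- this leaves exactly `n` of each.
  have hcardle : ∀ S : Finset ι, (∀ i ∈ S, ∀ j ∈ S, l i + l j ≠ 0) → S.card ≤ n := by
    intro S hS
    have := (hon S hS).linearIndependent.fintype_card_le_finrank
    rw [finrank_euclideanSpace, hcard, Fintype.card_sum, Fintype.card_coe] at this
    omega
  set S := Finset.univ.filter fun i => 0 < l i with hSdef
  have hSmem : ∀ i, i ∈ S ↔ 0 < l i := fun i => by simp [S]
  have hS : ∀ i ∈ S, ∀ j ∈ S, l i + l j ≠ 0 := fun i hi j hj => by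
    rw [hSmem] at hi hj
    linarith
  have hSc : ∀ i ∈ Sᶜ, ∀ j ∈ Sᶜ, l i + l j ≠ 0 := fun i hi j hj => by
    rw [Finset.mem_compl, hSmem, not_lt] at hi hj
    have := lt_of_le_of_ne hi (hl0 i)
    linarith
  have hcardS : Fintype.card S = n := by
    have h1 := hcardle S hS
    have h2 := hcardle _ hSc
    rw [Finset.card_compl, hcard] at h2
    rw [Fintype.card_coe]
    omega
  let φ : Fin n ≃ S := (Fintype.equivFinOfCardEq hcardS).symm
  have hspan : (⊤ : Submodule ℂ (EuclideanSpace ℂ ι)) ≤ Submodule.span ℂ (Set.range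
      (Sum.elim (fun i : S => e i) (fun i : S => conjVec (e i)))) := by
    rw [(hon S hS).linearIndependent.span_eq_top_of_card_eq_finrank']
    rw [finrank_euclideanSpace, hcard, Fintype.card_sum, hcardS, two_mul]
  let b := OrthonormalBasis.mk (hon S hS) hspan
  have hb : ∀ s, b s = Sum.elim (fun i : S => e i) (fun i : S => conjVec (e i)) s := fun s => by
    simp [b]
  refine ⟨fun j => e (φ j), fun j => l (φ j), fun j => (hSmem _).1 (φ j).2, fun j s => heig _ s,
    fun i j => ?_, fun i j => horth _ _ (hS _ (φ i).2 _ (φ j).2), fun x y => ?_⟩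
  · rw [hee]
    simp [← Subtype.ext_iff]
  · rw [← b.sum_inner_mul_inner x y, Fintype.sum_sum_type, ← Finset.sum_add_distrib]
    simp only [hb, Sum.elim_inl, Sum.elim_inr]
    exact (Equiv.sum_comp φ fun i : S => ⟪x, e i⟫_ℂ * ⟪e i, y⟫_ℂ +
      ⟪x, conjVec (e i)⟫_ℂ * ⟪conjVec (e i), y⟫_ℂ).symm

/-- Symplectic diagonalisation of a positive definite matrix. -/
theorem exists_normalModes {n : ℕ} {h : Matrix (QIdx n) (QIdx n) ℝ} (hh : h.PosDef) :
    ∃ (C : Fin n → QIdx n → ℂ) (ν : Fin n → ℝ), IsCCR C ∧ (∀ j, 0 < ν j) ∧ ∀ k l, (h k l : ℂ) =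
      ∑ j, (ν j : ℂ) * ((starRingEnd ℂ) (C j k) * C j l + C j k * (starRingEnd ℂ) (C j l)) := by
  obtain ⟨B, hB⟩ : ∃ B : Matrix (QIdx n) (QIdx n) ℝ, h = Bᴴ * B :=
    CStarAlgebra.nonneg_iff_eq_star_mul_self.1 hh.posSemidef.nonneg
  have hBunit : IsUnit B := by
    rw [Matrix.isUnit_iff_isUnit_det, isUnit_iff_ne_zero]
    intro h0
    have := hh.det_pos
    rw [hB, Matrix.det_mul, h0, mul_zero] at this
    exact lt_irrefl _ this
  set Bc : Matrix (QIdx n) (QIdx n) ℂ := B.map (algebraMap ℝ ℂ) with hBc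
  have hBcunit : IsUnit Bc := hBunit.map (algebraMap ℝ ℂ).mapMatrix
  set Om : Matrix (QIdx n) (QIdx n) ℂ := Matrix.of fun k l => Complex.I * (sympl k l : ℂ) with hOm
  have hOmsq : Om * Om = 1 := by
    ext k l
    rw [Matrix.mul_apply]
    have h1 : ∀ k, ∑ x, Om k x * Om x l = Complex.I * Complex.I * ∑ x, (sympl k x : ℂ) * (sympl x l : ℂ) := by
      intro k
      rw [Finset.mul_sum]
      exact Finset.sum_congr rfl fun x _ => by simp only [hOm, Matrix.of_apply]; ring
    rw [h1, Complex.I_mul_I]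
    obtain ⟨i, k2⟩ := k
    obtain ⟨j, l2⟩ := l
    fin_cases k2
    · change -1 * ∑ x, (sympl (i, 0) x : ℂ) * (sympl x (j, l2) : ℂ) = _
      rw [sum_sympl_zero i (fun x => (sympl x (j, l2) : ℂ)), Matrix.one_apply]
      fin_cases l2 <;> by_cases hij : i = j <;> simp [sympl, hij]
    · change -1 * ∑ x, (sympl (i, 1) x : ℂ) * (sympl x (j, l2) : ℂ) = _
      rw [sum_sympl_one i (fun x => (sympl x (j, l2) : ℂ)), Matrix.one_apply]
      fin_cases l2 <;> by_cases hij : i = j <;> simp [sympl, hij]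
  have hOmunit : IsUnit Om := IsUnit.of_mul_eq_one Om hOmsq
  have hBconj : ∀ s t, (starRingEnd ℂ) (Bc s t) = Bc s t := fun s t => Complex.conj_ofReal _
  -- With `h = Bᵀ B`, the matrix `B (iΩ) Bᵀ` is Hermitian with imaginary entries and invertible. Its
  -- positive eigenvalues are the normal frequencies.
  set M := Bc * Om * Bcᵀ with hMdef
  have hMapply : ∀ s t, M s t = ∑ k, ∑ l, Bc s k * Om k l * Bc t l := by
    intro s t
    rw [hMdef, Matrix.mul_apply]
    simp only [Matrix.mul_apply, Matrix.transpose_apply, Finset.sum_mul]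
    exact Finset.sum_comm
  have hOmconj : ∀ k l, (starRingEnd ℂ) (Om k l) = -Om k l := fun k l => by simp [hOm]
  have hOmanti : ∀ k l, Om k l = -Om l k := fun k l => by
    simp only [hOm, Matrix.of_apply]
    rw [sympl_antisymm k l]
    push_cast
    ring
  have hMconj : ∀ s t, (starRingEnd ℂ) (M s t) = -M s t := by
    intro s t
    simp only [hMapply, map_sum, map_mul, hBconj, hOmconj, mul_neg, neg_mul, Finset.sum_neg_distrib]
  have hM : M.IsHermitian := by
    ext s t
    rw [Matrix.conjTranspose_apply, Complex.star_def, hMconj, hMapply, hMapply, Finset.sum_comm,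
      ← Finset.sum_neg_distrib]
    refine Finset.sum_congr rfl fun k _ => ?_
    rw [← Finset.sum_neg_distrib]
    refine Finset.sum_congr rfl fun l _ => ?_
    rw [hOmanti l k]
    ring
  have hMunit : IsUnit M := (hBcunit.mul hOmunit).mul
    ((Matrix.isUnit_transpose _).2 hBcunit)
  obtain ⟨v, ν, hν, heig, hvv, hvc, hres⟩ := exists_conjugate_eigenbasis hM hMconj hMunit (n := n)
    (by simp [mul_comm])
  let w : Fin n → QIdx n → ℂ := fun j k => ∑ s, Bc s k * v j s
  have hwM : ∀ (u : EuclideanSpace ℂ (QIdx n)) j,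
      commPair (fun k => ∑ s, Bc s k * u s) (w j) = (ν j : ℂ) * ∑ s, u s * v j s := by
    intro u j
    have h1 : commPair (fun k => ∑ s, Bc s k * u s) (w j) = ∑ s, u s * ∑ t, M s t * v j t := by
      simp only [commPair, w, hMapply, Finset.mul_sum, Finset.sum_mul]
      have e1 : ∀ s t : QIdx n, ∑ k, ∑ l, u s * (Bc s k * Om k l * Bc t l * v j t) =
          ∑ k, ∑ l, Complex.I * (Bc s k * u s * (Bc t l * v j t) * (sympl k l : ℂ)) := fun s t =>
        Finset.sum_congr rfl fun k _ => Finset.sum_congr rfl fun l _ => by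
          simp only [hOm, Matrix.of_apply]; ring
      simp only [e1]
      rw [Finset.sum_congr rfl fun k _ => Finset.sum_congr rfl fun l _ => Finset.sum_comm]
      rw [Finset.sum_congr rfl fun k _ => Finset.sum_comm]
      rw [Finset.sum_comm]
      refine Finset.sum_congr rfl fun s _ => ?_
      rw [Finset.sum_congr rfl fun k _ => Finset.sum_comm, Finset.sum_comm]
    rw [h1, Finset.mul_sum]
    refine Finset.sum_congr rfl fun s _ => ?_
    rw [heig]
    ring
  have hsq : ∀ j, ((Real.sqrt (ν j) : ℝ) : ℂ) * ((Real.sqrt (ν j) : ℝ) : ℂ) = (ν j : ℂ) := by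
    intro j
    rw [← Complex.ofReal_mul, Real.mul_self_sqrt (hν j).le]
  have hsq0 : ∀ j, ((Real.sqrt (ν j) : ℝ) : ℂ) ≠ 0 := fun j => by
    rw [Complex.ofReal_ne_zero]
    exact (Real.sqrt_pos.2 (hν j)).ne'
  have hwconj : ∀ j, (fun k => (starRingEnd ℂ) (w j k)) = fun k => ∑ s, Bc s k * conjVec (v j) s := by
    intro j
    funext k
    simp only [w, map_sum, map_mul, hBconj, conjVec]
  have hscale : ∀ (a a' : ℂ) (x y : QIdx n → ℂ),
      commPair (fun k => a * x k) (fun k => a' * y k) = a * a' * commPair x y := by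
    intro a a' x y
    simp only [commPair, Finset.mul_sum]
    exact Finset.sum_congr rfl fun k _ => Finset.sum_congr rfl fun l _ => by ring
  have hcw : ∀ i j, commPair (fun k => (starRingEnd ℂ) (w i k)) (w j) =
      (ν j : ℂ) * if i = j then 1 else 0 := by
    intro i j
    rw [hwconj, hwM, ← hvv, inner_eq_sum]
    rfl
  have hww : ∀ i j, commPair (w i) (w j) = 0 := by
    intro i j
    have h1 : ∑ s, v i s * v j s = (starRingEnd ℂ) ⟪v i, conjVec (v j)⟫_ℂ := by
      simp [inner_eq_sum, conjVec]
    change commPair (fun k => ∑ s, Bc s k * v i s) (w j) = 0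
    rw [hwM, h1, hvc, map_zero, mul_zero]
  -- For `w j = Bᵀ v j` the pairing of `conj (w i)` with `w j` is `ν j δᵢⱼ`. Hence the conjugate of
  -- `w j`, divided by `√(ν j)`, is the annihilation operator.
  refine ⟨fun j k => ((Real.sqrt (ν j) : ℝ) : ℂ)⁻¹ * (starRingEnd ℂ) (w j k), ν, ⟨fun i j => ?_,
    fun i j => ?_⟩, hν, fun k l => ?_⟩
  · rw [hscale, commPair_conj, hww, map_zero, neg_zero, mul_zero]
  · simp only [map_mul, Complex.conj_conj, map_inv₀, Complex.conj_ofReal]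
    rw [hscale, hcw]
    split_ifs with hij
    · rw [hij, mul_one, ← mul_inv, hsq, inv_mul_cancel₀]
      rw [Complex.ofReal_ne_zero]
      exact (hν j).ne'
    · simp
  -- Entries of `Bᵀ B` are inner products of columns of `B`; inserting the resolution of the
  -- identity by `v j` and their conjugates yields the normal form.
  · have h1 : (h k l : ℂ) = ⟪(WithLp.toLp 2 fun s => Bc s k : EuclideanSpace ℂ (QIdx n)),
        (WithLp.toLp 2 fun s => Bc s l : EuclideanSpace ℂ (QIdx n))⟫_ℂ := by
      rw [inner_eq_sum, hB, Matrix.mul_apply]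
      simp only [hBconj]
      push_cast
      exact Finset.sum_congr rfl fun s _ => by simp [hBc]
    rw [h1, hres]
    refine Finset.sum_congr rfl fun j _ => ?_
    have e1 : ∀ k, ⟪(WithLp.toLp 2 fun s => Bc s k : EuclideanSpace ℂ (QIdx n)), v j⟫_ℂ = w j k := by
      intro k
      rw [inner_eq_sum]
      exact Finset.sum_congr rfl fun s _ => by simp only [hBconj]
    have e2 : ∀ k, ⟪(WithLp.toLp 2 fun s => Bc s k : EuclideanSpace ℂ (QIdx n)), conjVec (v j)⟫_ℂ =
        (starRingEnd ℂ) (w j k) := by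
      intro k
      rw [inner_eq_sum, congrFun (hwconj j) k]
      exact Finset.sum_congr rfl fun s _ => by simp only [hBconj]
    rw [e1, e2, ← inner_conj_symm (v j), ← inner_conj_symm (conjVec (v j)), e1, e2]
    simp only [map_mul, Complex.conj_conj, map_inv₀, Complex.conj_ofReal]
    have h0 := hsq0 j
    rw [← hsq j]
    field_simp

end Williamson

/-! ### Trace norm estimates -/

section TraceNorm

variable {H : Type*} [NormedAddCommGroup H] [InnerProductSpace ℂ H] [CompleteSpace H]

theorem enorm_sq_eq_ofReal {F : Type*} [NormedAddCommGroup F] (x : F) :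
    ‖x‖ₑ ^ 2 = ENNReal.ofReal (‖x‖ ^ 2) := by
  rw [ENNReal.ofReal_pow (norm_nonneg _), ofReal_norm]

theorem hasSum_of_tsum_ofReal {ι : Type*} {f : ι → ℝ} (hf : ∀ i, 0 ≤ f i) {s : ℝ} (hs : 0 ≤ s)
    (h : ∑' i, ENNReal.ofReal (f i) = ENNReal.ofReal s) : HasSum f s := by
  have h1 : Summable f := by
    have := ENNReal.summable_toReal (f := fun i => ENNReal.ofReal (f i))
      (by rw [h]; exact ENNReal.ofReal_ne_top)
    simpa [ENNReal.toReal_ofReal, hf] using this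
  have h2 := ENNReal.ofReal_tsum_of_nonneg hf h1
  rw [h, ENNReal.ofReal_eq_ofReal_iff (tsum_nonneg hf) hs] at h2
  rw [← h2]
  exact h1.hasSum

theorem hasSum_norm_inner_sq {ι : Type*} (b : HilbertBasis ι ℂ H) (x : H) :
    HasSum (fun i => ‖⟪b i, x⟫_ℂ‖ ^ 2) (‖x‖ ^ 2) := by
  refine hasSum_of_tsum_ofReal (fun i => by positivity) (by positivity) ?_
  have := tsum_enorm_inner_sq b x
  simpa only [enorm_sq_eq_ofReal] using this

/-- Parseval and an exchange of sums: an operator and its adjoint have the same Hilbert–Schmidt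
norm. -/
theorem tsum_enorm_sq_adjoint (T S : H →L[ℂ] H) (hTS : ∀ x y, ⟪S x, y⟫_ℂ = ⟪x, T y⟫_ℂ) :
    ∑' j, ‖T (onb H j)‖ₑ ^ 2 = ∑' i, ‖S (onb H i)‖ₑ ^ 2 := by
  simp_rw [← tsum_enorm_inner_sq (onb H) (T _), ← tsum_enorm_inner_sq (onb H) (S _)]
  rw [ENNReal.tsum_comm]
  refine tsum_congr fun i => tsum_congr fun j => ?_
  rw [← hTS, ← inner_conj_symm, ← ofReal_norm, ← ofReal_norm, RCLike.norm_conj]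

theorem sqrt_symm (A : H →L[ℂ] H) (x y : H) : ⟪CFC.sqrt A x, y⟫_ℂ = ⟪x, CFC.sqrt A y⟫_ℂ := by
  have h : ContinuousLinearMap.adjoint (CFC.sqrt A) = CFC.sqrt A := by
    rw [← ContinuousLinearMap.star_eq_adjoint]
    exact (IsSelfAdjoint.of_nonneg (CFC.sqrt_nonneg A)).star_eq
  conv_lhs => rw [← h]
  exact ContinuousLinearMap.adjoint_inner_left _ _ _

theorem sqrt_sqrt {A : H →L[ℂ] H} (hA : A.IsPositive) (x : H) : CFC.sqrt A (CFC.sqrt A x) = A x :=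
  congrArg (fun T : H →L[ℂ] H => T x)
    (CFC.sqrt_mul_sqrt_self A ((ContinuousLinearMap.nonneg_iff_isPositive A).2 hA))

theorem re_inner_eq_norm_sqrt {A : H →L[ℂ] H} (hA : A.IsPositive) (x : H) :
    RCLike.re ⟪x, A x⟫_ℂ = ‖CFC.sqrt A x‖ ^ 2 := by
  rw [← sqrt_sqrt hA, ← sqrt_symm, inner_self_eq_norm_sq]

theorem posTrace_eq_tsum_sqrt {A : H →L[ℂ] H} (hA : A.IsPositive) :
    posTrace A = ∑' i, ‖CFC.sqrt A (onb H i)‖ₑ ^ 2 := by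
  refine tsum_congr fun i => ?_
  rw [re_inner_eq_norm_sqrt hA, enorm_sq_eq_ofReal]

/-- The operator norm of `√A` is at most its Hilbert–Schmidt norm, whose square is the trace of `A`.
-/
theorem enorm_sqrt_le {A : H →L[ℂ] H} (hA : A.IsPositive) (x : H) :
    ‖CFC.sqrt A x‖ₑ ^ 2 ≤ posTrace A * ‖x‖ₑ ^ 2 := by
  rw [posTrace_eq_tsum_sqrt hA, ← tsum_enorm_inner_sq (onb H), ← ENNReal.tsum_mul_right]
  refine ENNReal.tsum_le_tsum fun i => ?_
  rw [← sqrt_symm, ← mul_pow]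
  gcongr
  simpa [← ofReal_norm, ← ENNReal.ofReal_mul] using
    ENNReal.ofReal_le_ofReal (norm_inner_le_norm (𝕜 := ℂ) (CFC.sqrt A (onb H i)) x)

theorem abs_isPositive (A : H →L[ℂ] H) : (CFC.abs A).IsPositive :=
  (ContinuousLinearMap.nonneg_iff_isPositive _).1 (CFC.abs_nonneg A)

/-- The operator norm is at most the trace norm. -/
theorem enorm_apply_le_traceNorm (A : H →L[ℂ] H) (x : H) : ‖A x‖ₑ ≤ traceNorm A * ‖x‖ₑ := by
  have habs : ‖A x‖ = ‖CFC.abs A x‖ := by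
    have h1 : CFC.abs A * CFC.abs A = star A * A := CFC.abs_mul_abs A
    have h2 : star (CFC.abs A) = CFC.abs A := (IsSelfAdjoint.of_nonneg (CFC.abs_nonneg A)).star_eq
    have h3 : ‖A x‖ ^ 2 = ‖CFC.abs A x‖ ^ 2 := by
      rw [← @inner_self_eq_norm_sq ℂ, ← @inner_self_eq_norm_sq ℂ,
        ← ContinuousLinearMap.adjoint_inner_right, ← ContinuousLinearMap.adjoint_inner_right,
        ← ContinuousLinearMap.star_eq_adjoint, ← ContinuousLinearMap.star_eq_adjoint, h2]
      exact congrArg (fun T : H →L[ℂ] H => RCLike.re ⟪x, T x⟫_ℂ) h1.symm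
    exact (sq_eq_sq₀ (norm_nonneg _) (norm_nonneg _)).1 h3
  have hp := abs_isPositive A
  have h1 := enorm_sqrt_le hp (CFC.sqrt (CFC.abs A) x)
  rw [sqrt_sqrt hp] at h1
  have h2 := enorm_sqrt_le hp x
  have h3 : ‖CFC.abs A x‖ₑ ^ 2 ≤ (traceNorm A * ‖x‖ₑ) ^ 2 := by
    refine h1.trans ?_
    rw [mul_pow, sq (traceNorm A), mul_assoc]
    exact mul_le_mul_right h2 _
  have h4 := (ENNReal.pow_le_pow_left_iff two_ne_zero).1 h3
  rwa [← ofReal_norm, habs, ofReal_norm]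

/-- For a unit vector `ψ`, a vector `f` and a symmetric contraction `X`. -/
theorem re_inner_sub_le {X : H →L[ℂ] H} (hX : ∀ x y, ⟪X x, y⟫_ℂ = ⟪x, X y⟫_ℂ) (hX1 : ∀ x, ‖X x‖ ≤ ‖x‖)
    {ψ : H} (hψ : ‖ψ‖ = 1) (f : H) :
    RCLike.re ⟪f, X f⟫_ℂ - ‖f‖ ^ 2 * RCLike.re ⟪ψ, X ψ⟫_ℂ ≤
      2 * (‖f‖ * √(‖f‖ ^ 2 - ‖⟪ψ, f⟫_ℂ‖ ^ 2)) := by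
  obtain ⟨θ, hθ, hθf⟩ : ∃ θ : ℂ, ‖θ‖ = 1 ∧ RCLike.re ⟪θ • ψ, f⟫_ℂ = ‖⟪ψ, f⟫_ℂ‖ := by
    by_cases h0 : ⟪ψ, f⟫_ℂ = 0
    · exact ⟨1, by simp, by simp [h0]⟩
    · have hn : ‖⟪ψ, f⟫_ℂ‖ ≠ 0 := norm_ne_zero_iff.2 h0
      refine ⟨⟪ψ, f⟫_ℂ / (‖⟪ψ, f⟫_ℂ‖ : ℂ), by simp [hn], ?_⟩
      rw [inner_smul_left, map_div₀, Complex.conj_ofReal, div_mul_eq_mul_div, Complex.conj_mul']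
      rw [sq, mul_div_assoc, div_self (by exact_mod_cast hn), mul_one]
      simp
  -- `χ` is `ψ` rescaled to the length of `f` and rotated so that `⟨χ, f⟩ ≥ 0`. Then `⟨f, X f⟩ - ⟨χ,
  -- X χ⟩ = Re ⟨f - χ, X (f + χ)⟩`, and for equal lengths `‖f - χ‖ ‖f + χ‖` is exactly the
  -- right-hand side.
  set χ : H := ((‖f‖ : ℝ) : ℂ) • θ • ψ with hχ
  have hχX : RCLike.re ⟪χ, X χ⟫_ℂ = ‖f‖ ^ 2 * RCLike.re ⟪ψ, X ψ⟫_ℂ := by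
    have hθθ : (starRingEnd ℂ) θ * θ = 1 := by
      rw [Complex.conj_mul', hθ]; simp
    have : ⟪χ, X χ⟫_ℂ = ((‖f‖ ^ 2 : ℝ) : ℂ) * ⟪ψ, X ψ⟫_ℂ := by
      simp only [hχ, map_smul, inner_smul_left, inner_smul_right, Complex.conj_ofReal]
      push_cast
      linear_combination ((‖f‖ : ℂ) ^ 2 * ⟪ψ, X ψ⟫_ℂ) * hθθ
    rw [this, RCLike.re_eq_complex_re, Complex.re_ofReal_mul]
  have hsplit : RCLike.re ⟪f - χ, X (f + χ)⟫_ℂ = RCLike.re ⟪f, X f⟫_ℂ - RCLike.re ⟪χ, X χ⟫_ℂ := by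
    have h1 : RCLike.re ⟪χ, X f⟫_ℂ = RCLike.re ⟪f, X χ⟫_ℂ := by
      rw [← hX, ← inner_conj_symm, RCLike.conj_re]
    rw [map_add, inner_sub_left, inner_add_right, inner_add_right]
    simp only [map_sub, map_add]
    linarith
  rw [← hχX, ← hsplit]
  have hle : RCLike.re ⟪f - χ, X (f + χ)⟫_ℂ ≤ ‖f - χ‖ * ‖f + χ‖ :=
    (RCLike.re_le_norm _).trans ((norm_inner_le_norm _ _).trans (by gcongr; exact hX1 _))
  refine hle.trans (le_of_eq ?_)
  have hχn : ‖χ‖ = ‖f‖ := by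
    rw [hχ, norm_smul, norm_smul, hθ, hψ, Complex.norm_real, norm_norm]
    ring
  have hχf : RCLike.re ⟪f, χ⟫_ℂ = ‖f‖ * ‖⟪ψ, f⟫_ℂ‖ := by
    rw [← inner_conj_symm, RCLike.conj_re, hχ, inner_smul_left, Complex.conj_ofReal,
      RCLike.re_eq_complex_re, Complex.re_ofReal_mul, ← hθf]
    rfl
  have hsq : (‖f - χ‖ * ‖f + χ‖) ^ 2 = (2 * (‖f‖ * √(‖f‖ ^ 2 - ‖⟪ψ, f⟫_ℂ‖ ^ 2))) ^ 2 := by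
    have h0 : 0 ≤ ‖f‖ ^ 2 - ‖⟪ψ, f⟫_ℂ‖ ^ 2 := by
      have := norm_inner_le_norm (𝕜 := ℂ) ψ f
      rw [hψ, one_mul] at this
      have h1 := norm_nonneg ⟪ψ, f⟫_ℂ
      nlinarith
    rw [mul_pow, mul_pow, mul_pow, Real.sq_sqrt h0, @norm_sub_sq ℂ, @norm_add_sq ℂ, hχn, hχf]
    ring
  exact (sq_eq_sq₀ (by positivity) (by positivity)).1 hsq

theorem IsState.hasSum_norm_sqrt {ρ : H →L[ℂ] H} (hρ : IsState ρ) :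
    HasSum (fun i => ‖CFC.sqrt ρ (onb H i)‖ ^ 2) 1 := by
  refine hasSum_of_tsum_ofReal (fun i => by positivity) zero_le_one ?_
  rw [ENNReal.ofReal_one, ← hρ.trace_eq_one, posTrace_eq_tsum_sqrt hρ.isPositive]
  exact tsum_congr fun i => (enorm_sq_eq_ofReal _).symm

theorem hasSum_inner_sqrt {ρ : H →L[ℂ] H} (hρ : ρ.IsPositive) (ψ : H) :
    HasSum (fun i => ‖⟪ψ, CFC.sqrt ρ (onb H i)⟫_ℂ‖ ^ 2) (RCLike.re ⟪ψ, ρ ψ⟫_ℂ) := by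
  rw [re_inner_eq_norm_sqrt hρ]
  convert hasSum_norm_inner_sq (onb H) (CFC.sqrt ρ ψ) using 2 with i
  rw [← sqrt_symm, norm_inner_symm]

theorem norm_starProjection_sub_le (K : Submodule ℂ H) [K.HasOrthogonalProjection] (x : H) :
    ‖K.starProjection x - (x - K.starProjection x)‖ ≤ ‖x‖ := by
  have h1 : ⟪K.starProjection x, x - K.starProjection x⟫_ℂ = 0 :=
    K.inner_right_of_mem_orthogonal (K.starProjection_apply_mem x)
      (K.sub_starProjection_mem_orthogonal x)
  have h2 : ‖K.starProjection x - (x - K.starProjection x)‖ ^ 2 = ‖x‖ ^ 2 := by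
    have h3 : ‖x‖ ^ 2 = ‖K.starProjection x + (x - K.starProjection x)‖ ^ 2 := by
      rw [add_sub_cancel]
    rw [h3, @norm_sub_sq ℂ, @norm_add_sq ℂ, h1]
    simp
  exact ((sq_eq_sq₀ (norm_nonneg _) (norm_nonneg _)).1 h2).le

/-- A self-adjoint operator is turned into its absolute value by a symmetry `2 P - 1`, where `P` is an
orthogonal projection commuting with it. -/
theorem exists_projection_abs {A : H →L[ℂ] H} (hA : IsSelfAdjoint A) :
    ∃ P : H →L[ℂ] H, (∀ x y, ⟪P x, y⟫_ℂ = ⟪x, P y⟫_ℂ) ∧ (∀ x, P (P x) = P x) ∧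
      (∀ x, ‖P x - (x - P x)‖ ≤ ‖x‖) ∧
      ∀ x, ⟪x, CFC.abs A x⟫_ℂ = ⟪P x, A (P x)⟫_ℂ - ⟪x - P x, A (x - P x)⟫_ℂ := by
  -- The projection onto the closed range of `A⁺` fixes `A⁺` and kills `A⁻`, because `A⁺ A⁻ = 0`.
  set K := (LinearMap.range (A⁺).toLinearMap).topologicalClosure with hK
  have hsub : A⁺ - A⁻ = A := CFC.posPart_sub_negPart A hA
  have hadd : A⁺ + A⁻ = CFC.abs A := CFC.posPart_add_negPart A hA
  have hpsym : ∀ x y, ⟪A⁺ x, y⟫_ℂ = ⟪x, A⁺ y⟫_ℂ :=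
    ((ContinuousLinearMap.nonneg_iff_isPositive _).1 (CFC.posPart_nonneg A)).isSymmetric
  have hnsym : ∀ x y, ⟪A⁻ x, y⟫_ℂ = ⟪x, A⁻ y⟫_ℂ :=
    ((ContinuousLinearMap.nonneg_iff_isPositive _).1 (CFC.negPart_nonneg A)).isSymmetric
  have hPp : ∀ x, K.starProjection (A⁺ x) = A⁺ x := fun x =>
    K.starProjection_eq_self_iff.2 (Submodule.le_topologicalClosure _ ⟨x, rfl⟩)
  have hpn : ∀ x, A⁺ (A⁻ x) = 0 := fun x =>
    congrArg (fun T : H →L[ℂ] H => T x) (CFC.posPart_mul_negPart A)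
  have hPn : ∀ x, K.starProjection (A⁻ x) = 0 := by
    intro x
    rw [K.starProjection_apply_eq_zero_iff, hK, Submodule.orthogonal_closure,
      Submodule.mem_orthogonal]
    rintro _ ⟨y, rfl⟩
    change ⟪A⁺ y, A⁻ x⟫_ℂ = 0
    rw [hpsym, hpn, inner_zero_right]
  have hPsym : ∀ x y, ⟪K.starProjection x, y⟫_ℂ = ⟪x, K.starProjection y⟫_ℂ :=
    fun x y => K.inner_starProjection_left_eq_right x y
  refine ⟨K.starProjection, hPsym, fun x => K.starProjection_eq_self_iff.2
    (K.starProjection_apply_mem x), norm_starProjection_sub_le K, fun x => ?_⟩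
  have hApply : ∀ y, A y = A⁺ y - A⁻ y := fun y =>
    congrArg (fun T : H →L[ℂ] H => T y) hsub.symm
  have habs : CFC.abs A x = A⁺ x + A⁻ x := congrArg (fun T : H →L[ℂ] H => T x) hadd.symm
  have hpP : ∀ y, A⁺ (K.starProjection y) = A⁺ y := by
    intro y
    refine ext_inner_left ℂ fun z => ?_
    rw [← hpsym, ← hPsym, hPp, hpsym]
  have hnP : ∀ y, A⁻ (K.starProjection y) = 0 := by
    intro y
    refine ext_inner_left ℂ fun z => ?_
    rw [← hnsym, ← hPsym, hPn, inner_zero_left, inner_zero_right]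
  rw [habs, hApply, hApply, map_sub, map_sub, hpP, hnP, sub_zero, sub_self, zero_sub, sub_zero,
    hPsym, hPp, inner_neg_right, sub_neg_eq_add, inner_sub_left, hPsym, hPn, inner_zero_right,
    sub_zero, inner_add_right]

/-- The Fuchs–van de Graaf inequality for a pure state. -/
theorem traceNorm_sub_rankOne_le {ρ : H →L[ℂ] H} (hρ : IsState ρ) {ψ : H} (hψ : ‖ψ‖ = 1) :
    traceNorm (ρ - InnerProductSpace.rankOne ℂ ψ ψ) ≤
      ENNReal.ofReal (2 * √(1 - RCLike.re ⟪ψ, ρ ψ⟫_ℂ)) := by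
  set A := ρ - InnerProductSpace.rankOne ℂ ψ ψ with hAdef
  have hA : IsSelfAdjoint A := hρ.isPositive.isSelfAdjoint.sub
    (InnerProductSpace.isPositive_rankOne_self ψ).isSelfAdjoint
  obtain ⟨P, hPsym, hPP, hP1, hPabs⟩ := exists_projection_abs hA
  set B := CFC.sqrt ρ with hB
  set f : onbIndex H → H := fun i => B (onb H i) with hf
  set D := 1 - RCLike.re ⟪ψ, ρ ψ⟫_ℂ with hD
  have hQsym : ∀ x y, ⟪(1 - P) x, y⟫_ℂ = ⟪x, (1 - P) y⟫_ℂ := by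
    intro x y
    change ⟪x - P x, y⟫_ℂ = ⟪x, y - P y⟫_ℂ
    rw [inner_sub_left, inner_sub_right, hPsym]
  have hf1 : HasSum (fun i => ‖f i‖ ^ 2) 1 := hρ.hasSum_norm_sqrt
  have hfψ : HasSum (fun i => ‖⟪ψ, f i⟫_ℂ‖ ^ 2) (RCLike.re ⟪ψ, ρ ψ⟫_ℂ) :=
    hasSum_inner_sqrt hρ.isPositive ψ
  -- Equality of the Hilbert–Schmidt norms of `√ρ T` and `T √ρ` trades basis vectors for the
  -- ensemble vectors `f i = √ρ eᵢ`.
  have hHS : ∀ T : H →L[ℂ] H, (∀ x y, ⟪T x, y⟫_ℂ = ⟪x, T y⟫_ℂ) →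
      HasSum (fun j => ‖B (T (onb H j))‖ ^ 2) (∑' i, ‖T (f i)‖ ^ 2) ∧
        Summable fun i => ‖T (f i)‖ ^ 2 := by
    intro T hT
    have hs : Summable fun i => ‖T (f i)‖ ^ 2 := by
      refine Summable.of_nonneg_of_le (fun i => by positivity) (fun i => ?_)
        (hf1.summable.mul_left (‖T‖ ^ 2))
      rw [← mul_pow]
      gcongr
      exact T.le_opNorm _
    refine ⟨hasSum_of_tsum_ofReal (fun j => by positivity) (tsum_nonneg fun i => by positivity) ?_, hs⟩
    rw [ENNReal.ofReal_tsum_of_nonneg (fun i => by positivity) hs]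
    have := tsum_enorm_sq_adjoint (B ∘L T) (T ∘L B) (fun x y => by
      rw [ContinuousLinearMap.comp_apply, ContinuousLinearMap.comp_apply, hT, hB, sqrt_symm])
    simp only [enorm_sq_eq_ofReal] at this
    exact this
  obtain ⟨hP2, hPs⟩ := hHS P hPsym
  obtain ⟨hQ2, hQs⟩ := hHS (1 - P) hQsym
  have hPψ := hasSum_norm_inner_sq (onb H) (P ψ)
  have hQψ := hasSum_norm_inner_sq (onb H) ((1 - P) ψ)
  have hterm : ∀ j, RCLike.re ⟪onb H j, CFC.abs A (onb H j)⟫_ℂ =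
      (‖B (P (onb H j))‖ ^ 2 - ‖⟪onb H j, P ψ⟫_ℂ‖ ^ 2) -
        (‖B ((1 - P) (onb H j))‖ ^ 2 - ‖⟪onb H j, (1 - P) ψ⟫_ℂ‖ ^ 2) := by
    intro j
    have hAx : ∀ x, RCLike.re ⟪x, A x⟫_ℂ = ‖B x‖ ^ 2 - ‖⟪x, ψ⟫_ℂ‖ ^ 2 := by
      intro x
      rw [hAdef, sub_apply, inner_sub_right, map_sub,
        re_inner_eq_norm_sqrt hρ.isPositive, InnerProductSpace.rankOne_apply, inner_smul_right,
        ← inner_conj_symm, Complex.conj_mul']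
      congr 1
      rw [← Complex.ofReal_pow]
      rfl
    rw [hPabs, map_sub, hAx, hAx]
    have h1 : onb H j - P (onb H j) = (1 - P) (onb H j) := rfl
    rw [h1, hPsym, hQsym]
  have hsum : HasSum (fun j => RCLike.re ⟪onb H j, CFC.abs A (onb H j)⟫_ℂ)
      ((∑' i, ‖P (f i)‖ ^ 2 - ‖P ψ‖ ^ 2) - (∑' i, ‖(1 - P) (f i)‖ ^ 2 - ‖(1 - P) ψ‖ ^ 2)) := by
    simp only [hterm]
    exact (hP2.sub hPψ).sub (hQ2.sub hQψ)
  set S := (∑' i, ‖P (f i)‖ ^ 2 - ‖P ψ‖ ^ 2) - (∑' i, ‖(1 - P) (f i)‖ ^ 2 - ‖(1 - P) ψ‖ ^ 2)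
  have htr : traceNorm A = ENNReal.ofReal S := by
    have hpos : ∀ j, 0 ≤ RCLike.re ⟪onb H j, CFC.abs A (onb H j)⟫_ℂ := fun j => by
      rw [re_inner_eq_norm_sqrt (abs_isPositive A)]
      positivity
    rw [traceNorm, posTrace, ← ENNReal.ofReal_tsum_of_nonneg hpos hsum.summable, hsum.tsum_eq]
  set X : H →L[ℂ] H := P - (1 - P) with hX
  have hXsym : ∀ x y, ⟪X x, y⟫_ℂ = ⟪x, X y⟫_ℂ := fun x y => by
    change ⟪P x - (1 - P) x, y⟫_ℂ = ⟪x, P y - (1 - P) y⟫_ℂ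
    rw [inner_sub_left, inner_sub_right, hPsym, hQsym]
  have hXre : ∀ x, RCLike.re ⟪x, X x⟫_ℂ = ‖P x‖ ^ 2 - ‖(1 - P) x‖ ^ 2 := by
    intro x
    have hQQ : (1 - P) ((1 - P) x) = (1 - P) x := by
      change x - P x - P (x - P x) = x - P x
      rw [map_sub, hPP]
      abel
    change RCLike.re ⟪x, P x - (1 - P) x⟫_ℂ = _
    rw [inner_sub_right, map_sub]
    nth_rewrite 1 [← hPP x]
    nth_rewrite 1 [← hQQ]
    rw [← hPsym, ← hQsym, inner_self_eq_norm_sq, inner_self_eq_norm_sq]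
  -- The trace norm is `Tr[X (ρ - ψ)]` with `X = 2 P - 1`. As `∑ ‖f i‖² = 1`, the term `⟨ψ, X ψ⟩`
  -- can be spread over the ensemble and `re_inner_sub_le` applied to each member.
  have hSsum : HasSum (fun i => RCLike.re ⟪f i, X (f i)⟫_ℂ - ‖f i‖ ^ 2 * RCLike.re ⟪ψ, X ψ⟫_ℂ) S := by
    have h1 := (hPs.hasSum.sub hQs.hasSum).sub (hf1.mul_right (RCLike.re ⟪ψ, X ψ⟫_ℂ))
    have h2 : S = (∑' i, ‖P (f i)‖ ^ 2 - ∑' i, ‖(1 - P) (f i)‖ ^ 2) - 1 * RCLike.re ⟪ψ, X ψ⟫_ℂ := by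
      rw [hXre]
      ring
    rw [h2]
    simpa only [hXre] using h1
  have hfi0 : ∀ i, 0 ≤ ‖f i‖ ^ 2 - ‖⟪ψ, f i⟫_ℂ‖ ^ 2 := by
    intro i
    have := norm_inner_le_norm (𝕜 := ℂ) ψ (f i)
    rw [hψ, one_mul] at this
    have h1 := norm_nonneg ⟪ψ, f i⟫_ℂ
    nlinarith
  have hDsum : HasSum (fun i => ‖f i‖ ^ 2 - ‖⟪ψ, f i⟫_ℂ‖ ^ 2) D := hf1.sub hfψ
  have hD0 : 0 ≤ D := hDsum.nonneg hfi0
  -- Cauchy–Schwarz for the series in the form `2 a b ≤ t a² + b² / t`. The optimal `t` is `√D`; if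
  -- `D = 0`, `t` tends to zero.
  have hSt : ∀ t : ℝ, 0 < t → S ≤ t + D / t := by
    intro t ht
    have h1 := (hf1.mul_left t).add (hDsum.div_const t)
    rw [mul_one] at h1
    refine hasSum_le (fun i => ?_) hSsum h1
    refine (re_inner_sub_le hXsym hP1 hψ (f i)).trans ?_
    have h2 := Real.sq_sqrt (hfi0 i)
    set s := √(‖f i‖ ^ 2 - ‖⟪ψ, f i⟫_ℂ‖ ^ 2)
    rw [← h2]
    have h3 : t * ‖f i‖ ^ 2 + s ^ 2 / t - 2 * (‖f i‖ * s) = (t * ‖f i‖ - s) ^ 2 / t := by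
      field_simp
      ring
    have h4 : 0 ≤ (t * ‖f i‖ - s) ^ 2 / t := by positivity
    linarith
  rw [htr]
  refine ENNReal.ofReal_le_ofReal ?_
  rcases hD0.eq_or_lt with h0 | h0
  · rw [← h0, Real.sqrt_zero, mul_zero]
    refine le_of_forall_pos_le_add fun t ht => ?_
    have := hSt t ht
    rwa [← h0, zero_div, add_zero, ← zero_add t] at this
  · have := hSt (√D) (Real.sqrt_pos.2 h0)
    rwa [Real.div_sqrt, ← two_mul] at this

end TraceNorm

/-! ### Pure Gaussian states are vacua -/

section GibbsAbstract

variable {H : Type*} [NormedAddCommGroup H] [InnerProductSpace ℂ H]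

/-- If a density operator is close to a pure state, then so is its leading eigenvector. -/
theorem one_sub_le_norm_inner_sq {κ : Type*} (e : HilbertBasis κ ℂ H) {p : κ → ℝ}
    (hp : ∀ i, 0 ≤ p i) (hp1 : HasSum p 1) {i₀ : κ} (hmax : ∀ i, p i ≤ p i₀) {σ : H →L[ℂ] H}
    (hσ : ∀ i, σ (e i) = (p i : ℂ) • e i) {ψ : H} (hψ : ‖ψ‖ = 1) {ε : ℝ} (hε : 0 ≤ ε)
    (hclose : ‖ψ - σ ψ‖ ≤ ε) : 1 - 2 * ε ≤ ‖⟪e i₀, ψ⟫_ℂ‖ ^ 2 := by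
  set c : κ → ℝ := fun i => ‖⟪e i, ψ⟫_ℂ‖ ^ 2 with hc
  have hc0 : ∀ i, 0 ≤ c i := fun i => by positivity
  have hc1 : HasSum c 1 := by
    have h := (e.hasSum_inner_mul_inner ψ ψ).mapL Complex.reCLM
    rw [inner_self_eq_norm_sq_to_K, hψ] at h
    convert h using 1
    · funext i
      rw [← inner_conj_symm ψ (e i), Complex.conj_mul', Complex.reCLM_apply, ← Complex.ofReal_pow,
        Complex.ofReal_re]
    · simp
  have hpc : HasSum (fun i => p i * c i) (RCLike.re ⟪ψ, σ ψ⟫_ℂ) := by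
    have h := (((e.hasSum_repr ψ).mapL σ).mapL (innerSL ℂ ψ)).mapL Complex.reCLM
    refine (funext fun i => ?_ : (fun i => p i * c i) = _) ▸ h
    rw [map_smul, hσ, innerSL_apply_apply, e.repr_apply_apply, inner_smul_right,
      inner_smul_right, ← inner_conj_symm ψ (e i), Complex.reCLM_apply, mul_left_comm,
      Complex.mul_conj', ← Complex.ofReal_pow, ← Complex.ofReal_mul, Complex.ofReal_re]
  have hlow : 1 - ε ≤ RCLike.re ⟪ψ, σ ψ⟫_ℂ := by
    have h1 : RCLike.re ⟪ψ, ψ - σ ψ⟫_ℂ ≤ ε := by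
      refine (RCLike.re_le_norm _).trans ((norm_inner_le_norm _ _).trans ?_)
      rwa [hψ, one_mul]
    rw [inner_sub_right, map_sub, inner_self_eq_norm_sq, hψ] at h1
    linarith
  have hp0 : 1 - ε ≤ p i₀ := by
    refine hlow.trans ?_
    have := hasSum_le (fun i => mul_le_mul_of_nonneg_right (hmax i) (hc0 i)) hpc (hc1.mul_left (p i₀))
    rwa [mul_one] at this
  have hple : p i₀ ≤ 1 := le_hasSum hp1 i₀ fun i _ => hp i
  -- The leading weight is at least `1 - ε` and the weights sum to one, so each other weight is at
  -- most `ε`. Thus `⟨ψ, σ ψ⟩ ≤ ε + c i₀`.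
  have hother : ∀ i, i ≠ i₀ → p i ≤ ε := by
    classical
    intro i hi
    have := sum_le_hasSum {i₀, i} (fun i _ => hp i) hp1
    rw [Finset.sum_pair hi.symm] at this
    linarith
  have hle : RCLike.re ⟪ψ, σ ψ⟫_ℂ ≤ ε * 1 + c i₀ := by
    classical
    refine hasSum_le (fun i => ?_) hpc ((hc1.mul_left ε).add (hasSum_ite_eq i₀ (c i₀)))
    by_cases hi : i = i₀
    · rw [if_pos hi, hi]
      nlinarith [hc0 i₀, mul_nonneg hε (hc0 i₀)]
    · rw [if_neg hi, add_zero]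
      exact mul_le_mul_of_nonneg_right (hother i hi) (hc0 i)
  linarith

end GibbsAbstract

/-! ### From limits of Gibbs states to vacua -/

section PureGaussian

variable {n : ℕ}

/-- In normal modes the Hamiltonian is `½ ∑ ν (a† a + a a†)`; normal ordering leaves the zero-point
energy `½ ∑ ν`. -/
theorem quadHamCore_eq {C : Fin n → QIdx n → ℂ} {m : QIdx n → ℝ} {g : Sch n}
    (hF : FockModes (incl n) (ann C m) (cre C m) g) {h : Matrix (QIdx n) (QIdx n) ℝ} {ν : Fin n → ℝ}
    (hh : ∀ k l, (h k l : ℂ) =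
      ∑ j, (ν j : ℂ) * ((starRingEnd ℂ) (C j k) * C j l + C j k * (starRingEnd ℂ) (C j l)))
    (φ : Sch n) :
    quadHamCore h m φ =
      weightedNumber (ann C m) (cre C m) ν φ + ((((∑ j, ν j) / 2 : ℝ)) : ℂ) • φ := by
  have h1 : ∑ k, ∑ l, (h k l : ℂ) • ((quadCore k - (m k : ℂ) • LinearMap.id : Sch n →ₗ[ℂ] Sch n)
      ((quadCore l - (m l : ℂ) • LinearMap.id : Sch n →ₗ[ℂ] Sch n) φ)) =
      ∑ j, (ν j : ℂ) • (cre C m j (ann C m j φ) + ann C m j (cre C m j φ)) := by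
    simp only [sum_ann_cre_eq, Finset.smul_sum, smul_smul]
    rw [Finset.sum_comm]
    rw [Finset.sum_congr rfl fun l _ => Finset.sum_congr rfl fun k _ => by rw [hh k l, Finset.sum_smul]]
    rw [Finset.sum_comm, Finset.sum_congr rfl fun k _ => Finset.sum_comm, Finset.sum_comm]
  have h2 : quadHamCore h m φ = (1 / 2 : ℂ) • ∑ k, ∑ l, (h k l : ℂ) •
      ((quadCore k - (m k : ℂ) • LinearMap.id : Sch n →ₗ[ℂ] Sch n)
      ((quadCore l - (m l : ℂ) • LinearMap.id : Sch n →ₗ[ℂ] Sch n) φ)) := by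
    simp only [quadHamCore, LinearMap.smul_apply, LinearMap.sum_apply, LinearMap.comp_apply]
  rw [h2, h1, weightedNumber_apply, Finset.smul_sum]
  push_cast
  rw [Finset.sum_div, Finset.sum_smul, ← Finset.sum_add_distrib]
  refine Finset.sum_congr rfl fun j _ => ?_
  rw [hF.comm, if_pos rfl]
  module

/-- A pure state close to a Gibbs state of a quadratic Hamiltonian is close to the vacuum of the
normal modes. -/
theorem exists_vacuum_near_of_gibbs {h : Matrix (QIdx n) (QIdx n) ℝ} (hh : h.PosDef)
    {m : QIdx n → ℝ} {β : ℝ} (hβ : 0 < β) {σ : Op n} (hσ : IsGibbsState β (quadHam h m) σ)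
    {ψ : Hilb n} (hψ : ‖ψ‖ = 1) {ε : ℝ} (hε : 0 ≤ ε)
    (hclose : traceNorm (InnerProductSpace.rankOne ℂ ψ ψ - σ) ≤ ENNReal.ofReal ε) :
    ∃ (C : Fin n → QIdx n → ℂ) (g : Sch n), IsCCR C ∧ FockModes (incl n) (ann C m) (cre C m) g ∧
      1 - 2 * ε ≤ ‖⟪incl n g, ψ⟫_ℂ‖ ^ 2 := by
  obtain ⟨C, ν, hC, hν, hhC⟩ := exists_normalModes hh
  obtain ⟨g, hF, hd⟩ := hC.exists_fockModes m
  refine ⟨C, g, hC, hF, ?_⟩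
  obtain ⟨κ, e, l, he, hsum, hσe⟩ := hσ
  have hweak : ∀ i φ, ⟪(l i : ℂ) • e i, incl n φ⟫_ℂ = ⟪e i, incl n
      (weightedNumber (ann C m) (cre C m) ν φ + ((((∑ j, ν j) / 2 : ℝ)) : ℂ) • φ)⟫_ℂ := by
    intro i φ
    rw [← quadHamCore_eq hF hhC]
    exact (toOperator_apply_iff _ _ _).1 (he i) φ
  obtain ⟨i₀, hi₀, hmin⟩ := hF.exists_eq_smul_vacuum hd e l ν hν _ hweak
  set Z := ∑' j, Real.exp (-β * l j) with hZ
  have hZpos : 0 < Z := hsum.tsum_pos (fun i => (Real.exp_pos _).le) i₀ (Real.exp_pos _)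
  have hclose' : ‖ψ - σ ψ‖ ≤ ε := by
    have h1 := enorm_apply_le_traceNorm (InnerProductSpace.rankOne ℂ ψ ψ - σ) ψ
    have h2 : (InnerProductSpace.rankOne ℂ ψ ψ - σ) ψ = ψ - σ ψ := by
      rw [sub_apply, InnerProductSpace.rankOne_apply, inner_self_eq_norm_sq_to_K, hψ]
      simp
    have h3 : ‖ψ‖ₑ = 1 := by rw [← ofReal_norm, hψ, ENNReal.ofReal_one]
    rw [h2, h3, mul_one, ← ofReal_norm] at h1
    exact (ENNReal.ofReal_le_ofReal_iff hε).1 (h1.trans hclose)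
  -- The vacuum has the lowest eigenvalue, hence the largest Gibbs weight, because `β > 0`.
  have hmain := one_sub_le_norm_inner_sq e (p := fun i => Real.exp (-β * l i) / Z) (i₀ := i₀)
    (fun i => by positivity) (by have := hsum.hasSum.div_const Z; rwa [div_self hZpos.ne'] at this)
    (fun i => by
      have := hmin i
      gcongr ?_ / Z
      exact Real.exp_le_exp.2 (by nlinarith))
    hσe hψ hε hclose'
  have hz : ‖⟪incl n g, e i₀⟫_ℂ‖ = 1 := by
    have := congrArg norm hi₀
    rw [norm_smul, hF.norm_vacuum, mul_one, e.orthonormal.1] at this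
    exact this.symm
  rwa [hi₀, inner_smul_left, norm_mul, RCLike.norm_conj, hz, one_mul] at hmain

/-- Vacua close to a given vector have bounded parameters. -/
theorem IsCCR.parameter_bound {C : Fin n → QIdx n → ℂ} (hC : IsCCR C) {m : QIdx n → ℝ} {g : Sch n}
    (hF : FockModes (incl n) (ann C m) (cre C m) g) {φ : Sch n} {θ : ℂ} (hθ : ‖θ‖ = 1)
    (hφ : ‖incl n φ - θ • incl n g‖ ≤ 1 / 10) (k : QIdx n) :
    m k ^ 2 + ∑ j, ‖creCoeff C k j‖ ^ 2 ≤ 2 * ‖incl n (quadCore k (quadCore k φ))‖ := by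
  set S := ∑ j, ‖creCoeff C k j‖ ^ 2 with hS
  have hS0 : 0 ≤ S := by positivity
  let a : Sch n →ₗ[ℂ] Sch n := ∑ j, (starRingEnd ℂ) (creCoeff C k j) • ann C m j
  let c : Sch n →ₗ[ℂ] Sch n := ∑ j, creCoeff C k j • cre C m j
  have ha : ∀ u, a u = ∑ j, (starRingEnd ℂ) (creCoeff C k j) • ann C m j u := fun u => by
    simp only [a, LinearMap.sum_apply, LinearMap.smul_apply]
  have hc : ∀ u, c u = ∑ j, creCoeff C k j • cre C m j u := fun u => by
    simp only [c, LinearMap.sum_apply, LinearMap.smul_apply]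
  -- The modes entering `R̂ₖ` combine into a single one with `[a, c] = S`, so `s = √S`.
  have := moment_bound (J := incl n) (a := a) (c := c) (g := g) (s := √S) (m := m k)
    (Real.sqrt_nonneg _)
    (fun u v => by
      rw [ha, hc, map_sum, map_sum, sum_inner, inner_sum]
      refine Finset.sum_congr rfl fun j _ => ?_
      rw [map_smul, map_smul, inner_smul_left, inner_smul_right, hF.adj, Complex.conj_conj])
    (fun u => by
      rw [Real.sq_sqrt hS0, hS]
      simp only [ha, hc, map_sum, map_smul, hF.comm, smul_add, Finset.sum_add_distrib,
        Finset.smul_sum]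
      congr 1
      · rw [Finset.sum_comm]
        exact Finset.sum_congr rfl fun i _ => Finset.sum_congr rfl fun j _ => by rw [smul_comm]
      · push_cast
        rw [Finset.sum_smul]
        refine Finset.sum_congr rfl fun j _ => ?_
        rw [Finset.sum_eq_single j]
        · rw [if_pos rfl, smul_smul, Complex.conj_mul']
        · intro i _ hi
          rw [if_neg (Ne.symm hi), smul_zero, smul_zero]
        · exact fun hn => absurd (Finset.mem_univ j) hn)
    (by simp only [ha, hF.vacuum, smul_zero, Finset.sum_const_zero]) hF.norm_vacuum
    (R := quadCore k) (fun u => by rw [ha, hc, hC.quadCore_eq m k u]) hθ hφ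
  rwa [Real.sq_sqrt hS0] at this

/-- With the phase aligned to the overlap `x ≤ 1`, the squared distance is `2 - 2x ≤ 2 - 2x² ≤ 4ε`.
-/
theorem exists_phase {H : Type*} [NormedAddCommGroup H] [InnerProductSpace ℂ H] {g ψ : H}
    (hg : ‖g‖ = 1) (hψ : ‖ψ‖ = 1) {ε : ℝ} (h : 1 - 2 * ε ≤ ‖⟪g, ψ⟫_ℂ‖ ^ 2) :
    ∃ θ : ℂ, ‖θ‖ = 1 ∧ ‖ψ - θ • g‖ ^ 2 ≤ 4 * ε := by
  have hle : ‖⟪g, ψ⟫_ℂ‖ ≤ 1 := by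
    have := norm_inner_le_norm (𝕜 := ℂ) g ψ
    rwa [hg, hψ, one_mul] at this
  have h0 := norm_nonneg ⟪g, ψ⟫_ℂ
  obtain ⟨θ, hθ, hθr⟩ : ∃ θ : ℂ, ‖θ‖ = 1 ∧ RCLike.re (θ * ⟪ψ, g⟫_ℂ) = ‖⟪g, ψ⟫_ℂ‖ := by
    by_cases hz : ⟪g, ψ⟫_ℂ = 0
    · exact ⟨1, by simp, by rw [← inner_conj_symm, hz]; simp⟩
    · have hn : ‖⟪g, ψ⟫_ℂ‖ ≠ 0 := norm_ne_zero_iff.2 hz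
      refine ⟨⟪g, ψ⟫_ℂ / (‖⟪g, ψ⟫_ℂ‖ : ℂ), by simp [hn], ?_⟩
      rw [← inner_conj_symm ψ g, div_mul_eq_mul_div, Complex.mul_conj', sq, mul_div_assoc,
        div_self (by exact_mod_cast hn), mul_one]
      simp
  refine ⟨θ, hθ, ?_⟩
  rw [@norm_sub_sq ℂ, inner_smul_right, hθr, norm_smul, hθ, hg, hψ]
  nlinarith

theorem continuous_commPair {X : Type*} [TopologicalSpace X] {w w' : X → QIdx n → ℂ}
    (hw : Continuous w) (hw' : Continuous w') : Continuous fun x => commPair (w x) (w' x) := by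
  unfold commPair
  fun_prop

/-- Here `(C, m)` enters only through scalar coefficients of fixed vectors, so continuity in the
parameters is visible. -/
theorem incl_cre (C : Fin n → QIdx n → ℂ) (m : QIdx n → ℝ) (j : Fin n) (φ : Sch n) :
    incl n (cre C m j φ) =
      ∑ k, (starRingEnd ℂ) (C j k) • (incl n (quadCore k φ) - (m k : ℂ) • incl n φ) := by
  simp only [cre, linQuad_apply, map_sum, map_smul, map_sub]

/-- A pure Gaussian state is the vacuum of a set of normal modes. -/
theorem IsGaussianState.exists_vacuum {ψ : Hilb n} (hψ : ‖ψ‖ = 1)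
    (hG : IsGaussianState (InnerProductSpace.rankOne ℂ ψ ψ : Op n)) :
    ∃ (C : Fin n → QIdx n → ℂ) (m : QIdx n → ℝ) (g : Sch n), IsCCR C ∧
      FockModes (incl n) (ann C m) (cre C m) g ∧
      Dense (Submodule.span ℂ (Set.range fun L => incl n (word (cre C m) g L)) : Set (Hilb n)) ∧
      ∃ z : ℂ, ‖z‖ = 1 ∧ ψ = z • incl n g := by
  -- The constant gives `4 / 1600 = (1/20)²`, so every approximating vacuum is within `1/20` of `ψ`.
  have hstep : ∀ N : ℕ, ∃ (C : Fin n → QIdx n → ℂ) (m : QIdx n → ℝ) (g : Sch n) (θ : ℂ), IsCCR C ∧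
      FockModes (incl n) (ann C m) (cre C m) g ∧ ‖θ‖ = 1 ∧
      ‖ψ - θ • incl n g‖ ^ 2 ≤ 4 * (1 / 1600 * (1 / ((N : ℝ) + 1))) := by
    intro N
    obtain ⟨β, h, m, σ, hβ, hh, hσ, hlt⟩ := hG.2 (ENNReal.ofReal (1 / 1600 * (1 / ((N : ℝ) + 1))))
      (ENNReal.ofReal_pos.2 (by positivity))
    obtain ⟨C, g, hC, hF, hle⟩ := exists_vacuum_near_of_gibbs hh hβ hσ hψ (by positivity) hlt.le
    obtain ⟨θ, hθ, hθle⟩ := exists_phase hF.norm_vacuum hψ hle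
    exact ⟨C, m, g, θ, hC, hF, hθ, hθle⟩
  choose C m g θ hC hF hθ hclose using hstep
  have hN1 : ∀ N : ℕ, (1 : ℝ) / ((N : ℝ) + 1) ≤ 1 := fun N => by
    rw [div_le_one (by positivity)]
    linarith [(Nat.cast_nonneg N : (0 : ℝ) ≤ N)]
  -- `ψ` is not yet known to have finite moments. A fixed Schwartz function near it serves instead:
  -- it is within `1/10` of all the vacua, so `parameter_bound` is uniform in `N`.
  obtain ⟨φ, hφ⟩ : ∃ φ : Sch n, ‖incl n φ - ψ‖ ≤ 1 / 20 := by
    have hd : DenseRange (SchwartzMap.toLpCLM ℝ ℂ 2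
        (volume : Measure (EuclideanSpace ℝ (Fin n)))) :=
      SchwartzMap.denseRange_toLpCLM ENNReal.ofNat_ne_top
    obtain ⟨_, ⟨φ, rfl⟩, hφ⟩ := Metric.mem_closure_iff.1 (hd ψ) (1 / 20) (by norm_num)
    exact ⟨φ, by rw [dist_comm, dist_eq_norm] at hφ; exact hφ.le⟩
  have hφg : ∀ N, ‖incl n φ - θ N • incl n (g N)‖ ≤ 1 / 10 := by
    intro N
    have h1 : ‖ψ - θ N • incl n (g N)‖ ≤ 1 / 20 := by
      refine abs_le_of_sq_le_sq' ?_ (by norm_num) |>.2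
      refine (hclose N).trans ?_
      linarith [hN1 N]
    calc ‖incl n φ - θ N • incl n (g N)‖ = ‖(incl n φ - ψ) + (ψ - θ N • incl n (g N))‖ := by
          rw [sub_add_sub_cancel]
      _ ≤ 1 / 20 + 1 / 20 := (norm_add_le _ _).trans (add_le_add hφ h1)
      _ = 1 / 10 := by norm_num
  set K : ℝ := ∑ k, 2 * ‖incl n (quadCore k (quadCore k φ))‖ with hK
  have hbound : ∀ N k, m N k ^ 2 + ∑ j, ‖creCoeff (C N) k j‖ ^ 2 ≤
      2 * ‖incl n (quadCore k (quadCore k φ))‖ := fun N k => (hC N).parameter_bound (hF N) (hθ N) (hφg N) k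
  have hmK : ∀ N k, m N k ^ 2 ≤ K := by
    intro N k
    have h1 : 0 ≤ ∑ j, ‖creCoeff (C N) k j‖ ^ 2 := by positivity
    have h2 : 2 * ‖incl n (quadCore k (quadCore k φ))‖ ≤ K :=
      Finset.single_le_sum (f := fun k => 2 * ‖incl n (quadCore k (quadCore k φ))‖)
        (fun k _ => by positivity) (Finset.mem_univ k)
    linarith [hbound N k]
  have hCK : ∀ N j k, ‖C N j k‖ ^ 2 ≤ K := by
    intro N j k
    have h1 : ∑ k, ∑ j, ‖creCoeff (C N) k j‖ ^ 2 ≤ K :=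
      Finset.sum_le_sum fun k _ => by linarith [hbound N k, sq_nonneg (m N k)]
    rw [Finset.sum_comm] at h1
    simp only [sum_norm_creCoeff] at h1
    refine le_trans ?_ h1
    refine le_trans ?_ (Finset.single_le_sum (f := fun j => ∑ k, ‖C N j k‖ ^ 2)
      (fun j _ => by positivity) (Finset.mem_univ j))
    exact Finset.single_le_sum (f := fun k => ‖C N j k‖ ^ 2) (fun k _ => by positivity)
      (Finset.mem_univ k)
  have hmem : ∀ N, ((C N, m N) : (Fin n → QIdx n → ℂ) × (QIdx n → ℝ)) ∈
      Metric.closedBall 0 (√K) := by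
    intro N
    rw [mem_closedBall_zero_iff, Prod.norm_def]
    refine max_le ((pi_norm_le_iff_of_nonneg (Real.sqrt_nonneg _)).2 fun j =>
      (pi_norm_le_iff_of_nonneg (Real.sqrt_nonneg _)).2 fun k => ?_)
      ((pi_norm_le_iff_of_nonneg (Real.sqrt_nonneg _)).2 fun k => ?_)
    · exact Real.le_sqrt_of_sq_le (hCK N j k)
    · refine Real.le_sqrt_of_sq_le ?_
      rw [Real.norm_eq_abs, sq_abs]
      exact hmK N k
  -- Bounded parameters have a convergent subsequence. The commutation relations are closed
  -- conditions and hold in the limit.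
  obtain ⟨⟨C', m'⟩, -, s, hs, hlim⟩ := tendsto_subseq_of_bounded Metric.isBounded_closedBall hmem
  have hlimF : ∀ {Y : Type} [TopologicalSpace Y] (F : (Fin n → QIdx n → ℂ) × (QIdx n → ℝ) → Y),
      Continuous F → Filter.Tendsto (fun N => F (C (s N), m (s N))) Filter.atTop (nhds (F (C', m'))) :=
    fun F hFc => (hFc.tendsto _).comp hlim
  have hC' : IsCCR C' := by
    refine ⟨fun i j => ?_, fun i j => ?_⟩
    · refine tendsto_nhds_unique (hlimF (fun x => commPair (x.1 i) (x.1 j))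
        (continuous_commPair (by fun_prop) (by fun_prop))) ?_
      simp only [(hC _).ann_ann]
      exact tendsto_const_nhds
    · refine tendsto_nhds_unique (hlimF
        (fun x => commPair (x.1 i) (fun k => (starRingEnd ℂ) (x.1 j k)))
        (continuous_commPair (by fun_prop)
          (continuous_pi fun k => Complex.continuous_conj.comp (by fun_prop)))) ?_
      simp only [(hC _).ann_cre]
      exact tendsto_const_nhds
  have hψlim : Filter.Tendsto (fun N => θ (s N) • incl n (g (s N))) Filter.atTop (nhds ψ) := by
    have h1 : Filter.Tendsto (fun N => θ N • incl n (g N)) Filter.atTop (nhds ψ) := by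
      rw [tendsto_iff_norm_sub_tendsto_zero]
      have h2 : Filter.Tendsto (fun N : ℕ => √(4 * (1 / 1600 * (1 / ((N : ℝ) + 1))))) Filter.atTop
          (nhds 0) := by
        have h3 := ((tendsto_one_div_add_atTop_nhds_zero_nat (𝕜 := ℝ)).const_mul
          (1 / 1600 : ℝ)).const_mul 4
        have h4 := (Real.continuous_sqrt.tendsto _).comp h3
        rw [mul_zero, mul_zero, Real.sqrt_zero] at h4
        exact h4
      refine squeeze_zero (fun N => norm_nonneg _) (fun N => ?_) h2
      rw [norm_sub_rev]
      exact Real.le_sqrt_of_sq_le (hclose N)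
    exact h1.comp hs.tendsto_atTop
  obtain ⟨g', hF', hd'⟩ := hC'.exists_fockModes m'
  refine ⟨C', m', g', hC', hF', hd', ?_⟩
  -- Orthogonality of a vacuum to the range of its creation operators passes to the limit, since
  -- both vectors converge.
  have hweak : ∀ j u, ⟪ψ, incl n (cre C' m' j u)⟫_ℂ = 0 := by
    intro j u
    have h1 : Filter.Tendsto (fun N => incl n (cre (C (s N)) (m (s N)) j u)) Filter.atTop
        (nhds (incl n (cre C' m' j u))) := by
      refine hlimF (fun x => incl n (cre x.1 x.2 j u)) ?_
      simp only [incl_cre]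
      refine continuous_finsetSum _ fun k _ => ?_
      have c1 : Continuous fun x : (Fin n → QIdx n → ℂ) × (QIdx n → ℝ) =>
          (starRingEnd ℂ) (x.1 j k) := Complex.continuous_conj.comp (by fun_prop)
      have c2 : Continuous fun x : (Fin n → QIdx n → ℂ) × (QIdx n → ℝ) => ((x.2 k : ℝ) : ℂ) :=
        Complex.continuous_ofReal.comp (by fun_prop)
      exact c1.smul (continuous_const.sub (c2.smul continuous_const))
    refine tendsto_nhds_unique (hψlim.inner h1) ?_
    have h0 : ∀ N, ⟪θ (s N) • incl n (g (s N)), incl n (cre (C (s N)) (m (s N)) j u)⟫_ℂ = 0 := by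
      intro N
      rw [inner_smul_left, (hF (s N)).inner_vacuum_cre, mul_zero]
    simp only [h0]
    exact tendsto_const_nhds
  have heq := hF'.eq_smul_vacuum_of_inner_cre hd' fun j L => hweak j _
  refine ⟨_, ?_, heq⟩
  have := congrArg norm heq
  rw [norm_smul, hF'.norm_vacuum, mul_one, hψ] at this
  exact this.symm

end PureGaussian

/-! ### Moments of states -/

section Moments

variable {H : Type*} [NormedAddCommGroup H] [InnerProductSpace ℂ H] [CompleteSpace H]

theorem formSq_of_mem {T : H →ₗ.[ℂ] H} {f : H} (hf : f ∈ T.domain) :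
    formSq T f = ENNReal.ofReal (‖applyOrZero T f‖ ^ 2) := by
  rw [formSq, applyOrZero, dif_pos hf, dif_pos hf, enorm_sq_eq_ofReal]

/-- `formSq` is infinite off the domain, so a finite sum forces every ensemble vector into it. -/
theorem sqrt_mem_domain {T : H →ₗ.[ℂ] H} {ρ : H →L[ℂ] H} (h : expectSq T ρ ≠ ⊤)
    (i : onbIndex H) : CFC.sqrt ρ (onb H i) ∈ T.domain := by
  by_contra hi
  have h1 : formSq T (CFC.sqrt ρ (onb H i)) ≠ ⊤ := ENNReal.ne_top_of_tsum_ne_top h i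
  rw [formSq, dif_neg hi] at h1
  exact h1 rfl

theorem summable_norm_applyOrZero_sqrt {T : H →ₗ.[ℂ] H} {ρ : H →L[ℂ] H} (h : expectSq T ρ ≠ ⊤) :
    Summable fun i => ‖applyOrZero T (CFC.sqrt ρ (onb H i))‖ ^ 2 := by
  have h1 := ENNReal.summable_toReal h
  simp only [formSq_of_mem (sqrt_mem_domain h _)] at h1
  exact h1.congr fun i => ENNReal.toReal_ofReal (by positivity)

theorem summable_re_inner {κ : Type*} {x y : κ → H} (hx : Summable fun i => ‖x i‖ ^ 2)
    (hy : Summable fun i => ‖y i‖ ^ 2) : Summable fun i => RCLike.re ⟪x i, y i⟫_ℂ := by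
  refine Summable.of_norm_bounded (hx.add hy) fun i => ?_
  have h1 : |RCLike.re ⟪x i, y i⟫_ℂ| ≤ ‖x i‖ * ‖y i‖ :=
    (RCLike.abs_re_le_norm _).trans (norm_inner_le_norm _ _)
  rw [Real.norm_eq_abs]
  nlinarith [sq_nonneg (‖x i‖ - ‖y i‖), norm_nonneg (x i), norm_nonneg (y i)]

theorem IsState.hasSum_expect {ρ : H →L[ℂ] H} (hρ : IsState ρ) {T : H →ₗ.[ℂ] H}
    (h : expectSq T ρ ≠ ⊤) :
    HasSum (fun i => RCLike.re ⟪CFC.sqrt ρ (onb H i), applyOrZero T (CFC.sqrt ρ (onb H i))⟫_ℂ)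
      (expect T ρ) :=
  (summable_re_inner hρ.hasSum_norm_sqrt.summable (summable_norm_applyOrZero_sqrt h)).hasSum

/-- The symmetrized product of `S - s` and `T - t` in the vector `f`. -/
def anticommForm (S T : H →ₗ.[ℂ] H) (s t : ℝ) (f : H) : ℝ :=
  RCLike.re (⟪applyOrZero S f - (s : ℂ) • f, applyOrZero T f - (t : ℂ) • f⟫_ℂ +
    ⟪applyOrZero T f - (t : ℂ) • f, applyOrZero S f - (s : ℂ) • f⟫_ℂ)

theorem anticommForm_eq_two_mul (S T : H →ₗ.[ℂ] H) (s t : ℝ) (f : H) :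
    anticommForm S T s t f =
      2 * RCLike.re ⟪applyOrZero S f - (s : ℂ) • f, applyOrZero T f - (t : ℂ) • f⟫_ℂ := by
  rw [anticommForm, map_add, inner_re_symm (applyOrZero T f - (t : ℂ) • f)]
  ring

theorem anticommForm_eq (S T : H →ₗ.[ℂ] H) (s t : ℝ) (f : H) :
    anticommForm S T s t f = 2 * RCLike.re ⟪applyOrZero S f, applyOrZero T f⟫_ℂ -
      2 * t * RCLike.re ⟪f, applyOrZero S f⟫_ℂ - 2 * s * RCLike.re ⟪f, applyOrZero T f⟫_ℂ +
      2 * s * t * ‖f‖ ^ 2 := by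
  rw [anticommForm_eq_two_mul, inner_sub_left, inner_sub_right, inner_sub_right, inner_smul_left,
    inner_smul_left, inner_smul_right, inner_smul_right, inner_self_eq_norm_sq_to_K,
    Complex.conj_ofReal, ← inner_conj_symm (applyOrZero S f) f]
  simp [← Complex.ofReal_pow, inner_re_symm (𝕜 := ℂ)]
  have := inner_re_symm (𝕜 := ℂ) (applyOrZero S f) f
  simp only [RCLike.re_eq_complex_re] at this
  rw [this]
  ring

theorem anticommForm_smul {S T : H →ₗ.[ℂ] H} {f : H} (hS : f ∈ S.domain) (hT : f ∈ T.domain)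
    (s t : ℝ) (z : ℂ) : anticommForm S T s t (z • f) = ‖z‖ ^ 2 * anticommForm S T s t f := by
  have h : ∀ x y : H, RCLike.re ⟪z • x, z • y⟫_ℂ = ‖z‖ ^ 2 * RCLike.re ⟪x, y⟫_ℂ := fun x y => by
    rw [inner_smul_left, inner_smul_right, ← mul_assoc, Complex.conj_mul', ← Complex.ofReal_pow]
    exact RCLike.re_ofReal_mul _ _
  rw [anticommForm_eq_two_mul, anticommForm_eq_two_mul, applyOrZero_smul S hS,
    applyOrZero_smul T hT, smul_comm _ z f, smul_comm _ z f, ← smul_sub, ← smul_sub, h]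
  ring

/-- The second moments about an arbitrary point. -/
theorem IsState.hasSum_anticommForm {ρ : H →L[ℂ] H} (hρ : IsState ρ) {S T : H →ₗ.[ℂ] H}
    (hS : expectSq S ρ ≠ ⊤) (hT : expectSq T ρ ≠ ⊤) (s t : ℝ) :
    HasSum (fun i => anticommForm S T s t (CFC.sqrt ρ (onb H i)))
      (expectAnticomm S T (expect S ρ) (expect T ρ) ρ +
        2 * ((expect S ρ - s) * (expect T ρ - t))) := by
  have h0 := (summable_re_inner (summable_norm_applyOrZero_sqrt hS)
    (summable_norm_applyOrZero_sqrt hT)).hasSum.mul_left 2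
  set W := 2 * ∑' i, RCLike.re ⟪applyOrZero S (CFC.sqrt ρ (onb H i)),
    applyOrZero T (CFC.sqrt ρ (onb H i))⟫_ℂ with hW
  -- Expansion about an arbitrary point; comparing `(s, t)` with the means gives the shift formula.
  have key : ∀ s t : ℝ, HasSum (fun i => anticommForm S T s t (CFC.sqrt ρ (onb H i)))
      (W - 2 * t * expect S ρ - 2 * s * expect T ρ + 2 * s * t * 1) := by
    intro s t
    simp only [anticommForm_eq]
    exact (((h0.sub ((hρ.hasSum_expect hS).mul_left (2 * t))).sub
      ((hρ.hasSum_expect hT).mul_left (2 * s))).add (hρ.hasSum_norm_sqrt.mul_left (2 * s * t)))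
  have h1 : expectAnticomm S T (expect S ρ) (expect T ρ) ρ = _ :=
    (key (expect S ρ) (expect T ρ)).tsum_eq
  rw [h1]
  convert key s t using 1
  ring

end Moments

/-! ### Moments of pure states -/

section PureMoments

variable {H : Type*} [NormedAddCommGroup H] [InnerProductSpace ℂ H] [CompleteSpace H]

/-- A positive idempotent is its own square root. -/
theorem sqrt_rankOne {ψ : H} (hψ : ‖ψ‖ = 1) :
    CFC.sqrt (InnerProductSpace.rankOne ℂ ψ ψ : H →L[ℂ] H) = InnerProductSpace.rankOne ℂ ψ ψ := by
  refine CFC.sqrt_unique ?_ ?_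
  · exact InnerProductSpace.isIdempotentElem_rankOne_self hψ
  · exact (ContinuousLinearMap.nonneg_iff_isPositive _).2 (InnerProductSpace.isPositive_rankOne_self ψ)

theorem sqrt_rankOne_onb {ψ : H} (hψ : ‖ψ‖ = 1) (i : onbIndex H) :
    CFC.sqrt (InnerProductSpace.rankOne ℂ ψ ψ : H →L[ℂ] H) (onb H i) = ⟪ψ, onb H i⟫_ℂ • ψ := by
  rw [sqrt_rankOne hψ, InnerProductSpace.rankOne_apply]

theorem hasSum_norm_inner_onb {ψ : H} (hψ : ‖ψ‖ = 1) :
    HasSum (fun i => ‖⟪ψ, onb H i⟫_ℂ‖ ^ 2) 1 := by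
  have := hasSum_norm_inner_sq (onb H) ψ
  rw [hψ, one_pow] at this
  simpa only [norm_inner_symm] using this

theorem expectSq_rankOne {T : H →ₗ.[ℂ] H} {ψ : H} (hψ : ‖ψ‖ = 1) (hT : ψ ∈ T.domain) :
    expectSq T (InnerProductSpace.rankOne ℂ ψ ψ) = ENNReal.ofReal (‖applyOrZero T ψ‖ ^ 2) := by
  have h := (hasSum_norm_inner_onb hψ).mul_right (‖applyOrZero T ψ‖ ^ 2)
  rw [one_mul] at h
  rw [expectSq, ← h.tsum_eq, ENNReal.ofReal_tsum_of_nonneg (fun i => by positivity) h.summable]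
  refine tsum_congr fun i => ?_
  rw [sqrt_rankOne_onb hψ, formSq_of_mem (T.domain.smul_mem _ hT), applyOrZero_smul T hT, norm_smul,
    mul_pow]

theorem expect_rankOne {T : H →ₗ.[ℂ] H} {ψ : H} (hψ : ‖ψ‖ = 1) (hT : ψ ∈ T.domain) :
    expect T (InnerProductSpace.rankOne ℂ ψ ψ) = RCLike.re ⟪ψ, applyOrZero T ψ⟫_ℂ := by
  have h := (hasSum_norm_inner_onb hψ).mul_right (RCLike.re ⟪ψ, applyOrZero T ψ⟫_ℂ)
  rw [one_mul] at h
  rw [expect, ← h.tsum_eq]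
  refine tsum_congr fun i => ?_
  rw [sqrt_rankOne_onb hψ, applyOrZero_smul T hT, inner_smul_left, inner_smul_right, ← mul_assoc,
    Complex.conj_mul', ← Complex.ofReal_pow]
  exact RCLike.re_ofReal_mul _ _

theorem expectAnticomm_rankOne {S T : H →ₗ.[ℂ] H} {ψ : H} (hψ : ‖ψ‖ = 1) (hS : ψ ∈ S.domain)
    (hT : ψ ∈ T.domain) (s t : ℝ) :
    expectAnticomm S T s t (InnerProductSpace.rankOne ℂ ψ ψ) = anticommForm S T s t ψ := by
  have h := (hasSum_norm_inner_onb hψ).mul_right (anticommForm S T s t ψ)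
  rw [one_mul] at h
  rw [← h.tsum_eq]
  refine tsum_congr fun i => ?_
  rw [sqrt_rankOne_onb hψ, ← anticommForm_smul hS hT]
  rfl

end PureMoments

/-! ### Quadratic forms of covariance matrices -/

section QuadraticForm

variable {κ : Type*} [Fintype κ]

/-- The real part of `aᴴ D a`. -/
def hermForm (a : κ → ℂ) (D : Matrix κ κ ℝ) : ℝ :=
  ∑ k, ∑ l, ((a k).re * (a l).re + (a k).im * (a l).im) * D k l

theorem hermForm_add (a : κ → ℂ) (D D' : Matrix κ κ ℝ) :
    hermForm a (D + D') = hermForm a D + hermForm a D' := by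
  simp only [hermForm, Matrix.add_apply, mul_add, Finset.sum_add_distrib]

theorem sum_sq_re_im (a : κ → ℂ) :
    ∑ k, (a k).re ^ 2 + ∑ k, (a k).im ^ 2 = ∑ k, ‖a k‖ ^ 2 := by
  rw [← Finset.sum_add_distrib]
  refine Finset.sum_congr rfl fun k _ => ?_
  rw [← Complex.normSq_eq_norm_sq, Complex.normSq_apply]
  ring

/-- Cauchy–Schwarz, separately for the real and imaginary parts of `a`. -/
theorem hermForm_mul_le (a : κ → ℂ) (d : κ → ℝ) :
    hermForm a (Matrix.of fun k l => 2 * (d k * d l)) ≤ 2 * ((∑ k, ‖a k‖ ^ 2) * ∑ k, d k ^ 2) := by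
  have h1 : hermForm a (Matrix.of fun k l => 2 * (d k * d l)) =
      2 * ((∑ k, (a k).re * d k) ^ 2 + (∑ k, (a k).im * d k) ^ 2) := by
    simp only [hermForm, Matrix.of_apply]
    rw [sq, sq, Finset.sum_mul_sum, Finset.sum_mul_sum, ← Finset.sum_add_distrib,
      Finset.mul_sum]
    refine Finset.sum_congr rfl fun k _ => ?_
    rw [← Finset.sum_add_distrib, Finset.mul_sum]
    exact Finset.sum_congr rfl fun l _ => by ring
  rw [h1, ← sum_sq_re_im, add_mul]
  gcongr
  · exact Finset.sum_mul_sq_le_sq_mul_sq _ _ _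
  · exact Finset.sum_mul_sq_le_sq_mul_sq _ _ _

theorem sum_mul_le_opNorm [DecidableEq κ] (u : κ → ℝ) (D : Matrix κ κ ℝ) :
    ∑ k, ∑ l, u k * u l * D k l ≤ opNorm D * ∑ k, u k ^ 2 := by
  set v : EuclideanSpace ℝ κ := WithLp.toLp 2 u with hv
  have h1 : ∑ k, ∑ l, u k * u l * D k l = ⟪v, Matrix.toEuclideanCLM (𝕜 := ℝ) D v⟫_ℝ := by
    rw [PiLp.inner_apply]
    refine Finset.sum_congr rfl fun k _ => ?_
    have : Matrix.toEuclideanCLM (𝕜 := ℝ) D v k = ∑ l, D k l * u l := by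
      rw [Matrix.ofLp_toEuclideanCLM]
      rfl
    rw [this, real_inner_comm, RCLike.inner_apply, conj_trivial, Finset.mul_sum]
    exact Finset.sum_congr rfl fun l _ => by rw [hv]; ring
  have h2 : ‖v‖ ^ 2 = ∑ k, u k ^ 2 := by
    rw [EuclideanSpace.real_norm_sq_eq]
  rw [h1, ← h2]
  refine (real_inner_le_norm _ _).trans ?_
  have := (Matrix.toEuclideanCLM (𝕜 := ℝ) D).le_opNorm v
  rw [opNorm]
  nlinarith [norm_nonneg v]

theorem hermForm_le_opNorm [DecidableEq κ] (a : κ → ℂ) (D : Matrix κ κ ℝ) :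
    hermForm a D ≤ opNorm D * ∑ k, ‖a k‖ ^ 2 := by
  rw [← sum_sq_re_im, mul_add]
  refine le_trans (le_of_eq ?_) (add_le_add (sum_mul_le_opNorm (fun k => (a k).re) D)
    (sum_mul_le_opNorm (fun k => (a k).im) D))
  simp only [hermForm, add_mul, Finset.sum_add_distrib]

/-- The contributions of the imaginary parts of `⟨x k, x l⟩` for `a` and for its conjugate cancel.
This is why the symmetric energy sees only the covariance matrix and not the commutators. -/
theorem norm_sq_sum_add_norm_sq_sum_conj {H : Type*} [NormedAddCommGroup H] [InnerProductSpace ℂ H]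
    (a : κ → ℂ) (x : κ → H) :
    ‖∑ k, a k • x k‖ ^ 2 + ‖∑ k, (starRingEnd ℂ) (a k) • x k‖ ^ 2 =
      hermForm a (Matrix.of fun k l => 2 * RCLike.re ⟪x k, x l⟫_ℂ) := by
  have h : ∀ b : κ → ℂ, ‖∑ k, b k • x k‖ ^ 2 =
      ∑ k, ∑ l, RCLike.re ((starRingEnd ℂ) (b k) * b l * ⟪x k, x l⟫_ℂ) := by
    intro b
    rw [← inner_self_eq_norm_sq (𝕜 := ℂ), sum_inner, map_sum]
    refine Finset.sum_congr rfl fun k _ => ?_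
    rw [inner_sum, map_sum]
    refine Finset.sum_congr rfl fun l _ => ?_
    rw [inner_smul_left, inner_smul_right, mul_assoc]
  rw [h, h, ← Finset.sum_add_distrib]
  refine Finset.sum_congr rfl fun k _ => ?_
  rw [← Finset.sum_add_distrib]
  refine Finset.sum_congr rfl fun l _ => ?_
  simp only [Matrix.of_apply, RCLike.re_eq_complex_re, Complex.mul_re, Complex.conj_re, Complex.conj_im,
    Complex.mul_im]
  ring

/-- An inequality between quadratic forms holds in expectation. -/
theorem IsState.le_sum_hermForm {H : Type*} [NormedAddCommGroup H] [InnerProductSpace ℂ H]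
    [CompleteSpace H] {ρ : H →L[ℂ] H} (hρ : IsState ρ) {T : κ → H →ₗ.[ℂ] H}
    (hT : ∀ k, expectSq (T k) ρ ≠ ⊤) (m : κ → ℝ) {ι : Type*} [Fintype ι] (C : ι → κ → ℂ) {r : ℝ}
    {u : H} (h : ∀ f, (∀ k, f ∈ (T k).domain) → r * ‖f‖ ^ 2 - ‖⟪u, f⟫_ℂ‖ ^ 2 ≤
      (∑ j, hermForm (C j) (Matrix.of fun k l => anticommForm (T k) (T l) (m k) (m l) f)) / 2) :
    r - RCLike.re ⟪u, ρ u⟫_ℂ ≤ (∑ j, hermForm (C j)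
      ((Matrix.of fun k l => expectAnticomm (T k) (T l) (expect (T k) ρ) (expect (T l) ρ) ρ) +
        Matrix.of fun k l => 2 * ((expect (T k) ρ - m k) * (expect (T l) ρ - m l)))) / 2 := by
  have h1 := (hρ.hasSum_norm_sqrt.mul_left r).sub (hasSum_inner_sqrt hρ.isPositive u)
  rw [mul_one] at h1
  have h2 := (hasSum_sum (s := Finset.univ) fun j _ => hasSum_sum (s := Finset.univ) fun k _ =>
    hasSum_sum (s := Finset.univ) fun l _ => (hρ.hasSum_anticommForm (hT k) (hT l) (m k) (m l)).mul_left
      ((C j k).re * (C j l).re + (C j k).im * (C j l).im)).div_const 2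
  exact hasSum_le (fun i => h _ fun k => sqrt_mem_domain (hT k) i) h1 h2

end QuadraticForm

/-! ### The gap inequality for states -/

section Gap

variable {n : ℕ}

theorem expectSq_ne_top {ρ : Op n} (h : energy ρ ≠ ⊤) (k : QIdx n) : expectSq (quad k) ρ ≠ ⊤ := by
  intro hk
  refine h ?_
  rw [energy, ENNReal.div_eq_top]
  exact Or.inr ⟨ENNReal.sum_eq_top.2 ⟨k, Finset.mem_univ k, hk⟩, by norm_num⟩

/-- The deviations `(R̂ₖ - mₖ) f`. -/
def deviation (m : QIdx n → ℝ) (f : Hilb n) (k : QIdx n) : Hilb n :=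
  applyOrZero (quad k) f - (m k : ℂ) • f

/-- This supplies the weak images of `f` under the annihilation and creation operators that
`FockModes.gap` requires. -/
theorem inner_sum_deviation {m : QIdx n → ℝ} {f : Hilb n} (hf : ∀ k, f ∈ (quad k).domain)
    (w : QIdx n → ℂ) (φ : Sch n) :
    ⟪∑ k, w k • deviation m f k, incl n φ⟫_ℂ =
      ⟪f, incl n (linQuad (fun k => (starRingEnd ℂ) (w k)) m φ)⟫_ℂ := by
  rw [linQuad_apply, map_sum, sum_inner, inner_sum]
  refine Finset.sum_congr rfl fun k _ => ?_
  rw [deviation, map_smul, map_sub, map_smul, inner_smul_left, inner_smul_right, inner_sub_left,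
    inner_sub_right, inner_smul_left, inner_smul_right, Complex.conj_ofReal]
  congr 2
  exact applyOrZero_toOperator (hf k) φ

/-- The symmetrized products of the deviations in the vector `f`. -/
def anticommMatrix (m : QIdx n → ℝ) (f : Hilb n) : Matrix (QIdx n) (QIdx n) ℝ :=
  Matrix.of fun k l => anticommForm (quad k) (quad l) (m k) (m l) f

theorem sum_norm_sq_deviation (C : Fin n → QIdx n → ℂ) (m : QIdx n → ℝ) (f : Hilb n) :
    ∑ j, (‖∑ k, C j k • deviation m f k‖ ^ 2 +
      ‖∑ k, (starRingEnd ℂ) (C j k) • deviation m f k‖ ^ 2) =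
      ∑ j, hermForm (C j) (anticommMatrix m f) := by
  refine Finset.sum_congr rfl fun j _ => ?_
  rw [norm_sq_sum_add_norm_sq_sum_conj]
  simp only [anticommMatrix, anticommForm_eq_two_mul, deviation]

theorem gap_vector {C : Fin n → QIdx n → ℂ} {m : QIdx n → ℝ} {g : Sch n}
    (hF : FockModes (incl n) (ann C m) (cre C m) g)
    (hd : Dense (Submodule.span ℂ (Set.range fun L => incl n (word (cre C m) g L)) : Set (Hilb n)))
    {f : Hilb n} (hf : ∀ k, f ∈ (quad k).domain) :
    (1 + (n : ℝ) / 2) * ‖f‖ ^ 2 - ‖⟪incl n g, f⟫_ℂ‖ ^ 2 ≤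
      (∑ j, hermForm (C j) (anticommMatrix m f)) / 2 := by
  have h := hF.gap hd (f := f) (af := fun j => ∑ k, C j k • deviation m f k)
    (cf := fun j => ∑ k, (starRingEnd ℂ) (C j k) • deviation m f k)
    (fun j φ => inner_sum_deviation hf _ φ)
    (fun j φ => by
      rw [inner_sum_deviation hf]
      simp only [Complex.conj_conj]
      rfl)
  rwa [sum_norm_sq_deviation, Fintype.card_fin] at h

/-- `gap_vector` is applied to the vectors `√ρ eᵢ`, which lie in the domains by finiteness of the
energy, and summed. -/
theorem gap_state {C : Fin n → QIdx n → ℂ} {m : QIdx n → ℝ} {g : Sch n}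
    (hF : FockModes (incl n) (ann C m) (cre C m) g)
    (hd : Dense (Submodule.span ℂ (Set.range fun L => incl n (word (cre C m) g L)) : Set (Hilb n)))
    {ρ : Op n} (hρ : IsState ρ) (hE : energy ρ ≠ ⊤) :
    1 + (n : ℝ) / 2 - RCLike.re ⟪incl n g, ρ (incl n g)⟫_ℂ ≤
      (∑ j, hermForm (C j) (covMatrix ρ + Matrix.of fun k l =>
        2 * ((firstMoment ρ k - m k) * (firstMoment ρ l - m l)))) / 2 :=
  hρ.le_sum_hermForm (expectSq_ne_top hE) m C fun _ hf => gap_vector hF hd hf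

end Gap

/-! ### The moments of a vacuum -/

section VacuumMoments

variable {n : ℕ}

theorem inner_cre_cre {C : Fin n → QIdx n → ℂ} {m : QIdx n → ℝ} {g : Sch n}
    (hF : FockModes (incl n) (ann C m) (cre C m) g) (i j : Fin n) :
    ⟪incl n (cre C m i g), incl n (cre C m j g)⟫_ℂ = if i = j then 1 else 0 := by
  rw [hF.adj', hF.comm, hF.vacuum, map_zero, zero_add]
  split_ifs
  · rw [inner_self_eq_norm_sq_to_K, hF.norm_vacuum]
    simp
  · simp

variable {C : Fin n → QIdx n → ℂ} {m : QIdx n → ℝ} {g : Sch n} {ψ : Hilb n} {z : ℂ}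

theorem vacuum_mem_domain (hψ : ψ = z • incl n g) (k : QIdx n) : ψ ∈ (quad k).domain := by
  rw [hψ]
  exact (quad k).domain.smul_mem _ (quad_incl_mem k g)

theorem deviation_vacuum (hψ : ψ = z • incl n g) (k : QIdx n) :
    deviation m ψ k = z • incl n (quadCore k g - (m k : ℂ) • g) := by
  rw [deviation, hψ, applyOrZero_smul _ (quad_incl_mem k g), applyOrZero_quad_incl, map_sub, map_smul,
    smul_sub, smul_comm]

theorem sum_deviation_vacuum (hψ : ψ = z • incl n g) (w : QIdx n → ℂ) :
    ∑ k, w k • deviation m ψ k = z • incl n (linQuad w m g) := by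
  rw [linQuad_apply, map_sum, Finset.smul_sum]
  refine Finset.sum_congr rfl fun k _ => ?_
  rw [deviation_vacuum hψ, map_smul, smul_comm]

/-- Each mode contributes `‖a ψ‖² + ‖a† ψ‖² = 0 + 1`. -/
theorem sum_hermForm_vacuum (hF : FockModes (incl n) (ann C m) (cre C m) g) (hz : ‖z‖ = 1)
    (hψ : ψ = z • incl n g) :
    ∑ j, hermForm (C j) (anticommMatrix m ψ) = n := by
  rw [← sum_norm_sq_deviation]
  have h : ∀ j, ‖∑ k, C j k • deviation m ψ k‖ ^ 2 +
      ‖∑ k, (starRingEnd ℂ) (C j k) • deviation m ψ k‖ ^ 2 = 1 := by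
    intro j
    have ha : linQuad (C j) m g = 0 := hF.vacuum j
    have hc : ‖incl n (linQuad (fun k => (starRingEnd ℂ) (C j k)) m g)‖ ^ 2 = 1 := by
      have := congrArg RCLike.re (inner_cre_cre hF j j)
      rw [if_pos rfl, inner_self_eq_norm_sq] at this
      exact this.trans Complex.one_re
    rw [sum_deviation_vacuum hψ, sum_deviation_vacuum hψ, ha, map_zero, smul_zero, norm_zero,
      norm_smul, hz, one_mul, hc]
    norm_num
  simp [h]

theorem quadCore_vacuum (hC : IsCCR C) (hF : FockModes (incl n) (ann C m) (cre C m) g)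
    (k : QIdx n) : quadCore k g - (m k : ℂ) • g = ∑ j, creCoeff C k j • cre C m j g := by
  rw [hC.quadCore_eq m k g]
  simp only [hF.vacuum, smul_zero, Finset.sum_const_zero, add_zero, add_sub_cancel_left]

theorem inner_vacuum_deviation (hC : IsCCR C) (hF : FockModes (incl n) (ann C m) (cre C m) g)
    (hψ : ψ = z • incl n g) (k : QIdx n) : ⟪ψ, deviation m ψ k⟫_ℂ = 0 := by
  rw [deviation_vacuum hψ, quadCore_vacuum hC hF, hψ, inner_smul_left, inner_smul_right, map_sum,
    inner_sum]
  simp only [map_smul, inner_smul_right, hF.inner_vacuum_cre, mul_zero, Finset.sum_const_zero]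

/-- The deviations expand in the orthonormal one-quantum vectors with coefficients `creCoeff`, which
have the same total norm as `C`. -/
theorem sum_norm_deviation_vacuum (hC : IsCCR C) (hF : FockModes (incl n) (ann C m) (cre C m) g)
    (hz : ‖z‖ = 1) (hψ : ψ = z • incl n g) :
    ∑ k, ‖deviation m ψ k‖ ^ 2 = ∑ j, ∑ k, ‖C j k‖ ^ 2 := by
  simp only [← sum_norm_creCoeff]
  rw [Finset.sum_comm]
  refine Finset.sum_congr rfl fun k _ => ?_
  have ho : Orthonormal ℂ fun j => incl n (cre C m j g) :=
    orthonormal_iff_ite.2 fun i j => inner_cre_cre hF i j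
  rw [deviation_vacuum hψ, quadCore_vacuum hC hF, norm_smul, hz, one_mul, map_sum]
  simp only [map_smul]
  rw [← inner_self_eq_norm_sq (𝕜 := ℂ), ho.inner_sum, map_sum]
  refine Finset.sum_congr rfl fun j _ => ?_
  rw [Complex.conj_mul', ← Complex.ofReal_pow]
  exact Complex.ofReal_re _

theorem firstMoment_vacuum (hC : IsCCR C) (hF : FockModes (incl n) (ann C m) (cre C m) g)
    (hψ1 : ‖ψ‖ = 1) (hψ : ψ = z • incl n g) (k : QIdx n) :
    firstMoment (InnerProductSpace.rankOne ℂ ψ ψ : Op n) k = m k := by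
  have h := inner_vacuum_deviation hC hF hψ k
  rw [deviation, inner_sub_right, inner_smul_right, inner_self_eq_norm_sq_to_K, hψ1, sub_eq_zero] at h
  change expect (quad k) _ = m k
  rw [expect_rankOne hψ1 (vacuum_mem_domain hψ k), h]
  simp

theorem covMatrix_vacuum (hC : IsCCR C) (hF : FockModes (incl n) (ann C m) (cre C m) g)
    (hψ1 : ‖ψ‖ = 1) (hψ : ψ = z • incl n g) :
    covMatrix (InnerProductSpace.rankOne ℂ ψ ψ : Op n) = anticommMatrix m ψ := by
  ext k l
  rw [covMatrix, anticommMatrix, Matrix.of_apply, Matrix.of_apply, firstMoment_vacuum hC hF hψ1 hψ, firstMoment_vacuum hC hF hψ1 hψ,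
    expectAnticomm_rankOne hψ1 (vacuum_mem_domain hψ k) (vacuum_mem_domain hψ l)]

theorem trace_covMatrix_vacuum (hC : IsCCR C) (hF : FockModes (incl n) (ann C m) (cre C m) g)
    (hψ1 : ‖ψ‖ = 1) (hψ : ψ = z • incl n g) :
    (covMatrix (InnerProductSpace.rankOne ℂ ψ ψ : Op n)).trace =
      2 * ∑ k, ‖deviation m ψ k‖ ^ 2 := by
  rw [Matrix.trace, Finset.mul_sum]
  refine Finset.sum_congr rfl fun k _ => ?_
  rw [Matrix.diag_apply, covMatrix_vacuum hC hF hψ1 hψ, anticommMatrix, Matrix.of_apply, anticommForm_eq_two_mul,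
    inner_self_eq_norm_sq]
  rfl

theorem trace_covMatrix_vacuum_nonneg (hC : IsCCR C)
    (hF : FockModes (incl n) (ann C m) (cre C m) g) (hψ1 : ‖ψ‖ = 1) (hψ : ψ = z • incl n g) :
    0 ≤ (covMatrix (InnerProductSpace.rankOne ℂ ψ ψ : Op n)).trace :=
  (trace_covMatrix_vacuum hC hF hψ1 hψ).symm ▸
    mul_nonneg two_pos.le (Finset.sum_nonneg fun _ _ => sq_nonneg _)

/-- Pythagoras: `R̂ₖ ψ` is the deviation plus the orthogonal vector `mₖ ψ`, so the energy is at
least a quarter of the trace. The maximum with zero reflects that `ENNReal.ofReal` truncates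
negative `E`. -/
theorem trace_covMatrix_vacuum_le (hC : IsCCR C) (hF : FockModes (incl n) (ann C m) (cre C m) g)
    (hψ1 : ‖ψ‖ = 1) (hψ : ψ = z • incl n g) {E : ℝ}
    (hE : energy (InnerProductSpace.rankOne ℂ ψ ψ : Op n) ≤ ENNReal.ofReal E) :
    (covMatrix (InnerProductSpace.rankOne ℂ ψ ψ : Op n)).trace ≤ 4 * max E 0 := by
  have h1 : ∀ k, ‖deviation m ψ k‖ ^ 2 ≤ ‖applyOrZero (quad k) ψ‖ ^ 2 := by
    intro k
    have h2 : applyOrZero (quad k) ψ = deviation m ψ k + (m k : ℂ) • ψ := by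
      rw [deviation, sub_add_cancel]
    have h3 : RCLike.re ⟪deviation m ψ k, (m k : ℂ) • ψ⟫_ℂ = 0 := by
      rw [inner_smul_right, ← inner_conj_symm, inner_vacuum_deviation hC hF hψ]
      simp
    rw [h2, @norm_add_sq ℂ, h3]
    nlinarith [sq_nonneg ‖(m k : ℂ) • ψ‖]
  have h2 : energy (InnerProductSpace.rankOne ℂ ψ ψ : Op n) =
      ENNReal.ofReal ((∑ k, ‖applyOrZero (quad k) ψ‖ ^ 2) / 2) := by
    rw [energy, ENNReal.ofReal_div_of_pos two_pos, ENNReal.ofReal_sum_of_nonneg fun k _ => by positivity]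
    simp only [expectSq_rankOne hψ1 (vacuum_mem_domain hψ _)]
    norm_num
  rw [h2, ← max_eq_left (zero_le (a := ENNReal.ofReal E)), ← ENNReal.ofReal_zero, ← ENNReal.ofReal_max,
    ENNReal.ofReal_le_ofReal_iff (le_max_right _ _)] at hE
  rw [trace_covMatrix_vacuum hC hF hψ1 hψ]
  have := Finset.sum_le_sum fun k (_ : k ∈ Finset.univ) => h1 k
  linarith

end VacuumMoments

/-! ### The fidelity bound -/

section Main

variable {n : ℕ}

/-- The quadratic form at `V(ψ)` contributes exactly `n / 2`, cancelling the zero-point term of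
`gap_state`. What remains is linear in `V(ρ) - V(ψ) + 2δδᵀ` and is bounded by the total weight `∑ ‖C
j‖² = ½ Tr V(ψ)`. -/
theorem one_sub_fidelity_le {C : Fin n → QIdx n → ℂ} {m : QIdx n → ℝ} {g : Sch n} {ψ : Hilb n} {z : ℂ}
    (hC : IsCCR C) (hF : FockModes (incl n) (ann C m) (cre C m) g)
    (hd : Dense (Submodule.span ℂ (Set.range fun L => incl n (word (cre C m) g L)) : Set (Hilb n)))
    (hz : ‖z‖ = 1) (hψ1 : ‖ψ‖ = 1) (hψ : ψ = z • incl n g) {ρ : Op n} (hρ : IsState ρ)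
    (hE : energy ρ ≠ ⊤) :
    1 - RCLike.re ⟪ψ, ρ ψ⟫_ℂ ≤
      (covMatrix (InnerProductSpace.rankOne ℂ ψ ψ : Op n)).trace / 4 *
        (2 * ‖firstMoment ρ - firstMoment (InnerProductSpace.rankOne ℂ ψ ψ : Op n)‖ ^ 2 +
          opNorm (covMatrix ρ - covMatrix (InnerProductSpace.rankOne ℂ ψ ψ : Op n))) := by
  set P : Op n := InnerProductSpace.rankOne ℂ ψ ψ with hP
  have hgap := gap_state hF hd hρ hE
  have hfid : RCLike.re ⟪ψ, ρ ψ⟫_ℂ = RCLike.re ⟪incl n g, ρ (incl n g)⟫_ℂ := by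
    rw [hψ, map_smul, inner_smul_left, inner_smul_right, ← mul_assoc, Complex.conj_mul', hz]
    simp
  have hn := sum_hermForm_vacuum hF hz hψ
  rw [← covMatrix_vacuum hC hF hψ1 hψ] at hn
  have htr : ∑ j, ∑ k, ‖C j k‖ ^ 2 = (covMatrix P).trace / 2 := by
    rw [trace_covMatrix_vacuum hC hF hψ1 hψ, sum_norm_deviation_vacuum hC hF hz hψ]
    ring
  have hm : ‖firstMoment ρ - firstMoment P‖ ^ 2 = ∑ k, (firstMoment ρ k - m k) ^ 2 := by
    rw [EuclideanSpace.real_norm_sq_eq]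
    exact Finset.sum_congr rfl fun k _ => by rw [PiLp.sub_apply, firstMoment_vacuum hC hF hψ1 hψ]
  have hj : ∀ j, hermForm (C j) (covMatrix ρ + Matrix.of fun k l =>
      2 * ((firstMoment ρ k - m k) * (firstMoment ρ l - m l))) ≤
      hermForm (C j) (covMatrix P) + (∑ k, ‖C j k‖ ^ 2) *
        (2 * ‖firstMoment ρ - firstMoment P‖ ^ 2 + opNorm (covMatrix ρ - covMatrix P)) := by
    intro j
    have e1 : hermForm (C j) (covMatrix ρ) =
        hermForm (C j) (covMatrix P) + hermForm (C j) (covMatrix ρ - covMatrix P) := by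
      rw [← hermForm_add, add_sub_cancel]
    have e2 := hermForm_le_opNorm (C j) (covMatrix ρ - covMatrix P)
    have e3 := hermForm_mul_le (C j) fun k => firstMoment ρ k - m k
    rw [hermForm_add, e1, hm]
    linarith
  have hsum := Finset.sum_le_sum fun j (_ : j ∈ Finset.univ) => hj j
  rw [Finset.sum_add_distrib, ← Finset.sum_mul, htr] at hsum
  rw [hfid]
  rw [hn] at hsum
  linarith

theorem two_mul_sqrt_le {x t D : ℝ} (ht : 0 ≤ t) (h : x ≤ t / 4 * D) : 2 * √x ≤ √t * √D := by
  have h2 : (2 : ℝ) = √4 := by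
    rw [show (4 : ℝ) = 2 ^ 2 by norm_num, Real.sqrt_sq two_pos.le]
  rw [h2, ← Real.sqrt_mul (by norm_num), ← Real.sqrt_mul ht]
  exact Real.sqrt_le_sqrt (by linarith)

/-- For negative `E` both sides are zero, since `√` vanishes on nonpositive reals. -/
theorem sqrt_le_sqrt_mul_two {t E : ℝ} (h : t ≤ 4 * max E 0) : √t ≤ √E * 2 := by
  have h2 : √(4 * max E 0) = √E * 2 := by
    rw [show (4 : ℝ) = 2 ^ 2 by norm_num, Real.sqrt_mul (by positivity), Real.sqrt_sq two_pos.le,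
      mul_comm]
    rcases le_total E 0 with h | h
    · rw [max_eq_right h, Real.sqrt_eq_zero_of_nonpos h, Real.sqrt_zero]
    · rw [max_eq_left h]
  exact h2 ▸ Real.sqrt_le_sqrt h

theorem ofReal_mul_div_two_le {s e d : ℝ} (hd : 0 ≤ d) (h : s ≤ e * 2) {x : ℝ≥0∞}
    (hx : x ≤ ENNReal.ofReal (s * d)) : x / 2 ≤ ENNReal.ofReal (e * d) := by
  refine ENNReal.div_le_of_le_mul (hx.trans ?_)
  rw [show (2 : ℝ≥0∞) = ENNReal.ofReal 2 by norm_num, ← ENNReal.ofReal_mul' two_pos.le]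
  exact ENNReal.ofReal_le_ofReal (by nlinarith)

end Main

end CVSystem

end

/-! ### The trace-norm bounds -/

theorem mainTheorem6 (n : ℕ) (ψ ρ : CVSystem.Op n)
    (hψ : CVSystem.IsGaussianState ψ) (hψ_pure : CVSystem.IsPure ψ)
    (hρ : CVSystem.IsState ρ) (hρ_energy : CVSystem.energy ρ ≠ ⊤) :
    CVSystem.traceNorm (ρ - ψ) ≤
        ENNReal.ofReal (√(CVSystem.covMatrix ψ).trace *
          √(2 * ‖CVSystem.firstMoment ρ - CVSystem.firstMoment ψ‖ ^ 2 +
            CVSystem.opNorm (CVSystem.covMatrix ρ - CVSystem.covMatrix ψ))) ∧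
      ∀ E : ℝ, CVSystem.energy ψ ≤ ENNReal.ofReal E →
        CVSystem.traceNorm (ρ - ψ) / 2 ≤
          ENNReal.ofReal (√E *
            √(2 * ‖CVSystem.firstMoment ρ - CVSystem.firstMoment ψ‖ ^ 2 +
              CVSystem.opNorm (CVSystem.covMatrix ρ - CVSystem.covMatrix ψ))) := by
  obtain ⟨v, hv, rfl⟩ := hψ_pure
  obtain ⟨C, m, g, hC, hF, hd, z, hz, hvz⟩ := CVSystem.IsGaussianState.exists_vacuum hv hψ
  have hfirst := (CVSystem.traceNorm_sub_rankOne_le hρ hv).trans (ENNReal.ofReal_le_ofReal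
    (CVSystem.two_mul_sqrt_le (CVSystem.trace_covMatrix_vacuum_nonneg hC hF hv hvz)
      (CVSystem.one_sub_fidelity_le hC hF hd hz hv hvz hρ hρ_energy)))
  exact ⟨hfirst, fun E hE => CVSystem.ofReal_mul_div_two_le (Real.sqrt_nonneg _)
    (CVSystem.sqrt_le_sqrt_mul_two (CVSystem.trace_covMatrix_vacuum_le hC hF hv hvz hE)) hfirst⟩
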